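/- **Setting.** Let $n\ge 2$, let $\sigma$ be the surface measure on $\mathbb S^{n-1}$, $\omega_n=\sigma(\mathbb S^{n-1})$, and let $\|\cdot\|_p$ be the norm of $L^p(\sigma)$. Let $C_+=C_+(\mathbb S^{n-1})$ be the set of strictly positive continuous functions on $\mathbb S^{n-1}$, with the uniform topology. A *model* consists of an open set $\mathcal D\subseteq C_+\times\mathbb R^n$ whose sections $\mathcal D_r=\{x:(r,x)\in\mathcal D\}$ are non-empty, a measurable map $F:\mathcal D\to C_+$ with $\int F(r,x,\theta)\,d\sigma(\theta)=1$, and a measurable map $H:C_+\times\mathbb S^{n-1}\to\mathbb R^n$ such that for every $r\in C_+$ and $\sigma$-a.e. $\xi$, $(r',H(r,\xi))\in\mathcal D$ for all $r'\ge r$. Put $$y_{r,x}=\omega_n\!\int r^{n-1}F(r,x,\cdot)\,d\sigma,\quad b(r,x)=\frac{\omega_n}{y_{r,x}}F(r,x,\cdot),\quad h(r,x)=\int H(r,\xi)F(r,x,\xi)\,d\sigma(\xi)-x .$$ For $f$ on $\mathbb S^{n-1}$ and $g$ on $[-1,1]$ let $(f\star g)(z)=\omega_n^{-1}\int f(\theta)g(\langle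 z,\theta\rangle)\,d\sigma(\theta)$. A *local spherical approximate identity* is a family of continuous $g_\eta:[-1,1]\to[0,\infty)$, $\eta>0$, measurable in $\eta$, with $1\star g_\eta=1$, $\|f\star g_\eta\|_2\le\|f\|_2$ and $\|f\star g_\eta-f\|_2\to0$ as $\eta\to 0$ for all $f\in L^2(\sigma)$, with $g_\eta(\langle z,\theta\rangle)=0$ if $|z-\theta|>2\eta$, and with $\sup_{0<\eta<1}\eta^{n-1}\|g_\eta\|_\infty<\infty$. Put $\eta(\varepsilon,r,x)=\varepsilon^{1/n}y_{r,x}^{-1/(n-1)}$ and $b^\varepsilon(r,x)=b(r,x)\star g_{\eta(\varepsilon,r,x)}$. For $\varepsilon>0$, $(R^\varepsilon_t,x^\varepsilon_t)_{t\ge0}$ is the Markov jump process which at the arrival times of a Poisson process of rate $\varepsilon^{-1}$ jumps from $(r,x)$ to $\big(r+\tfrac{\varepsilon}{y_{r,x}}g_{\eta(\varepsilon,r,x)}(\langle\xi,\cdot\rangle),\,H(r,\xi)\big)$, where $\xi$ has density $F(r,x,\cdot)$. For $r\in C_+$, $x^{1,r}$ is the jump process of rate $1$ on $\mathcal D_r$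 which jumps from $x$ to $H(r,\xi)$, where $\xi$ has density $F(r,x,\cdot)$; $\mathsf P_r$ is the transition probability of its embedded chain. An *invariant measure for $r$* is an invariant probability measure of $x^{1,r}$ (carried by $\mathcal D_r$). Given a family $\nu=(\nu_r)_{r\in C_+}$ of such measures, put $\overline b(r)(\theta)=\int b(r,x)(\theta)\,d\nu_r(x)$ and consider the ODE $$r_t(\theta)=r_0(\theta)+\int_0^t\overline b(r_s)(\theta)\,ds ,\qquad \theta\in\mathbb S^{n-1},\ t\ge0, \tag{ODE}$$ whose solutions are continuous maps $t\mapsto r_t$ from $[0,\infty)$ to $C_+$. For $a\in(0,1)$ and $1\le p\le\infty$ let $\mathcal A_p(a)=\{r\in C_+:\inf r\ge a,\ \|r\|_p\le a^{-1}\}$, and let $\mathcal A^{\sf e}_p(a)$ be the set of $(r,x)\in\mathcal D$ with $r\in\mathcal A_p(a)$ and $x\in H(r',\mathbb S^{n-1})$ for some $r'\in\mathcal A_p(a)$ with $r'\le r$. Consider the conditions, with constants $K=K(a)<\infty$ and for all $a\in(0,1)$: - (F$_p$): $\|F(r,x,\cdot)-F(r',x',\cdot)\|_p\le K(\|r-r'\|_p+|x-x'|)$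 on $\mathcal A^{\sf e}_\infty(a)$; - (H): $|H(r,z)-H(r',z')|\le K(\|r-r'\|_2+|z-z'|)$ for $(r,x),(r',x')\in\mathcal A^{\sf e}_\infty(a)$ and $z,z'\in\mathbb S^{n-1}$; - ($\overline{\rm B}_p$): $\|\overline b(r)-\overline b(r')\|_p\le K\|r-r'\|_p$ on $\mathcal A_\infty(a)$; - (U): $F$ is bounded above on $\mathcal A^{\sf e}_2(a)\times\mathbb S^{n-1}$; (Lo): $F$ is bounded away from $0$ on $\mathcal A^{\sf e}_2(a)\times\mathbb S^{n-1}$; - (Bd$_p$): $\|F(r,x,\cdot)\|_p$ is bounded on $\mathcal A^{\sf e}_\infty(a)$. **Proposition.** (a) Let $p\in\{2,\infty\}$. Condition (Bd$_p$) holds whenever (U) holds, or (F$_p$) and (H) hold. If (F$_p$) holds at $a$ with constant $K$, and $\|F(r,x,\cdot)\|_p\le B$ on $\mathcal A^{\sf e}_\infty(a)$, then $\|b(r,x)-b(r',x')\|_p\le C(\|r-r'\|_p+|x-x'|)$ on $\mathcal A^{\sf e}_\infty(a)$, where $C$ depends only on $n,p,a,K,B$. If (F$_2$) and (H) hold at $a$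 with constant $K$, then $|h(r,x)-h(r',x')|\le C(\|r-r'\|_2+|x-x'|)$ on $\mathcal A^{\sf e}_\infty(a)$, where $C$ depends only on $n,a,K$. If (F$_2$), (F$_\infty$), (H), (U) and (Lo) hold, then every $r\in C_+$ has a unique invariant measure $\nu_r$, and ($\overline{\rm B}_2$) and ($\overline{\rm B}_\infty$) hold. (b) Let $\nu$ be a family of invariant measures such that ($\overline{\rm B}_\infty$) holds, and let (U) hold. Then for every $r_0\in C_+$, (ODE) has a unique $C_+$-valued solution on $[0,\infty)$, and for every $T$ there is $a_1=a_1(r_0,T)\in(0,1)$ with $r_t\in\mathcal A_\infty(a_1)$ for all $t\in[0,T]$. (c) Assume (Bd$_2$), and that for every $a\in(0,1)$ there are $n_0\ge1$ and $\delta>0$ such that for every $r$ there is a probability measure $m_r$ on $\mathbb R^n$ with $(\mathsf P_r)^{n_0}(x,\cdot)\ge\delta\, m_r(\cdot)$ for all $x$ with $(r,x)\in\mathcal A^{\sf e}_\infty(a)$. Then Assumption (E) holds: every $r\in C_+$ has a unique invariant measure $\nu_r$, and for every $a\in(0,1)$ there is $\lambda(\cdot,a):(0,\infty)\to[0,\infty)$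 with $\lambda(t,a)\to0$ as $t\to\infty$ and $$\sup_{(r,x)\in\mathcal A^{\sf e}_\infty(a)}\ \sup_{t_0\ge0}\ \mathbb E_x\Big[\Big\|\frac1t\int_{t_0}^{t_0+t}\big[b(r,x^{1,r}_s)-\overline b(r)\big]ds\Big\|_2^2\Big]\le\lambda(t,a),\qquad t>0 .$$ (d) Suppose that for every $a\in(0,1)$ the functions $F(r,x,\cdot)$, $(r,x)\in\mathcal A^{\sf e}_\infty(a)$, are Lipschitz with a common constant. Let $r_0\in C_+$, let $R^\varepsilon_0=r_0$, and let $x^\varepsilon_0$ either be a fixed point of $\mathcal D_{r_0}$ or satisfy $(r_0,x_0^\varepsilon)\in\mathcal A^{\sf e}_\infty(a)$ for some $a\in(0,1)$ and all $\varepsilon\in(0,1]$. Then Assumption (C) holds: with $\zeta^\varepsilon(\delta)=\inf\{t>0:\|R^\varepsilon_t\|_\infty>\delta^{-1}\}$, for all $t\ge0$ and $\delta>0$, $$\big\|b^\varepsilon(R^\varepsilon_{t\wedge\zeta^\varepsilon(\delta)},x^\varepsilon_{t\wedge\zeta^\varepsilon(\delta)})-b(R^\varepsilon_{t\wedge\zeta^\varepsilon(\delta)},x^\varepsilon_{t\wedge\zeta^\varepsilon(\delta)})\big\|_2\to0\quad\text{in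 probability as }\varepsilon\to0 .$$ (e) Let (U) hold, let $\nu$ be a family of invariant measures, let $(r_t)_{t\ge0}$ be a solution of (ODE) from $r_0\in C_+$, and let $T\ge0$. Put $\kappa^\varepsilon=\inf\{t\ge0:\|R^\varepsilon_t\|_2>1+\|r_T\|_2\}$. There is $\delta_n=\delta_n(r_0,T)>0$ such that, for $R^\varepsilon_0=r_0$, arbitrary $x^\varepsilon_0\in\mathcal D_{r_0}$ and every $0<\delta<\delta_n$, $\lim_{\varepsilon\to0}\mathbb P(\zeta^\varepsilon(\delta)<T\wedge\kappa^\varepsilon)=0$. -/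

import Mathlib

open MeasureTheory ProbabilityTheory Filter Topology Set
open scoped NNReal ENNReal

noncomputable section

namespace StarGrowth

/-! ### The sphere, positive continuous functions, spherical convolution -/

/-- Euclidean space `ℝⁿ`. -/
abbrev Eucl (n : ℕ) : Type := EuclideanSpace ℝ (Fin n)

/-- The unit sphere of `ℝⁿ`. -/
abbrev Sph (n : ℕ) : Type := Metric.sphere (0 : Eucl n) 1

/-- The Euclidean surface measure of the unit sphere. -/
abbrev surf (n : ℕ) : Measure (Sph n) := (volume : Measure (Eucl n)).toSphere

/-- The total surface area of the unit sphere. -/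
def area (n : ℕ) : ℝ := (surf n).real univ

/-- Spaces of continuous real functions carry the Borel `σ`-algebra. -/
instance instMeasurableSpaceC {X : Type*} [TopologicalSpace X] : MeasurableSpace C(X, ℝ) :=
  borel _

instance instBorelSpaceC {X : Type*} [TopologicalSpace X] : BorelSpace C(X, ℝ) := ⟨rfl⟩

/-- Strictly positive continuous functions on the sphere, with the topology of uniform
convergence, its Borel `σ`-algebra, and the pointwise order. -/
abbrev Cplus (n : ℕ) : Type := {r : C(Sph n, ℝ) // ∀ θ, 0 < r θ}

/-- `⟨ξ, θ⟩` as a point of `[-1, 1]`. -/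
def sphInner {n : ℕ} (ξ θ : Sph n) : Icc (-1 : ℝ) 1 :=
  ⟨inner ℝ (ξ : Eucl n) (θ : Eucl n), by
    have h : |inner ℝ (ξ : Eucl n) (θ : Eucl n)| ≤ 1 := by
      refine (abs_real_inner_le_norm _ _).trans ?_
      simp
    exact abs_le.mp h⟩

lemma continuous_sphInner {n : ℕ} : Continuous fun p : Sph n × Sph n => sphInner p.1 p.2 := by
  unfold sphInner
  fun_prop

/-- `⟨ξ, ·⟩` as a continuous map from the sphere to `[-1, 1]`. -/
def sphInnerC {n : ℕ} (ξ : Sph n) : C(Sph n, Icc (-1 : ℝ) 1) :=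
  ⟨sphInner ξ, continuous_sphInner.comp (Continuous.prodMk_right ξ)⟩

lemma continuous_sphInnerC {n : ℕ} : Continuous (sphInnerC (n := n)) :=
  ContinuousMap.continuous_of_continuous_uncurry _ continuous_sphInner

/-- Spherical convolution `(f ⋆ g)(z) = ω_n⁻¹ ∫ f(θ) g(⟨z, θ⟩) dσ(θ)`. -/
def conv {n : ℕ} (f : Sph n → ℝ) (g : C(Icc (-1 : ℝ) 1, ℝ)) (z : Sph n) : ℝ :=
  (area n)⁻¹ * ∫ θ, f θ * g (sphInner z θ) ∂(surf n)

/-- A local spherical approximate identity `(g_η)_{η > 0}`.  Only the values of `g` at `η > 0`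
are ever used. -/
structure BumpFamily (n : ℕ) where
  g : ℝ → C(Icc (-1 : ℝ) 1, ℝ)
  measurable_g : Measurable g
  nonneg : ∀ η t, 0 ≤ g η t
  conv_one : ∀ η, 0 < η → ∀ z : Sph n, conv (fun _ => 1) (g η) z = 1
  contraction : ∀ η, 0 < η → ∀ f : Sph n → ℝ, MemLp f 2 (surf n) →
    eLpNorm (conv f (g η)) 2 (surf n) ≤ eLpNorm f 2 (surf n)
  approx : ∀ f : Sph n → ℝ, MemLp f 2 (surf n) →
    Tendsto (fun η => eLpNorm (fun z => conv f (g η) z - f z) 2 (surf n)) (𝓝[>] 0) (𝓝 0)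
  support : ∀ η, 0 < η → ∀ z θ : Sph n, 2 * η < dist z θ → g η (sphInner z θ) = 0
  bounded : ∃ Λ : ℝ, ∀ η ∈ Ioo (0 : ℝ) 1, ∀ t, η ^ (n - 1) * g η t ≤ Λ

/-! ### The growth model -/

/-- The two rules `F` (hitting density) and `H` (transport) of the growth model. -/
structure GrowthModel (n : ℕ) where
  /-- the domain of `F` -/
  dom : Set (Cplus n × Eucl n)
  isOpen_dom : IsOpen dom
  dom_nonempty : ∀ r, ∃ x, (r, x) ∈ dom
  F : dom → Cplus n
  measurable_F : Measurable F
  integral_F : ∀ q, ∫ θ, (F q).1 θ ∂(surf n) = 1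
  H : Cplus n → Sph n → Eucl n
  measurable_H : Measurable fun p : Cplus n × Sph n => H p.1 p.2
  /-- The iteration of the rules is almost surely well defined. -/
  admissible : ∀ r, ∀ᵐ ξ ∂(surf n), ∀ r', r ≤ r' → (r', H r ξ) ∈ dom

namespace GrowthModel

lemma area_pos {n : ℕ} (M : GrowthModel n) : 0 < area n := by
  obtain ⟨x, hx⟩ := M.dom_nonempty ⟨ContinuousMap.const _ 1, fun _ => one_pos⟩
  have h := M.integral_F ⟨_, hx⟩
  refine lt_of_le_of_ne measureReal_nonneg fun h0 => ?_
  have h1 : surf n = 0 := by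
    rw [← Measure.measure_univ_eq_zero]
    exact (measureReal_eq_zero_iff).1 h0.symm
  rw [h1] at h
  simp at h

variable {n : ℕ} (M : GrowthModel n)

open Classical in
/-- The hitting density: `F` on its domain, extended by the uniform density (a mere
convention, which lets all kernels be defined on the full space). -/
def dens (p : Cplus n × Eucl n) : Cplus n :=
  if h : p ∈ M.dom then M.F ⟨p, h⟩
  else ⟨ContinuousMap.const _ (area n)⁻¹, fun _ => inv_pos.2 M.area_pos⟩

lemma measurable_dens : Measurable M.dens := by
  classical
  exact Measurable.dite M.measurable_F measurable_const M.isOpen_dom.measurableSet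

lemma integral_dens (p : Cplus n × Eucl n) : ∫ θ, (M.dens p).1 θ ∂(surf n) = 1 := by
  by_cases h : p ∈ M.dom
  · simp only [dens, h, dite_true]
    exact M.integral_F _
  · simp only [dens, h, dite_false, ContinuousMap.const_apply, integral_const, smul_eq_mul]
    exact mul_inv_cancel₀ M.area_pos.ne'

lemma continuous_eval : Continuous fun q : Cplus n × Sph n => q.1.1 q.2 := by
  fun_prop

lemma measurable_dens_eval :
    Measurable fun q : (Cplus n × Eucl n) × Sph n => (M.dens q.1).1 q.2 :=
  continuous_eval.measurable.comp
    ((M.measurable_dens.comp measurable_fst).prodMk measurable_snd)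

/-- The volume normalisation `y_{r,x} = ω_n ∫ r(θ)^{n-1} F(r, x, θ) dσ(θ)`. -/
def y (p : Cplus n × Eucl n) : ℝ :=
  area n * ∫ θ, p.1.1 θ ^ (n - 1) * (M.dens p).1 θ ∂(surf n)

lemma measurable_y : Measurable M.y := by
  unfold y
  refine Measurable.const_mul ?_ _
  have h : Measurable fun q : (Cplus n × Eucl n) × Sph n =>
      q.1.1.1 q.2 ^ (n - 1) * (M.dens q.1).1 q.2 :=
    ((continuous_eval.measurable.comp
      ((measurable_fst.comp measurable_fst).prodMk measurable_snd)).pow_const _).mul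
      M.measurable_dens_eval
  exact h.stronglyMeasurable.integral_prod_right'.measurable

lemma y_nonneg (p : Cplus n × Eucl n) : 0 ≤ M.y p :=
  mul_nonneg M.area_pos.le (integral_nonneg fun θ =>
    mul_nonneg (pow_nonneg (p.1.2 θ).le _) ((M.dens p).2 θ).le)

/-- The spherical scale `η(ε, r, x) = ε^{1/n} y_{r,x}^{-1/(n-1)}`. -/
def scale (ε : ℝ≥0) (p : Cplus n × Eucl n) : ℝ :=
  (ε : ℝ) ^ (1 / (n : ℝ)) * M.y p ^ (-(1 / ((n : ℝ) - 1)))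

lemma measurable_scale (ε : ℝ≥0) : Measurable (M.scale ε) :=
  (M.measurable_y.pow_const _).const_mul _

/-- The drift `b(r, x) = (ω_n / y_{r,x}) F(r, x, ·)`. -/
def b (p : Cplus n × Eucl n) (θ : Sph n) : ℝ := area n / M.y p * (M.dens p).1 θ

/-- The smoothed drift `b^ε(r, x) = b(r, x) ⋆ g_{η(ε, r, x)}`. -/
def bEps (G : BumpFamily n) (ε : ℝ≥0) (p : Cplus n × Eucl n) : Sph n → ℝ :=
  conv (M.b p) (G.g (M.scale ε p))

/-- The drift `h(r, x) = ∫ H(r, ξ) F(r, x, ξ) dσ(ξ) - x` of the particle. -/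
def h (p : Cplus n × Eucl n) : Eucl n :=
  (∫ ξ, (M.dens p).1 ξ • M.H p.1 ξ ∂(surf n)) - p.2

/-- The averaged drift `∫ b(r, x)(θ) dν_r(x)` for a family `ν` of measures. -/
def bBar (ν : Cplus n → Measure (Eucl n)) (r : Cplus n) (θ : Sph n) : ℝ :=
  ∫ x, M.b (r, x) θ ∂(ν r)

/-! ### The jump kernels -/

/-- The law `F(r, x, ·) dσ` of the hitting angle, as a Markov kernel. -/
def hitKernel : Kernel (Cplus n × Eucl n) (Sph n) :=
  Kernel.withDensity (Kernel.const _ (surf n)) fun p θ => ENNReal.ofReal ((M.dens p).1 θ)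

lemma hitKernel_apply (p : Cplus n × Eucl n) :
    M.hitKernel p = (surf n).withDensity fun θ => ENNReal.ofReal ((M.dens p).1 θ) := by
  rw [hitKernel, Kernel.withDensity_apply]
  · simp
  · exact M.measurable_dens_eval.ennreal_ofReal

instance : IsMarkovKernel M.hitKernel := by
  refine ⟨fun p => ⟨?_⟩⟩
  have hint : Integrable (fun θ => (M.dens p).1 θ) (surf n) := by
    by_contra hc
    have h := M.integral_dens p
    rw [integral_undef hc] at h
    exact zero_ne_one h
  rw [hitKernel_apply, withDensity_apply _ MeasurableSet.univ, Measure.restrict_univ,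
    ← ofReal_integral_eq_lintegral_ofReal hint (ae_of_all _ fun θ => ((M.dens p).2 θ).le),
    M.integral_dens, ENNReal.ofReal_one]

/-- The new state after a particle hits the boundary at the angle `ξ`: the domain becomes
`r + (ε / y_{r,x}) g_{η(ε,r,x)}(⟨ξ, ·⟩)` and the particle is moved to `H(r, ξ)`. -/
def update (G : BumpFamily n) (ε : ℝ≥0) (q : (Cplus n × Eucl n) × Sph n) : Cplus n × Eucl n :=
  (⟨q.1.1.1 + ((ε : ℝ) / M.y q.1) • (G.g (M.scale ε q.1)).comp (sphInnerC q.2), fun θ => by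
      have h1 := q.1.1.2 θ
      have h2 : 0 ≤ (ε : ℝ) / M.y q.1 := div_nonneg ε.2 (M.y_nonneg _)
      have h3 := G.nonneg (M.scale ε q.1) (sphInnerC q.2 θ)
      simp only [ContinuousMap.add_apply, ContinuousMap.smul_apply, ContinuousMap.comp_apply,
        smul_eq_mul]
      positivity⟩,
    M.H q.1.1 q.2)

lemma measurable_update (G : BumpFamily n) (ε : ℝ≥0) : Measurable (M.update G ε) := by
  refine Measurable.prodMk (Measurable.subtype_mk ?_)
    (M.measurable_H.comp ((measurable_fst.comp measurable_fst).prodMk measurable_snd))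
  have hy : Measurable fun q : (Cplus n × Eucl n) × Sph n => (ε : ℝ) / M.y q.1 :=
    (M.measurable_y.comp measurable_fst).const_div _
  have hg : Measurable fun q : (Cplus n × Eucl n) × Sph n => G.g (M.scale ε q.1) :=
    G.measurable_g.comp ((M.measurable_scale ε).comp measurable_fst)
  have hc : Continuous fun z : ℝ × C(Icc (-1 : ℝ) 1, ℝ) × C(Sph n, ℝ) × Sph n =>
      z.2.2.1 + z.1 • z.2.1.comp (sphInnerC z.2.2.2) := by
    have : Continuous fun z : ℝ × C(Icc (-1 : ℝ) 1, ℝ) × C(Sph n, ℝ) × Sph n =>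
        z.2.1.comp (sphInnerC z.2.2.2) :=
      ContinuousMap.continuous_comp'.comp
        ((continuous_sphInnerC.comp (by fun_prop)).prodMk (by fun_prop))
    fun_prop
  exact hc.measurable.comp (hy.prodMk (hg.prodMk
    ((measurable_subtype_coe.comp (measurable_fst.comp measurable_fst)).prodMk measurable_snd)))

/-- One jump of the chain (domain, particle). -/
def stepKernel (G : BumpFamily n) (ε : ℝ≥0) : Kernel (Cplus n × Eucl n) (Cplus n × Eucl n) :=
  (Kernel.id ×ₖ M.hitKernel).map (M.update G ε)

instance (G : BumpFamily n) (ε : ℝ≥0) : IsMarkovKernel (M.stepKernel G ε) :=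
  Kernel.IsMarkovKernel.map _ (M.measurable_update G ε)

lemma stepKernel_apply (G : BumpFamily n) (ε : ℝ≥0) (p : Cplus n × Eucl n) :
    M.stepKernel G ε p = (M.hitKernel p).map fun ξ => M.update G ε (p, ξ) := by
  rw [stepKernel, Kernel.map_apply _ (M.measurable_update G ε), Kernel.prod_apply,
    Kernel.id_apply, Measure.dirac_prod,
    Measure.map_map (M.measurable_update G ε) measurable_prodMk_left]
  rfl

/-- One jump of the particle in the frozen domain `r`: the transition probability `P_r` of the
embedded chain. -/
def frozenKernel (r : Cplus n) : Kernel (Eucl n) (Eucl n) :=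
  (M.hitKernel.comap (fun x => (r, x)) measurable_prodMk_left).map (M.H r)

lemma measurable_H_right (r : Cplus n) : Measurable (M.H r) :=
  M.measurable_H.comp measurable_prodMk_left

instance (r : Cplus n) : IsMarkovKernel (M.frozenKernel r) :=
  Kernel.IsMarkovKernel.map _ (M.measurable_H_right r)

lemma frozenKernel_apply (r : Cplus n) (x : Eucl n) :
    M.frozenKernel r x = (M.hitKernel (r, x)).map (M.H r) := by
  rw [frozenKernel, Kernel.map_apply _ (M.measurable_H_right r), Kernel.comap_apply]

end GrowthModel

/-! ### Markov jump processes -/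

section Jump

variable {α : Type*} [MeasurableSpace α]

/-- The law of the Markov chain with transition kernel `κ` and initial law `μ`. -/
def chainLaw (κ : Kernel α α) [IsMarkovKernel κ] (μ : Measure α) : Measure (ℕ → α) :=
  Kernel.trajMeasure (X := fun _ => α) μ fun k =>
    κ.comap (fun z : (i : Finset.Iic k) → α => z ⟨k, Finset.mem_Iic.2 le_rfl⟩)
      (measurable_pi_apply _)

/-- Independent exponential waiting times of unit rate. -/
def clockLaw : Measure (ℕ → ℝ) := Measure.infinitePi fun _ => expMeasure 1

/-- The law of a unit rate clock together with an independent Markov chain. -/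
def jumpLaw (κ : Kernel α α) [IsMarkovKernel κ] (μ : Measure α) :
    Measure ((ℕ → ℝ) × (ℕ → α)) :=
  clockLaw.prod (chainLaw κ μ)

/-- The time of the `k`-th arrival of the Poisson process of rate `1 / ε`, that is, `ε` times
the `k`-th arrival time of the unit rate clock. -/
def arrival (ε : ℝ≥0) (τ : ℕ → ℝ) (k : ℕ) : ℝ := ∑ i ∈ Finset.range k, (ε : ℝ) * τ i

/-- The number of arrivals up to time `t`. -/
def arrivalCount (ε : ℝ≥0) (τ : ℕ → ℝ) (t : ℝ) : ℕ := sSup {k | arrival ε τ k ≤ t}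

/-- The state at time `t` of the jump process of jump rate `1 / ε`: the chain after the number
of jumps which occurred up to time `t`. -/
def pathAt (ε : ℝ≥0) (w : (ℕ → ℝ) × (ℕ → α)) (t : ℝ) : α := w.2 (arrivalCount ε w.1 t)

end Jump

namespace GrowthModel

variable {n : ℕ} (M : GrowthModel n)

/-- The law (on clocks and chains) of the process `(R^ε, x^ε)` started at `p`. -/
def procLaw (G : BumpFamily n) (ε : ℝ≥0) (p : Cplus n × Eucl n) :
    Measure ((ℕ → ℝ) × (ℕ → Cplus n × Eucl n)) :=
  jumpLaw (M.stepKernel G ε) (Measure.dirac p)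

/-- The law (on clocks and chains) of the particle process `x^{1,r}` in the frozen domain `r`,
with initial law `μ`. -/
def frozenLaw (r : Cplus n) (μ : Measure (Eucl n)) : Measure ((ℕ → ℝ) × (ℕ → Eucl n)) :=
  jumpLaw (M.frozenKernel r) μ

/-- `ν` is an invariant probability measure of the frozen particle process `x^{1,r}`, whose
state space is `{x | (r, x) ∈ dom}`: started from `ν`, the process has law `ν` at all times. -/
def IsInvariant (r : Cplus n) (ν : Measure (Eucl n)) : Prop :=
  IsProbabilityMeasure ν ∧ ν {x | (r, x) ∈ M.dom} = 1 ∧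
    ∀ t : ℝ, 0 ≤ t → (M.frozenLaw r ν).map (fun w => pathAt 1 w t) = ν

/-! ### The sets `𝒜_p(a)`, `𝒜ᵉ_p(a)` and the regularity conditions -/

/-- `𝒜_p(a)`: functions with `inf r ≥ a` and `‖r‖_p ≤ 1 / a`. -/
def A (n : ℕ) (p : ℝ≥0∞) (a : ℝ) : Set (Cplus n) :=
  {r | (∀ θ, a ≤ r.1 θ) ∧ eLpNorm r.1 p (surf n) ≤ ENNReal.ofReal a⁻¹}

/-- `𝒜ᵉ_p(a)`: pairs `(r, x)` in the domain of `F` such that `r ∈ 𝒜_p(a)` and `x` is in the image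
of `H(r', ·)` for some `r' ≤ r` in `𝒜_p(a)`. -/
def Ae (p : ℝ≥0∞) (a : ℝ) : Set (Cplus n × Eucl n) :=
  {q | q ∈ M.dom ∧ q.1 ∈ A n p a ∧ ∃ r' ∈ A n p a, r' ≤ q.1 ∧ q.2 ∈ range (M.H r')}

/-- `F` is Lipschitz in `L^p` on `𝒜ᵉ_∞(a)`, with constant `K`. -/
def LipF (p : ℝ≥0∞) (a : ℝ) (K : ℝ≥0) : Prop :=
  ∀ q ∈ M.Ae ∞ a, ∀ q' ∈ M.Ae ∞ a,
    eLpNorm (fun θ => (M.dens q).1 θ - (M.dens q').1 θ) p (surf n) ≤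
      K * (eLpNorm (fun θ => q.1.1 θ - q'.1.1 θ) p (surf n) + edist q.2 q'.2)

/-- `H` is Lipschitz on `𝒜_∞(a) × 𝕊^{n-1}`, with constant `K`. -/
def LipH (a : ℝ) (K : ℝ≥0) : Prop :=
  ∀ q ∈ M.Ae ∞ a, ∀ q' ∈ M.Ae ∞ a, ∀ z z' : Sph n,
    edist (M.H q.1 z) (M.H q'.1 z') ≤
      K * (eLpNorm (fun θ => q.1.1 θ - q'.1.1 θ) 2 (surf n) + edist z z')

/-- The averaged drift is Lipschitz in `L^p` on `𝒜_∞(a)`, with constant `K`. -/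
def LipBar (ν : Cplus n → Measure (Eucl n)) (p : ℝ≥0∞) (a : ℝ) (K : ℝ≥0) : Prop :=
  ∀ r ∈ A n ∞ a, ∀ r' ∈ A n ∞ a,
    eLpNorm (fun θ => M.bBar ν r θ - M.bBar ν r' θ) p (surf n) ≤
      K * eLpNorm (fun θ => r.1 θ - r'.1 θ) p (surf n)

/-- `b` is Lipschitz in `L^p` on `𝒜ᵉ_∞(a)`, with constant `C`. -/
def LipB (p : ℝ≥0∞) (a : ℝ) (C : ℝ≥0) : Prop :=
  ∀ q ∈ M.Ae ∞ a, ∀ q' ∈ M.Ae ∞ a,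
    eLpNorm (fun θ => M.b q θ - M.b q' θ) p (surf n) ≤
      C * (eLpNorm (fun θ => q.1.1 θ - q'.1.1 θ) p (surf n) + edist q.2 q'.2)

/-- `h` is Lipschitz on `𝒜ᵉ_∞(a)`, with constant `C`. -/
def Liph (a : ℝ) (C : ℝ≥0) : Prop :=
  ∀ q ∈ M.Ae ∞ a, ∀ q' ∈ M.Ae ∞ a,
    edist (M.h q) (M.h q') ≤
      C * (eLpNorm (fun θ => q.1.1 θ - q'.1.1 θ) 2 (surf n) + edist q.2 q'.2)

/-- `‖F(r, x, ·)‖_p ≤ B` on `𝒜ᵉ_∞(a)`. -/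
def BddF (p : ℝ≥0∞) (a : ℝ) (B : ℝ≥0) : Prop :=
  ∀ q ∈ M.Ae ∞ a, eLpNorm (M.dens q).1 p (surf n) ≤ B

/-- For every `a ∈ (0,1)`, `F` is bounded above on `𝒜ᵉ_2(a) × 𝕊^{n-1}`. -/
def UpperF : Prop :=
  ∀ a ∈ Ioo (0 : ℝ) 1, ∃ B : ℝ, ∀ q ∈ M.Ae 2 a, ∀ θ, (M.dens q).1 θ ≤ B

/-- For every `a ∈ (0,1)`, `F` is bounded away from zero on `𝒜ᵉ_2(a) × 𝕊^{n-1}`. -/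
def LowerF : Prop :=
  ∀ a ∈ Ioo (0 : ℝ) 1, ∃ c : ℝ, 0 < c ∧ ∀ q ∈ M.Ae 2 a, ∀ θ, c ≤ (M.dens q).1 θ

/-- For every `a ∈ (0,1)`, the functions `F(r, x, ·)`, `(r, x) ∈ 𝒜ᵉ_∞(a)`, are uniformly
Lipschitz. -/
def UnifLipF : Prop :=
  ∀ a ∈ Ioo (0 : ℝ) 1, ∃ L : ℝ≥0, ∀ q ∈ M.Ae ∞ a, LipschitzWith L (M.dens q).1

/-- For every `a ∈ (0,1)`, the embedded frozen chains satisfy a minorisation condition, uniform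
over `𝒜ᵉ_∞(a)`. -/
def Minorisation : Prop :=
  ∀ a ∈ Ioo (0 : ℝ) 1, ∃ n₀ : ℕ, 1 ≤ n₀ ∧ ∃ δ : ℝ, 0 < δ ∧
    ∀ r : Cplus n, ∃ m : Measure (Eucl n), IsProbabilityMeasure m ∧
      ∀ x, (r, x) ∈ M.Ae ∞ a → ENNReal.ofReal δ • m ≤ (M.frozenKernel r ^ n₀) x

/-! ### The averaged equation, and the assumptions (E) and (C) -/

/-- `r` is a `C_+`-valued solution on `[0, ∞)` of `r_t = r_0 + ∫_0^t b̄(r_s) ds`. -/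
def IsSolution (ν : Cplus n → Measure (Eucl n)) (r₀ : Cplus n) (r : ℝ → Cplus n) : Prop :=
  ContinuousOn r (Ici 0) ∧ r 0 = r₀ ∧ ∀ t : ℝ, 0 ≤ t → ∀ θ : Sph n,
    IntervalIntegrable (fun s => M.bBar ν (r s) θ) volume 0 t ∧
      (r t).1 θ = r₀.1 θ + ∫ s in (0 : ℝ)..t, M.bBar ν (r s) θ

/-- Assumption (E): for every `r` the frozen particle process has a unique invariant probability
measure `ν_r`, and its time averages of `b(r, ·)` converge to `b̄(r)` in mean square, uniformly
over `𝒜ᵉ_∞(a)` and over the starting time of the averaging. -/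
def AssumptionE : Prop :=
  (∀ r, ∃! μ, M.IsInvariant r μ) ∧
    ∀ ν : Cplus n → Measure (Eucl n), (∀ r, M.IsInvariant r (ν r)) →
      ∀ a ∈ Ioo (0 : ℝ) 1, ∃ rate : ℝ → ℝ≥0, Tendsto rate atTop (𝓝 0) ∧
        ∀ t : ℝ, 0 < t → ∀ r x, (r, x) ∈ M.Ae ∞ a → ∀ t₀ : ℝ, 0 ≤ t₀ →
          ∫⁻ w, eLpNorm (fun θ => t⁻¹ * ∫ s in t₀..(t₀ + t),
              (M.b (r, pathAt 1 w s) θ - M.bBar ν r θ)) 2 (surf n) ^ 2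
            ∂(M.frozenLaw r (Measure.dirac x)) ≤ rate t

/-- `ζ^ε(δ) = inf {t > 0 : ‖R^ε_t‖_∞ > 1 / δ}`, with `inf ∅ = ∞`. -/
def zeta (ε : ℝ≥0) (δ : ℝ) (w : (ℕ → ℝ) × (ℕ → Cplus n × Eucl n)) : EReal :=
  sInf ((fun t : ℝ => (t : EReal)) ''
    {t | 0 < t ∧ ENNReal.ofReal δ⁻¹ < eLpNorm (pathAt ε w t).1.1 ∞ (surf n)})

/-- `inf {t ≥ 0 : ‖R^ε_t‖_2 > 1 + ‖ρ‖_2}`, with `inf ∅ = ∞`. -/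
def kappa (ε : ℝ≥0) (ρ : Cplus n) (w : (ℕ → ℝ) × (ℕ → Cplus n × Eucl n)) : EReal :=
  sInf ((fun t : ℝ => (t : EReal)) ''
    {t | 0 ≤ t ∧ 1 + eLpNorm ρ.1 2 (surf n) < eLpNorm (pathAt ε w t).1.1 2 (surf n)})

/-- Assumption (C) for the processes started at `(r₀, x₀ ε)`: for all `t ≥ 0` and `δ > 0`,
`‖b^ε - b‖_2` at time `t ∧ ζ^ε(δ)` tends to `0` in probability as `ε → 0`. -/
def AssumptionC (G : BumpFamily n) (r₀ : Cplus n) (x₀ : ℝ≥0 → Eucl n) : Prop :=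
  ∀ t : ℝ, 0 ≤ t → ∀ δ : ℝ, 0 < δ → ∀ c : ℝ, 0 < c →
    Tendsto (fun ε : ℝ≥0 => M.procLaw G ε (r₀, x₀ ε)
      {w | ENNReal.ofReal c ≤ eLpNorm (fun θ =>
          M.bEps G ε (pathAt ε w (min (t : EReal) (zeta ε δ w)).toReal) θ -
            M.b (pathAt ε w (min (t : EReal) (zeta ε δ w)).toReal) θ) 2 (surf n)})
      (𝓝[>] 0) (𝓝 0)

end GrowthModel

end StarGrowth

end

/-!
The jump processes are coded by a clock of independent exponential waiting times and an independent
Markov chain, so every statement splits into a statement about the chain (`ae_chainLaw_step`,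
`lintegral_chainLaw_prod_le`) and one about the clock (`clockLaw_sum_le`,
`clockLaw_arrivalCount_eq`).

*Lipschitz bounds.*  The bound for `b = ω_n F / y` is the quotient rule (`exists_lipB`).  For `h`,
since `F` is a probability density, `H(r, ·)` may be recentred at one of its values, and only its
oscillation on the sphere enters (`exists_liph`).  An invariant measure of the jump process is the
same as one of the embedded chain (`jumpLaw_invariant_iff`), because the chain is observed at a time
so small that at most one jump is likely.  The lower bound on `F` is Doeblin's condition for one
step, which gives a unique invariant measure `ν_r`, and `ν_r` is the image under `H(r, ·)` of a
stationary hitting density.  This density is a fixed point of a strict contraction of `L^1` depending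
on `r` in a Lipschitz way, hence is Lipschitz in `r` itself (`nrm_one_avgDens_sub_le`), and so is the
averaged drift (`exists_lipBar`).

*The averaged equation.*  Truncating `r` to `[a, 1/a]` makes the vector field globally Lipschitz.
Since `∫ r^{n-1} b(r, x) dσ = 1`, the volume `∫ r^n dσ` grows at the constant rate `n`; this
bounds `‖r_t‖_2` independently of `a`, then by (U) the vector field, and then `‖r_t‖_∞`, so that
the truncation is inactive for small `a` (`exists_isSolutionOn`).

*Ergodicity.*  For a chain satisfying Doeblin's condition, functions of mean zero decorrelate
exponentially fast, and by Schur's test the mean square of a weighted sum along the chain is at most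
a constant times the sum of the squares of the weights (`Minorised.integral_norm_sq_sum_le`).  For
time averages of a jump process the weights are occupation times, and the expected sum of their
squares is the double integral of the probability that no jump occurs between two times, which is
linear in the length of the interval (`lintegral_sum_sq_occ_le`).

*Smoothing.*  The state at time `t ∧ ζ^ε(δ)` is either the initial one or the result of a jump from a
domain in a fixed set `𝒜_∞(a)`, after which the drift is Lipschitz with a fixed constant; smoothing
at the scale `ε^{1/n}` then changes it by `O(ε^{1/n})` (`UnifLipF.assumptionC`).

*Supremum norm.*  Before `κ^ε` the hitting density is bounded by (U), except possibly at the first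
jump.  The sphere is cut into polynomially many (in `1/ε`) cells of diameter of order `ε^{1/n}`.  A
jump changes the domain on a given cell with probability `O(ε^{(n-1)/n})`, and then by `O(ε^{1/n})`.
Among the `O(1/ε)` jumps up to time `T`, a number of changes exceeding a large multiple of
`ε^{-1/n}` has probability at most `exp(-ε^{-1/n})` by an exponential Chebyshev inequality, which
survives the union bound over the cells (`procLaw_zeta_lt_le`, `UpperF.tendsto_zeta_lt`).
-/

namespace StarGrowth

/-! ### Markov chains -/

section Chain

variable {α : Type*} [MeasurableSpace α] (κ : Kernel α α) [IsMarkovKernel κ] (μ : Measure α)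

instance [IsProbabilityMeasure μ] : IsProbabilityMeasure (chainLaw κ μ) := by
  unfold chainLaw; infer_instance

lemma lintegral_chainLaw_zero {f : α → ℝ≥0∞} (hf : Measurable f) :
    ∫⁻ w, f (w 0) ∂(chainLaw κ μ) = ∫⁻ x, f x ∂μ := by
  set κ' : (k : ℕ) → Kernel ((i : Finset.Iic k) → (fun _ => α) i) α := fun k =>
    κ.comap (fun z : (i : Finset.Iic k) → α => z ⟨k, Finset.mem_Iic.2 le_rfl⟩)
      (measurable_pi_apply _) with hκ'
  have h1 : (chainLaw κ μ).map (Preorder.frestrictLe 0) =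
      μ.map (MeasurableEquiv.piUnique fun _ : Finset.Iic 0 => α).symm := by
    change (Kernel.traj (X := fun _ => α) κ' 0 ∘ₘ _).map _ = _
    rw [Measure.map_comp _ _ (by fun_prop), Kernel.traj_map_frestrictLe,
      Kernel.partialTraj_self, Measure.id_comp]
  have h2 : ∫⁻ w, f (w 0) ∂(chainLaw κ μ) =
      ∫⁻ z, f (z ⟨0, Finset.mem_Iic.2 le_rfl⟩) ∂(chainLaw κ μ).map
        (Preorder.frestrictLe (π := fun _ => α) 0) := by
    rw [lintegral_map (by fun_prop) (by fun_prop)]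
    rfl
  rw [h2, h1, lintegral_map (by fun_prop) (by fun_prop)]
  rfl

variable [IsProbabilityMeasure μ]

/-- The Markov property: given the trajectory up to time `k`, the state at time `k + 1` has law
`κ` at the current state. -/
lemma lintegral_chainLaw_succ (k : ℕ) {f : ((i : Finset.Iic k) → α) × α → ℝ≥0∞}
    (hf : Measurable f) :
    ∫⁻ w, f (Preorder.frestrictLe k w, w (k + 1)) ∂(chainLaw κ μ) =
      ∫⁻ w, ∫⁻ y, f (Preorder.frestrictLe k w, y) ∂(κ (w k)) ∂(chainLaw κ μ) := by
  have h := Kernel.map_frestrictLe_trajMeasure_compProd_eq_map_trajMeasure (X := fun _ => α)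
    (μ₀ := μ) (a := k) (κ := fun k =>
    κ.comap (fun z : (i : Finset.Iic k) → α => z ⟨k, Finset.mem_Iic.2 le_rfl⟩)
      (measurable_pi_apply _))
  have h3 := congrArg (fun ρ => ∫⁻ z, f z ∂ρ) h
  rw [Measure.lintegral_compProd hf, lintegral_map hf (by fun_prop),
    lintegral_map hf.lintegral_kernel_prod_right' (by fun_prop)] at h3
  exact h3.symm

lemma lintegral_chainLaw_pair (i k : ℕ) {f : α × α → ℝ≥0∞} (hf : Measurable f) :
    ∫⁻ w, f (w i, w (i + k)) ∂(chainLaw κ μ) =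
      ∫⁻ w, ∫⁻ y, f (w i, y) ∂((κ ^ k) (w i)) ∂(chainLaw κ μ) := by
  induction k generalizing f with
  | zero =>
    refine lintegral_congr fun w => ?_
    rw [pow_zero]
    change _ = ∫⁻ y, f (w i, y) ∂(Kernel.id (w i))
    rw [Kernel.id_apply, lintegral_dirac' _ (by fun_prop)]
    rfl
  | succ k ih =>
    have h1 := lintegral_chainLaw_succ κ μ (i + k)
      (f := fun z => f (z.1 ⟨i, Finset.mem_Iic.2 (Nat.le_add_right _ _)⟩, z.2)) (by fun_prop)
    have hg : Measurable fun z : α × α => ∫⁻ y, f (z.1, y) ∂(κ z.2) := by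
      have : Measurable fun z : (α × α) × α => f (z.1.1, z.2) := by fun_prop
      exact this.lintegral_kernel_prod_right' (κ := κ.comap Prod.snd measurable_snd)
    have h2 := ih hg
    refine h1.trans (h2.trans (lintegral_congr fun w => ?_))
    have h3 : κ ^ (k + 1) = κ ∘ₖ (κ ^ k) := by rw [add_comm, Kernel.pow_add, pow_one]
    rw [h3]
    exact (Kernel.lintegral_comp _ _ _ (by fun_prop : Measurable fun y => f (w i, y))).symm

lemma lintegral_chainLaw_apply (k : ℕ) {f : α → ℝ≥0∞} (hf : Measurable f) :
    ∫⁻ w, f (w k) ∂(chainLaw κ μ) = ∫⁻ x, ∫⁻ y, f y ∂((κ ^ k) x) ∂μ := by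
  have h := lintegral_chainLaw_pair κ μ 0 k (f := fun z => f z.2) (by fun_prop)
  simp only [zero_add] at h
  rw [h]
  exact lintegral_chainLaw_zero κ μ (f := fun x => ∫⁻ y, f y ∂((κ ^ k) x)) hf.lintegral_kernel

lemma chainLaw_map_apply (k : ℕ) : (chainLaw κ μ).map (fun w => w k) = (κ ^ k) ∘ₘ μ := by
  ext s hs
  have h := lintegral_chainLaw_apply κ μ k (f := s.indicator 1) (measurable_one.indicator hs)
  rw [Measure.bind_apply hs (Kernel.aemeasurable _), Measure.map_apply (by fun_prop) hs]
  simp only [lintegral_indicator_one hs] at h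
  rw [← h, ← lintegral_indicator_one (hs.preimage (by fun_prop))]
  rfl

lemma ae_chainLaw_zero {S : Set α} (h : ∀ᵐ x ∂μ, x ∈ S) :
    ∀ᵐ w ∂(chainLaw κ μ), w 0 ∈ S := by
  have h0 : (chainLaw κ μ).map (fun w => w 0) = μ := by
    rw [chainLaw_map_apply, pow_zero]
    exact Measure.id_comp
  rw [← h0] at h
  exact ae_of_ae_map (measurable_pi_apply 0).aemeasurable h

/-- A relation which almost surely holds along one step of the kernel holds along all steps of
the chain. -/
lemma ae_chainLaw_step {R : Set (α × α)} (hR : MeasurableSet R)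
    (h : ∀ x, ∀ᵐ y ∂(κ x), (x, y) ∈ R) :
    ∀ᵐ w ∂(chainLaw κ μ), ∀ k, (w k, w (k + 1)) ∈ R := by
  rw [ae_all_iff]
  intro k
  have hm : Measurable (Rᶜ.indicator (1 : α × α → ℝ≥0∞)) := measurable_one.indicator hR.compl
  have h1 := lintegral_chainLaw_pair κ μ k 1 hm
  have h2 : ∀ x, ∫⁻ y, Rᶜ.indicator (1 : α × α → ℝ≥0∞) (x, y) ∂((κ ^ 1) x) = 0 := fun x => by
    rw [pow_one, lintegral_eq_zero_iff (by fun_prop)]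
    filter_upwards [h x] with y hy
    simp [hy]
  simp only [h2, lintegral_zero] at h1
  rw [lintegral_eq_zero_iff (by fun_prop)] at h1
  filter_upwards [h1] with w hw
  by_contra hc
  simp [hc] at hw

/-- If a nonnegative function of a transition has conditional expectation at most `C`, then the
product of its values along `m` transitions has expectation at most `C ^ m`. -/
lemma lintegral_chainLaw_prod_le {φ : α × α → ℝ≥0∞} (hφ : Measurable φ) {C : ℝ≥0∞}
    (hC : ∀ x, ∫⁻ y, φ (x, y) ∂(κ x) ≤ C) (m : ℕ) :
    ∫⁻ w, ∏ l ∈ Finset.range m, φ (w l, w (l + 1)) ∂(chainLaw κ μ) ≤ C ^ m := by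
  induction m with
  | zero => simp
  | succ m ih =>
    let g : ((i : Finset.Iic m) → α) → ℝ≥0∞ := fun z =>
      ∏ l ∈ (Finset.range m).attach, φ (z ⟨l, by
        have := Finset.mem_range.1 l.2; simp; lia⟩, z ⟨l + 1, by
        have := Finset.mem_range.1 l.2; simp; lia⟩)
    have hg : Measurable g := by
      refine Finset.measurable_fun_prod _ fun l _ => hφ.comp ?_
      fun_prop
    have hgw : ∀ w : ℕ → α, g (Preorder.frestrictLe m w) =
        ∏ l ∈ Finset.range m, φ (w l, w (l + 1)) := fun w => by
      rw [← Finset.prod_attach (Finset.range m)]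
      rfl
    have h1 := lintegral_chainLaw_succ κ μ m
      (f := fun z => g z.1 * φ (z.1 ⟨m, Finset.mem_Iic.2 le_rfl⟩, z.2)) (by fun_prop)
    simp only [hgw] at h1
    calc _ = ∫⁻ w, (∏ l ∈ Finset.range m, φ (w l, w (l + 1))) *
          φ (w m, w (m + 1)) ∂(chainLaw κ μ) := by simp only [Finset.prod_range_succ]
      _ = _ := h1
      _ ≤ ∫⁻ w, (∏ l ∈ Finset.range m, φ (w l, w (l + 1))) * C ∂(chainLaw κ μ) := by
          refine lintegral_mono fun w => ?_
          rw [lintegral_const_mul _ (by fun_prop)]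
          exact mul_le_mul_right (hC (w m)) _
      _ ≤ C ^ (m + 1) := by
          rw [lintegral_mul_const _ (by fun_prop), pow_succ]
          exact mul_le_mul_left ih C

end Chain


/-! ### The Poisson clock -/

instance isProbabilityMeasure_expMeasure_one : IsProbabilityMeasure (expMeasure 1) :=
  isProbabilityMeasure_expMeasure one_pos

instance : IsProbabilityMeasure clockLaw := by
  unfold clockLaw; infer_instance

lemma expMeasure_Ioi {c : ℝ} (hc : 0 ≤ c) :
    expMeasure 1 (Ioi c) = ENNReal.ofReal (Real.exp (-c)) := by
  have h := cdf_expMeasure_eq one_pos c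
  rw [if_pos hc, one_mul, cdf_eq_real] at h
  rw [← compl_Iic, ← ofReal_measureReal, probReal_compl_eq_one_sub measurableSet_Iic, h]
  congr 1; ring

lemma expMeasure_Iic {c : ℝ} (hc : 0 ≤ c) :
    expMeasure 1 (Iic c) = ENNReal.ofReal (1 - Real.exp (-c)) := by
  have h := cdf_expMeasure_eq one_pos c
  rw [if_pos hc, one_mul, cdf_eq_real] at h
  rw [← ofReal_measureReal, h]

lemma lintegral_exp_neg_expMeasure :
    ∫⁻ x, ENNReal.ofReal (Real.exp (-x)) ∂(expMeasure 1) = ENNReal.ofReal (1 / 2) := by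
  have h1 : expMeasure 1 = volume.withDensity (exponentialPDF 1) := rfl
  have hm : ∀ r, Measurable (exponentialPDF r) := fun r =>
    (measurable_exponentialPDFReal r).ennreal_ofReal
  rw [h1, lintegral_withDensity_eq_lintegral_mul _ (hm 1) (by fun_prop)]
  have h2 : ∀ x, (exponentialPDF 1 * fun x => ENNReal.ofReal (Real.exp (-x))) x =
      ENNReal.ofReal (1 / 2) * exponentialPDF 2 x := fun x => by
    simp only [Pi.mul_apply, exponentialPDF_eq]
    rw [← ENNReal.ofReal_mul (by split_ifs <;> positivity), ← ENNReal.ofReal_mul (by positivity)]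
    congr 1
    split_ifs
    · rw [one_mul, ← Real.exp_add, ← mul_assoc]; norm_num; ring
    · simp
  simp_rw [h2]
  rw [lintegral_const_mul _ (hm 2), lintegral_exponentialPDF_eq_one (by norm_num), mul_one]

lemma iIndepFun_clockLaw : iIndepFun (fun (i : ℕ) (τ : ℕ → ℝ) => τ i) clockLaw :=
  iIndepFun_infinitePi (X := fun _ x => x) (by fun_prop)

lemma clockLaw_map_eval (i : ℕ) : clockLaw.map (fun τ => τ i) = expMeasure 1 :=
  Measure.infinitePi_map_eval _ i

lemma clockLaw_eval_preimage (i : ℕ) {s : Set ℝ} (hs : MeasurableSet s) :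
    clockLaw {τ | τ i ∈ s} = expMeasure 1 s := by
  rw [← clockLaw_map_eval i, Measure.map_apply (by fun_prop) hs]; rfl

/-- Chernoff bound: the first `m` waiting times are unlikely to be over by time `t`. -/
lemma clockLaw_sum_le (m : ℕ) (t : ℝ) :
    clockLaw {τ | ∑ i ∈ Finset.range m, τ i ≤ t} ≤ ENNReal.ofReal (Real.exp t * (1 / 2) ^ m) := by
  have h1 : ∫⁻ τ, ∏ i ∈ Finset.range m, ENNReal.ofReal (Real.exp (-τ i)) ∂clockLaw =
      ENNReal.ofReal (1 / 2) ^ m := by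
    have h := lintegral_prod_eq_prod_lintegral_of_indepFun (μ := clockLaw) (Finset.range m)
      (fun i τ => ENNReal.ofReal (Real.exp (-τ i)))
      (iIndepFun_clockLaw.comp (fun _ x => ENNReal.ofReal (Real.exp (-x))) (by fun_prop))
      (by fun_prop)
    rw [h, Finset.prod_congr rfl (g := fun _ => ENNReal.ofReal (1 / 2)), Finset.prod_const,
      Finset.card_range]
    intro i _
    rw [← lintegral_exp_neg_expMeasure, ← clockLaw_map_eval i,
      lintegral_map (by fun_prop) (by fun_prop)]
  have hms : MeasurableSet {τ : ℕ → ℝ | ∑ i ∈ Finset.range m, τ i ≤ t} :=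
    measurableSet_le (by fun_prop) (by fun_prop)
  calc clockLaw {τ | ∑ i ∈ Finset.range m, τ i ≤ t}
      = ∫⁻ τ, {τ : ℕ → ℝ | ∑ i ∈ Finset.range m, τ i ≤ t}.indicator 1 τ ∂clockLaw :=
        (lintegral_indicator_one hms).symm
    _ ≤ ∫⁻ τ, ENNReal.ofReal (Real.exp t) *
          ∏ i ∈ Finset.range m, ENNReal.ofReal (Real.exp (-τ i)) ∂clockLaw := by
        refine lintegral_mono fun τ => ?_
        refine indicator_apply_le (g := fun τ : ℕ → ℝ => ENNReal.ofReal (Real.exp t) *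
          ∏ i ∈ Finset.range m, ENNReal.ofReal (Real.exp (-τ i))) fun hτ => ?_
        rw [← ENNReal.ofReal_prod_of_nonneg fun _ _ => (Real.exp_pos _).le, ← Real.exp_sum,
          ← ENNReal.ofReal_mul (Real.exp_pos _).le, ← Real.exp_add, Pi.one_apply,
          ENNReal.one_le_ofReal, Real.one_le_exp_iff, Finset.sum_neg_distrib]
        simpa using hτ
    _ = _ := by
        rw [lintegral_const_mul _ (by fun_prop), h1, ENNReal.ofReal_mul (Real.exp_pos _).le,
          ENNReal.ofReal_pow (by norm_num)]

/-- The clocks for which the arrival times are strictly increasing and tend to infinity. -/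
def IsClock (τ : ℕ → ℝ) : Prop :=
  (∀ i, 0 < τ i) ∧ Tendsto (fun k => ∑ i ∈ Finset.range k, τ i) atTop atTop

lemma ae_isClock : ∀ᵐ τ ∂clockLaw, IsClock τ := by
  have h1 : ∀ᵐ τ ∂clockLaw, ∀ i, 0 < τ i := by
    rw [ae_all_iff]
    intro i
    rw [ae_iff]
    have := clockLaw_eval_preimage i (measurableSet_Iic (a := (0 : ℝ)))
    simpa [expMeasure_Iic le_rfl] using this
  have h2 : ∀ᵐ τ ∂clockLaw, ∀ t : ℕ, ∃ k, (t : ℝ) < ∑ i ∈ Finset.range k, τ i := by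
    rw [ae_all_iff]
    intro t
    rw [ae_iff]
    simp only [not_exists, not_lt]
    have h : Tendsto (fun m : ℕ => Real.exp t * (1 / 2 : ℝ) ^ m) atTop (𝓝 (Real.exp t * 0)) :=
      (tendsto_pow_atTop_nhds_zero_of_lt_one (by norm_num) (by norm_num)).const_mul _
    have h' := ENNReal.tendsto_ofReal h
    rw [mul_zero, ENNReal.ofReal_zero] at h'
    refine le_antisymm (ge_of_tendsto' h' fun m => ?_) zero_le
    refine le_trans (measure_mono ?_) (clockLaw_sum_le m t)
    exact fun τ (hτ : ∀ k, ∑ i ∈ Finset.range k, τ i ≤ t) => hτ m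
  filter_upwards [h1, h2] with τ h1 h2
  refine ⟨h1, tendsto_atTop_atTop_of_monotone ?_ fun b => ?_⟩
  · exact monotone_nat_of_le_succ fun k => by
      rw [Finset.sum_range_succ]; linarith [h1 k]
  · obtain ⟨k, hk⟩ := h2 ⌈b⌉₊
    exact ⟨k, (Nat.le_ceil b).trans hk.le⟩

lemma arrival_eq (ε : ℝ≥0) (τ : ℕ → ℝ) (k : ℕ) :
    arrival ε τ k = ε * ∑ i ∈ Finset.range k, τ i := (Finset.mul_sum _ _ _).symm

lemma arrival_zero (ε : ℝ≥0) (τ : ℕ → ℝ) : arrival ε τ 0 = 0 := by simp [arrival]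

lemma arrival_succ (ε : ℝ≥0) (τ : ℕ → ℝ) (k : ℕ) :
    arrival ε τ (k + 1) = arrival ε τ k + ε * τ k := Finset.sum_range_succ _ _

namespace IsClock

variable {τ : ℕ → ℝ} (hτ : IsClock τ) {ε : ℝ≥0} (hε : 0 < ε)

include hτ hε

lemma strictMono_arrival : StrictMono (arrival ε τ) :=
  strictMono_nat_of_lt_succ fun k => by
    have h := mul_pos (NNReal.coe_pos.2 hε) (hτ.1 k)
    rw [arrival_succ]; linarith

lemma arrival_nonneg (k : ℕ) : 0 ≤ arrival ε τ k :=
  (arrival_zero ε τ).symm.le.trans ((hτ.strictMono_arrival hε).monotone (Nat.zero_le k))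

lemma arrivalCount_spec {t : ℝ} (ht : 0 ≤ t) :
    arrival ε τ (arrivalCount ε τ t) ≤ t ∧ t < arrival ε τ (arrivalCount ε τ t + 1) := by
  have hne : {k | arrival ε τ k ≤ t}.Nonempty := ⟨0, by simpa [arrival_zero] using ht⟩
  have hbd : BddAbove {k | arrival ε τ k ≤ t} := by
    have h : Tendsto (arrival ε τ) atTop atTop := by
      simp_rw [funext (arrival_eq ε τ)]
      exact hτ.2.const_mul_atTop (NNReal.coe_pos.2 hε)
    obtain ⟨m, hm⟩ := (h.eventually_gt_atTop t).exists
    refine ⟨m, fun k hk => ?_⟩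
    by_contra hc
    exact absurd (((hτ.strictMono_arrival hε).monotone (not_le.1 hc).le).trans hk) (not_le.2 hm)
  refine ⟨Nat.sSup_mem hne hbd, ?_⟩
  by_contra hc
  have := le_csSup hbd (show arrivalCount ε τ t + 1 ∈ _ from not_lt.1 hc)
  exact absurd this (by unfold arrivalCount; lia)

lemma arrivalCount_eq_iff {t : ℝ} (ht : 0 ≤ t) {k : ℕ} :
    arrivalCount ε τ t = k ↔ arrival ε τ k ≤ t ∧ t < arrival ε τ (k + 1) := by
  have h := hτ.arrivalCount_spec hε ht
  have hm := hτ.strictMono_arrival hε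
  refine ⟨fun hk => hk ▸ h, fun hk => ?_⟩
  have h1 := hm.lt_iff_lt.1 (h.1.trans_lt hk.2)
  have h2 := hm.lt_iff_lt.1 (hk.1.trans_lt h.2)
  lia

lemma arrivalCount_mono {s t : ℝ} (hs : 0 ≤ s) (hst : s ≤ t) :
    arrivalCount ε τ s ≤ arrivalCount ε τ t := by
  have h := hτ.arrivalCount_spec hε hs
  have h' := hτ.arrivalCount_spec hε (hs.trans hst)
  have := (hτ.strictMono_arrival hε).lt_iff_lt.1 ((h.1.trans hst).trans_lt h'.2)
  lia

lemma arrivalCount_zero : arrivalCount ε τ 0 = 0 :=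
  (hτ.arrivalCount_eq_iff hε le_rfl).2 ⟨(arrival_zero _ _).le, by
    rw [arrival_succ, arrival_zero, zero_add]
    exact mul_pos (NNReal.coe_pos.2 hε) (hτ.1 0)⟩

end IsClock

lemma Nat_sSup_eq_iff (S : Set ℕ) (k : ℕ) :
    sSup S = k ↔ (k ∈ S ∧ ∀ j, k < j → j ∉ S) ∨
      (k = 0 ∧ ((∀ m, ∃ j, m ≤ j ∧ j ∈ S) ∨ ∀ j, j ∉ S)) := by
  rcases S.eq_empty_or_nonempty with rfl | hne
  · simp [eq_comm]
  by_cases hb : BddAbove S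
  · have h1 := Nat.sSup_mem hne hb
    obtain ⟨B, hB⟩ := hb
    refine ⟨fun h => Or.inl ⟨h ▸ h1, fun j hj hjS => ?_⟩, ?_⟩
    · have := le_csSup ⟨B, hB⟩ hjS; lia
    · rintro (⟨hk, hj⟩ | ⟨-, h | h⟩)
      · refine le_antisymm (not_lt.1 fun hlt => hj _ hlt h1) (le_csSup ⟨B, hB⟩ hk)
      · obtain ⟨j, hj, hjS⟩ := h (B + 1)
        exact absurd (hB hjS) (by lia)
      · exact absurd hne.some_mem (h _)
  · rw [Nat.sSup_of_not_bddAbove hb]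
    have hu : ∀ m, ∃ j, m ≤ j ∧ j ∈ S := fun m => by
      by_contra! hc
      exact hb ⟨m, fun j hj => not_lt.1 fun hlt => hc j hlt.le hj⟩
    refine ⟨fun h => Or.inr ⟨h.symm, Or.inl hu⟩, ?_⟩
    rintro (⟨-, hj⟩ | ⟨rfl, -⟩)
    · obtain ⟨j, hj', hjS⟩ := hu (k + 1)
      exact absurd hjS (hj j (by lia))
    · rfl

lemma measurable_arrivalCount (ε : ℝ≥0) :
    Measurable fun p : (ℕ → ℝ) × ℝ => arrivalCount ε p.1 p.2 := by
  have hA : ∀ k, MeasurableSet {p : (ℕ → ℝ) × ℝ | arrival ε p.1 k ≤ p.2} := fun k => by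
    unfold arrival
    exact measurableSet_le (by fun_prop) (by fun_prop)
  refine measurable_to_countable' fun k => ?_
  have : (fun p : (ℕ → ℝ) × ℝ => arrivalCount ε p.1 p.2) ⁻¹' {k} =
      {p | (arrival ε p.1 k ≤ p.2 ∧ ∀ j, k < j → ¬ arrival ε p.1 j ≤ p.2) ∨
      (k = 0 ∧ ((∀ m, ∃ j, m ≤ j ∧ arrival ε p.1 j ≤ p.2) ∨ ∀ j, ¬ arrival ε p.1 j ≤ p.2))} := by
    ext p
    exact Nat_sSup_eq_iff {k | arrival ε p.1 k ≤ p.2} k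
  rw [this]
  have hA' : ∀ j, Measurable fun p : (ℕ → ℝ) × ℝ => arrival ε p.1 j ≤ p.2 :=
    fun j => measurableSet_setOfPred.1 (hA j)
  exact measurableSet_setOfPred.2 (((hA' k).and
    (.forall fun j => .imp measurable_const (hA' j).not)).or (measurable_const.and
    ((Measurable.forall fun m => .exists fun j =>
      measurable_const.and (hA' j)).or (.forall fun j => (hA' j).not))))

/-- The memoryless property at a fixed time: given that `k` arrivals occurred up to time `s`, no
further arrival occurs until time `t` with probability `e^{-(t-s)}`. -/
lemma clockLaw_no_arrival (k : ℕ) {s t : ℝ} (hst : s ≤ t) :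
    clockLaw {τ | arrival 1 τ k ≤ s ∧ t < arrival 1 τ (k + 1)} =
      ENNReal.ofReal (Real.exp (-(t - s))) *
        clockLaw {τ | arrival 1 τ k ≤ s ∧ s < arrival 1 τ (k + 1)} := by
  have key : ∀ t, s ≤ t → clockLaw {τ | arrival 1 τ k ≤ s ∧ t < arrival 1 τ (k + 1)} =
      ENNReal.ofReal (Real.exp (-t)) * ∫⁻ x in Iic s, ENNReal.ofReal (Real.exp x)
        ∂(clockLaw.map fun τ => arrival 1 τ k) := by
    intro t hst
    have hind : IndepFun (fun τ : ℕ → ℝ => arrival 1 τ k) (fun τ => τ k) clockLaw := by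
      have h := iIndepFun_clockLaw.indepFun_finsetSum_of_notMem₀ (s := Finset.range k) (i := k)
        (fun i => (measurable_pi_apply i).aemeasurable) (by simp)
      convert h using 2
      simp [arrival]
    have hma : Measurable fun τ : ℕ → ℝ => arrival 1 τ k := by unfold arrival; fun_prop
    rw [indepFun_iff_map_prod_eq_prod_map_map hma.aemeasurable (measurable_pi_apply k).aemeasurable,
      clockLaw_map_eval] at hind
    have hms : MeasurableSet {p : ℝ × ℝ | p.1 ≤ s ∧ t < p.1 + p.2} :=
      (measurableSet_le measurable_fst measurable_const).inter
        (measurableSet_lt measurable_const (measurable_fst.add measurable_snd))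
    have : IsProbabilityMeasure (clockLaw.map fun τ => arrival 1 τ k) :=
      Measure.isProbabilityMeasure_map hma.aemeasurable
    calc clockLaw {τ | arrival 1 τ k ≤ s ∧ t < arrival 1 τ (k + 1)}
        = (clockLaw.map fun τ => (arrival 1 τ k, τ k)) {p : ℝ × ℝ | p.1 ≤ s ∧ t < p.1 + p.2} := by
          rw [Measure.map_apply (by fun_prop) hms]
          simp [arrival_succ]
      _ = ∫⁻ x, (Iic s).indicator (fun x => ENNReal.ofReal (Real.exp (-t)) *
            ENNReal.ofReal (Real.exp x)) x ∂(clockLaw.map fun τ => arrival 1 τ k) := by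
          rw [hind, Measure.prod_apply hms]
          refine lintegral_congr fun x => ?_
          by_cases hx : x ≤ s
          · have : Prod.mk x ⁻¹' {p : ℝ × ℝ | p.1 ≤ s ∧ t < p.1 + p.2} = Ioi (t - x) := by
              ext y; simp [hx, sub_lt_iff_lt_add']
            rw [this, expMeasure_Ioi (by linarith), indicator_of_mem (show x ∈ Iic s from hx),
              ← ENNReal.ofReal_mul (Real.exp_pos _).le, ← Real.exp_add]
            congr 2; ring
          · have : Prod.mk x ⁻¹' {p : ℝ × ℝ | p.1 ≤ s ∧ t < p.1 + p.2} = ∅ := by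
              ext y; simp [hx]
            rw [this, indicator_of_notMem (show x ∉ Iic s from hx), measure_empty]
      _ = _ := by
          rw [lintegral_indicator measurableSet_Iic, lintegral_const_mul _ (by fun_prop)]
  rw [key t hst, key s le_rfl, ← mul_assoc, ← ENNReal.ofReal_mul (Real.exp_pos _).le,
    ← Real.exp_add]
  congr 3; ring

lemma clockLaw_arrivalCount_eq {s t : ℝ} (hs : 0 ≤ s) (hst : s ≤ t) :
    clockLaw {τ | arrivalCount 1 τ s = arrivalCount 1 τ t} =
      ENNReal.ofReal (Real.exp (-(t - s))) := by
  have hm : ∀ r : ℝ, Measurable fun τ => arrivalCount 1 τ r := fun r =>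
    (measurable_arrivalCount 1).comp (measurable_id.prodMk measurable_const)
  have h1 : ∀ r, s ≤ r → clockLaw {τ | arrivalCount 1 τ s = arrivalCount 1 τ r} =
      ∑' k, clockLaw {τ | arrival 1 τ k ≤ s ∧ r < arrival 1 τ (k + 1)} := by
    intro r hr
    have : {τ | arrivalCount 1 τ s = arrivalCount 1 τ r} =
        ⋃ k, {τ | arrivalCount 1 τ s = k ∧ arrivalCount 1 τ r = k} := by
      ext τ; simp [eq_comm]
    rw [this, measure_iUnion]
    · refine tsum_congr fun k => measure_congr ?_
      filter_upwards [ae_isClock] with τ hτ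
      refine propext ?_
      change (_ ∧ _) ↔ (_ ∧ _)
      rw [hτ.arrivalCount_eq_iff one_pos hs, hτ.arrivalCount_eq_iff one_pos (hs.trans hr)]
      constructor
      · rintro ⟨h1, h2⟩; exact ⟨h1.1, h2.2⟩
      · rintro ⟨h1, h2⟩; exact ⟨⟨h1, hr.trans_lt h2⟩, h1.trans hr, h2⟩
    · intro i j hij
      refine disjoint_left.2 fun τ h1 h2 => hij (h1.1.symm.trans h2.1)
    · intro k
      exact ((hm s) (measurableSet_singleton k)).inter ((hm r) (measurableSet_singleton k))
  rw [h1 t hst]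
  simp_rw [clockLaw_no_arrival _ hst]
  rw [ENNReal.tsum_mul_left, ← h1 s le_rfl]
  simp

lemma clockLaw_arrivalCount_zero {t : ℝ} (ht : 0 ≤ t) :
    clockLaw {τ | arrivalCount 1 τ t = 0} = ENNReal.ofReal (Real.exp (-t)) := by
  have h := clockLaw_arrivalCount_eq le_rfl ht
  rw [sub_zero] at h
  rw [← h]
  refine measure_congr ?_
  filter_upwards [ae_isClock] with τ hτ
  refine propext ?_
  change _ = _ ↔ _ = _
  rw [hτ.arrivalCount_zero one_pos, eq_comm]

lemma clockLaw_two_le_arrivalCount {t : ℝ} (ht : 0 ≤ t) :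
    clockLaw {τ | 2 ≤ arrivalCount 1 τ t} ≤ ENNReal.ofReal (1 - Real.exp (-t)) ^ 2 := by
  have hind := (iIndepFun_clockLaw.indepFun
    (show (0 : ℕ) ≠ 1 by decide)).measure_inter_preimage_eq_mul (Iic t) (Iic t)
    measurableSet_Iic measurableSet_Iic
  have h0 := clockLaw_eval_preimage 0 (measurableSet_Iic (a := t))
  have h1 := clockLaw_eval_preimage 1 (measurableSet_Iic (a := t))
  rw [expMeasure_Iic ht] at h0 h1
  rw [pow_two]
  nth_rewrite 1 [← h0]
  rw [← h1]
  refine le_trans (measure_mono_ae ?_) hind.le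
  filter_upwards [ae_isClock] with τ hτ (h2 : 2 ≤ arrivalCount 1 τ t)
  have h3 := (hτ.strictMono_arrival one_pos).monotone h2
  have h4 := h3.trans (hτ.arrivalCount_spec one_pos ht).1
  simp only [arrival, NNReal.coe_one, one_mul, Finset.sum_range_succ, Finset.range_zero,
    Finset.sum_empty, zero_add] at h4
  exact ⟨show τ 0 ≤ t by linarith [hτ.1 1], show τ 1 ≤ t by linarith [hτ.1 0]⟩

lemma measurable_pathAt {α : Type*} [MeasurableSpace α] (ε : ℝ≥0) :
    Measurable fun p : ((ℕ → ℝ) × (ℕ → α)) × ℝ => pathAt ε p.1 p.2 := by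
  have h1 : Measurable fun q : ℕ × (ℕ → α) => q.2 q.1 :=
    measurable_from_prod_countable_right fun k => measurable_pi_apply k
  exact h1.comp (((measurable_arrivalCount ε).comp
    ((measurable_fst.comp measurable_fst).prodMk measurable_snd)).prodMk
      (measurable_snd.comp measurable_fst))


/-! ### Minorised Markov chains -/

section Doeblin

variable {X : Type*} [MeasurableSpace X]

/-- The measure `ρ` gives full mass to every measurable set containing `G`; the set `G` itself
need not be measurable. -/
def CarriedBy (ρ : Measure X) (G : Set X) : Prop :=
  ∀ S, MeasurableSet S → G ⊆ S → ∀ᵐ x ∂ρ, x ∈ S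

/-- The values of `f` on `G` lie in an interval of length `d`. -/
def OscLE (f : X → ℝ) (G : Set X) (d : ℝ) : Prop :=
  ∃ l, ∀ x ∈ G, l ≤ f x ∧ f x ≤ l + d

lemma integrable_of_bound {ρ : Measure X} [IsFiniteMeasure ρ] {f : X → ℝ} (hf : Measurable f)
    {C : ℝ} (hC : ∀ x, |f x| ≤ C) : Integrable f ρ :=
  .of_bound hf.aestronglyMeasurable C (ae_of_all _ hC)

lemma CarriedBy.integral_mem {ρ : Measure X} [IsProbabilityMeasure ρ] {G : Set X}
    (h : CarriedBy ρ G) {f : X → ℝ} (hf : Measurable f) {C : ℝ} (hC : ∀ x, |f x| ≤ C) {l u : ℝ}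
    (hlu : ∀ x ∈ G, l ≤ f x ∧ f x ≤ u) : l ≤ ∫ x, f x ∂ρ ∧ ∫ x, f x ∂ρ ≤ u := by
  have hae : ∀ᵐ x ∂ρ, l ≤ f x ∧ f x ≤ u := h {x | l ≤ f x ∧ f x ≤ u}
    ((measurableSet_le measurable_const hf).inter (measurableSet_le hf measurable_const)) hlu
  have hi := integrable_of_bound (ρ := ρ) hf hC
  constructor
  · simpa using integral_mono_ae (integrable_const l) hi (hae.mono fun x hx => hx.1)
  · simpa using integral_mono_ae hi (integrable_const u) (hae.mono fun x hx => hx.2)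

lemma OscLE.abs_integral_sub_le {ρ ρ' : Measure X} [IsProbabilityMeasure ρ]
    [IsProbabilityMeasure ρ'] {G : Set X} (h : CarriedBy ρ G) (h' : CarriedBy ρ' G) {f : X → ℝ}
    (hf : Measurable f) {C : ℝ} (hC : ∀ x, |f x| ≤ C) {d : ℝ} (hd : OscLE f G d) :
    |∫ x, f x ∂ρ - ∫ x, f x ∂ρ'| ≤ d := by
  obtain ⟨l, hl⟩ := hd
  have h1 := h.integral_mem hf hC hl
  have h2 := h'.integral_mem hf hC hl
  rw [abs_le]; constructor <;> linarith

variable (P : Kernel X X) [IsMarkovKernel P]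

instance isMarkovKernel_pow (k : ℕ) : IsMarkovKernel (P ^ k) := by
  induction k with
  | zero => rw [pow_zero]; exact inferInstanceAs (IsMarkovKernel Kernel.id)
  | succ k ih => rw [Kernel.pow_add, pow_one]; infer_instance

omit [IsMarkovKernel P] in
lemma measurable_integral_pow {f : X → ℝ} (hf : Measurable f) (k : ℕ) :
    Measurable fun x => ∫ y, f y ∂((P ^ k) x) :=
  (hf.stronglyMeasurable.integral_kernel (κ := P ^ k)).measurable

lemma abs_integral_pow_le {f : X → ℝ} {C : ℝ} (hC : ∀ x, |f x| ≤ C) (k : ℕ) (x : X) :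
    |∫ y, f y ∂((P ^ k) x)| ≤ C := by
  simpa using norm_integral_le_of_norm_le_const (μ := (P ^ k) x) (f := f) (C := C)
    (ae_of_all _ hC)

lemma integral_pow_add {f : X → ℝ} (hf : Measurable f) {C : ℝ} (hC : ∀ x, |f x| ≤ C)
    (j k : ℕ) (x : X) :
    ∫ y, f y ∂((P ^ (j + k)) x) = ∫ z, ∫ y, f y ∂((P ^ k) z) ∂((P ^ j) x) := by
  rw [add_comm, Kernel.pow_add, Kernel.integral_comp (integrable_of_bound hf hC)]

omit [IsMarkovKernel P] in
lemma carriedBy_pow {G : Set X} (hP : ∀ x, CarriedBy (P x) G) (k : ℕ) {x : X}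
    (hx : x ∈ G ∨ 1 ≤ k) : CarriedBy ((P ^ k) x) G := by
  intro S hS hGS
  cases k with
  | zero =>
    have h0 : (P ^ 0) x = Measure.dirac x := by
      rw [pow_zero]; exact Kernel.id_apply x
    rw [h0]
    refine (ae_dirac_iff (p := fun x => x ∈ S) hS).2 ?_
    exact hGS (hx.resolve_right (by norm_num))
  | succ k =>
    rw [ae_iff, add_comm]
    have : (P ^ (1 + k)) x Sᶜ = 0 := by
      rw [Kernel.pow_add, pow_one, Kernel.comp_apply' _ _ _ hS.compl]
      rw [lintegral_eq_zero_iff (P.measurable_coe hS.compl)]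
      exact ae_of_all _ fun z => ae_iff.1 (hP z S hS hGS)
    exact this

lemma OscLE.step {G : Set X} (hP : ∀ x, CarriedBy (P x) G) {f : X → ℝ} (hf : Measurable f) {C : ℝ}
    (hC : ∀ x, |f x| ≤ C) {d : ℝ} (hd : OscLE f G d) (k : ℕ) :
    OscLE (fun x => ∫ y, f y ∂((P ^ k) x)) G d := by
  obtain ⟨l, hl⟩ := hd
  exact ⟨l, fun x hx => (carriedBy_pow P hP k (Or.inl hx)).integral_mem hf hC hl⟩

/-- Doeblin's condition: on `G`, the `n₀`-step transition probabilities dominate `δ m`. -/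
def Minorised (G : Set X) (n₀ : ℕ) (δ : ℝ) : Prop :=
  1 ≤ n₀ ∧ 0 < δ ∧ ∃ m : Measure X, IsProbabilityMeasure m ∧
    ∀ x ∈ G, ENNReal.ofReal δ • m ≤ (P ^ n₀) x

variable {P}

lemma Minorised.le_one {G : Set X} {n₀ : ℕ} {δ : ℝ} (h : Minorised P G n₀ δ) {x : X}
    (hx : x ∈ G) : δ ≤ 1 := by
  obtain ⟨-, hδ, m, hm, hle⟩ := h
  have := hle x hx univ
  simpa using this

/-- Under Doeblin's condition `n₀` steps reduce oscillations on `G` by the factor `1 - δ`: both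
`f - l` and `l + d - f` lose at least `δ` times their `m`-integral. -/
lemma OscLE.minorised {G : Set X} (hP : ∀ x, CarriedBy (P x) G) {n₀ : ℕ} {δ : ℝ}
    (h : Minorised P G n₀ δ) {f : X → ℝ} (hf : Measurable f) {C : ℝ}
    (hC : ∀ x, |f x| ≤ C) {d : ℝ} (hd : OscLE f G d) :
    OscLE (fun x => ∫ y, f y ∂((P ^ n₀) x)) G ((1 - δ) * d) := by
  obtain ⟨hn, hδ, m, hm, hle⟩ := h
  obtain ⟨l, hl⟩ := hd
  refine ⟨δ * ∫ y, f y ∂m + (1 - δ) * l, fun x hx => ?_⟩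
  have hae : ∀ᵐ y ∂((P ^ n₀) x), l ≤ f y ∧ f y ≤ l + d := carriedBy_pow P hP n₀ (Or.inl hx)
    {y | l ≤ f y ∧ f y ≤ l + d} ((measurableSet_le measurable_const hf).inter
      (measurableSet_le hf measurable_const)) hl
  have hi : ∀ ρ : Measure X, IsFiniteMeasure ρ → Integrable f ρ := fun ρ _ =>
    integrable_of_bound hf hC
  have h1 := integral_mono_measure (f := fun y => f y - l) (hle x hx)
    (hae.mono fun y hy => by simpa using hy.1) ((hi _ inferInstance).sub (integrable_const l))
  have h2 := integral_mono_measure (f := fun y => l + d - f y) (hle x hx)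
    (hae.mono fun y hy => by simpa using hy.2) ((integrable_const _).sub (hi _ inferInstance))
  rw [integral_smul_measure, ENNReal.toReal_ofReal hδ.le,
    integral_sub (hi _ inferInstance) (integrable_const l),
    integral_sub (hi _ inferInstance) (integrable_const l)] at h1
  rw [integral_smul_measure, ENNReal.toReal_ofReal hδ.le,
    integral_sub (integrable_const _) (hi _ inferInstance),
    integral_sub (integrable_const _) (hi _ inferInstance)] at h2
  simp only [integral_const, probReal_univ, smul_eq_mul, one_mul] at h1 h2
  constructor <;> nlinarith

lemma OscLE.iterate {G : Set X} (hP : ∀ x, CarriedBy (P x) G) {n₀ : ℕ} {δ : ℝ}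
    (h : Minorised P G n₀ δ) {f : X → ℝ} (hf : Measurable f) {C : ℝ}
    (hC : ∀ x, |f x| ≤ C) {d : ℝ} (hd : OscLE f G d) (k : ℕ) :
    OscLE (fun x => ∫ y, f y ∂((P ^ k) x)) G ((1 - δ) ^ (k / n₀) * d) := by
  have hn := h.1
  induction k using Nat.strong_induction_on with
  | _ k ih =>
    rcases lt_or_ge k n₀ with hk | hk
    · rw [Nat.div_eq_of_lt hk, pow_zero, one_mul]
      exact hd.step P hP hf hC k
    · have h1 := (ih (k - n₀) (by lia)).minorised hP h (measurable_integral_pow P hf _)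
        (abs_integral_pow_le P hC _)
      obtain ⟨j, rfl⟩ := Nat.exists_eq_add_of_le hk
      rw [Nat.add_sub_cancel_left] at h1
      rw [Nat.add_div_left _ hn, pow_succ', mul_assoc]
      simpa only [integral_pow_add P hf hC] using h1

omit [MeasurableSpace X] in
lemma oscLE_indicator (A : Set X) (G : Set X) : OscLE (A.indicator (fun _ => (1 : ℝ))) G 1 :=
  ⟨0, fun x _ => ⟨indicator_nonneg (fun _ _ => zero_le_one) x, by
    rw [zero_add]; exact indicator_apply_le' (fun _ => le_rfl) fun _ => zero_le_one⟩⟩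

omit [MeasurableSpace X] in
lemma abs_indicator_one_le (A : Set X) (x : X) : |A.indicator (fun _ => (1 : ℝ)) x| ≤ 1 := by
  by_cases h : x ∈ A <;> simp [h]

lemma tendsto_pow_div {δ : ℝ} (hδ : 0 < δ) (hδ1 : δ ≤ 1) {n₀ : ℕ} (hn : 1 ≤ n₀) :
    Tendsto (fun k : ℕ => (1 - δ) ^ (k / n₀)) atTop (𝓝 0) :=
  (tendsto_pow_atTop_nhds_zero_of_lt_one (by linarith) (by linarith)).comp
    (Nat.tendsto_div_const_atTop (by lia))

/-- A sequence of probability measures which is Cauchy uniformly over measurable sets converges,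
uniformly over measurable sets, to a probability measure. -/
lemma exists_measure_of_uniform_cauchy {μ : ℕ → Measure X} [∀ k, IsProbabilityMeasure (μ k)]
    {c : ℕ → ℝ} (hc : Tendsto c atTop (𝓝 0))
    (h : ∀ A, MeasurableSet A → ∀ k j, |(μ (j + k)).real A - (μ k).real A| ≤ c k) :
    ∃ ν : Measure X, IsProbabilityMeasure ν ∧
      ∀ A, MeasurableSet A → ∀ k, |ν.real A - (μ k).real A| ≤ c k := by
  have hlim : ∀ A, ∃ L : ℝ, MeasurableSet A → Tendsto (fun k => (μ k).real A) atTop (𝓝 L) := by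
    intro A
    by_cases hA : MeasurableSet A
    · have hcs : CauchySeq fun k => (μ k).real A := by
        refine Metric.cauchySeq_iff'.2 fun e he => ?_
        obtain ⟨N, hN⟩ := (hc.eventually_lt_const he).exists
        refine ⟨N, fun k hk => ?_⟩
        obtain ⟨j, rfl⟩ := Nat.exists_eq_add_of_le' hk
        exact (h A hA N j).trans_lt hN
      obtain ⟨L, hL⟩ := cauchySeq_tendsto_of_complete hcs
      exact ⟨L, fun _ => hL⟩
    · exact ⟨0, fun h => absurd h hA⟩
  choose L hL using hlim
  have hclose : ∀ A, MeasurableSet A → ∀ k, |L A - (μ k).real A| ≤ c k := fun A hA k =>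
    le_of_tendsto' (((hL A hA).comp (tendsto_add_atTop_nat k)).sub_const _).abs fun j => h A hA k j
  have hL0 : ∀ A, MeasurableSet A → 0 ≤ L A := fun A hA =>
    ge_of_tendsto' (hL A hA) fun k => measureReal_nonneg
  have hempty : L ∅ = 0 := tendsto_nhds_unique (hL ∅ .empty) (by simp)
  have hsum : ∀ f : ℕ → Set X, (∀ i, MeasurableSet (f i)) → Pairwise (Function.onFun Disjoint f) →
      HasSum (fun i => L (f i)) (L (⋃ i, f i)) := by
    intro f hf hd
    rw [hasSum_iff_tendsto_nat_of_nonneg fun i => hL0 _ (hf i)]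
    have hfin : ∀ N, L (⋃ i ∈ Finset.range N, f i) = ∑ i ∈ Finset.range N, L (f i) := fun N => by
      refine tendsto_nhds_unique (hL _ (Finset.measurableSet_biUnion _ fun i _ => hf i)) ?_
      have : ∀ k, (μ k).real (⋃ i ∈ Finset.range N, f i) =
          ∑ i ∈ Finset.range N, (μ k).real (f i) := fun k =>
        measureReal_biUnion_finset (fun i _ j _ hij => hd hij) fun i _ => hf i
      simp_rw [this]
      exact tendsto_finsetSum _ fun i _ => hL _ (hf i)
    simp_rw [← hfin]
    rw [Metric.tendsto_atTop]
    intro e he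
    obtain ⟨k, hk⟩ := (hc.eventually_lt_const (show (0 : ℝ) < e / 3 by linarith)).exists
    have hk' : Tendsto (fun N => (μ k).real (⋃ i ∈ Finset.range N, f i)) atTop
        (𝓝 ((μ k).real (⋃ i, f i))) := by
      have h2 : ∀ N, (μ k).real (⋃ i ∈ Finset.range N, f i) =
          ∑ i ∈ Finset.range N, (μ k).real (f i) := fun N =>
        measureReal_biUnion_finset (fun i _ j _ hij => hd hij) fun i _ => hf i
      simp_rw [h2]
      refine (hasSum_iff_tendsto_nat_of_nonneg (fun i => measureReal_nonneg) _).1 ?_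
      have h3 := measure_iUnion (μ := μ k) hd hf
      rw [Measure.real, h3, ENNReal.tsum_toReal_eq fun i => measure_ne_top _ _]
      exact (ENNReal.summable_toReal (h3 ▸ measure_ne_top _ _)).hasSum
    obtain ⟨N, hN⟩ := Metric.tendsto_atTop.1 hk' (e / 3) (by linarith)
    refine ⟨N, fun M hM => ?_⟩
    have h1 := hN M hM
    have h2 := hclose (⋃ i, f i) (.iUnion hf) k
    have h3 := hclose (⋃ i ∈ Finset.range M, f i)
      (Finset.measurableSet_biUnion _ fun i _ => hf i) k
    rw [Real.dist_eq] at h1 ⊢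
    rw [abs_lt] at h1 ⊢
    rw [abs_le] at h2 h3
    constructor <;> linarith
  let ν : Measure X := Measure.ofMeasurable (fun A _ => ENNReal.ofReal (L A))
    (by simp [hempty]) fun f hf hd => by
      rw [← (hsum f hf hd).tsum_eq, ENNReal.ofReal_tsum_of_nonneg (fun i => hL0 _ (hf i))
        (hsum f hf hd).summable]
  have hν : ∀ A, MeasurableSet A → ν A = ENNReal.ofReal (L A) := fun A hA =>
    Measure.ofMeasurable_apply A hA
  have huniv : L univ = 1 := tendsto_nhds_unique (hL univ .univ) (by simp)
  refine ⟨ν, ⟨by rw [hν _ .univ, huniv, ENNReal.ofReal_one]⟩, fun A hA k => ?_⟩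
  rw [Measure.real, hν A hA, ENNReal.toReal_ofReal (hL0 A hA)]
  exact hclose A hA k

/-- Two probability measures whose values differ by at most `c` on every measurable set integrate
`[0, 1]`-valued functions with an error of at most `c`. -/
lemma abs_integral_sub_le_of_measureReal {ν μ : Measure X} [IsProbabilityMeasure ν]
    [IsProbabilityMeasure μ] {c : ℝ} (h : ∀ A, MeasurableSet A → |ν.real A - μ.real A| ≤ c)
    {g : X → ℝ} (hg : Measurable g) (h0 : ∀ x, 0 ≤ g x) (h1 : ∀ x, g x ≤ 1) :
    |∫ x, g x ∂ν - ∫ x, g x ∂μ| ≤ c := by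
  have hi : ∀ ρ : Measure X, IsProbabilityMeasure ρ → Integrable g ρ := fun ρ _ =>
    integrable_of_bound hg fun x => by rw [abs_of_nonneg (h0 x)]; exact h1 x
  have key : ∀ ρ : Measure X, IsProbabilityMeasure ρ →
      ∫ x, g x ∂ρ = ∫ t in Ioc (0 : ℝ) 1, ρ.real {x | t ≤ g x} := fun ρ hρ =>
    (hi ρ hρ).integral_eq_integral_Ioc_meas_le (ae_of_all _ h0) (ae_of_all _ h1)
  have hint : ∀ ρ : Measure X, IsProbabilityMeasure ρ →
      IntegrableOn (fun t : ℝ => ρ.real {x | t ≤ g x}) (Ioc 0 1) := fun ρ hρ => by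
    have ha : Antitone fun t : ℝ => ρ.real {x | t ≤ g x} := fun s t hst =>
      measureReal_mono fun x (hx : t ≤ g x) => hst.trans hx
    have : Integrable (fun t : ℝ => ρ.real {x | t ≤ g x}) (volume.restrict (Ioc 0 1)) :=
      .of_bound ha.measurable.aestronglyMeasurable 1 (ae_of_all _ fun t => by
        rw [Real.norm_of_nonneg measureReal_nonneg]; exact measureReal_le_one)
    exact this
  rw [key ν inferInstance, key μ inferInstance, ← integral_sub (hint ν inferInstance)
    (hint μ inferInstance)]
  have := norm_setIntegral_le_of_norm_le_const (μ := volume) (s := Ioc (0 : ℝ) 1) (C := c)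
    (f := fun t => ν.real {x | t ≤ g x} - μ.real {x | t ≤ g x}) (by simp)
    fun t _ => h _ (measurableSet_le measurable_const hg)
  simpa using this

omit [IsMarkovKernel P] in
lemma integral_pow_indicator {A : Set X} (hA : MeasurableSet A) (k : ℕ) (x : X) :
    ∫ y, A.indicator (fun _ => (1 : ℝ)) y ∂((P ^ k) x) = ((P ^ k) x).real A := by
  rw [integral_indicator_const _ hA, smul_eq_mul, mul_one]

lemma comp_real_apply {ρ : Measure X} [IsProbabilityMeasure ρ] {A : Set X} (hA : MeasurableSet A)
    (k : ℕ) : ((P ^ k) ∘ₘ ρ).real A = ∫ x, ((P ^ k) x).real A ∂ρ := by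
  rw [Measure.real, Measure.bind_apply hA (Kernel.aemeasurable _)]
  have hm : Measurable fun x => ((P ^ k) x) A := (P ^ k).measurable_coe hA
  simp only [Measure.real]
  rw [integral_toReal hm.aemeasurable (ae_of_all _ fun x => measure_lt_top _ _)]

/-- A minorised chain has an invariant probability measure. -/
lemma Minorised.exists_invariant {G : Set X} (hG : G.Nonempty) (hP : ∀ x, CarriedBy (P x) G)
    {n₀ : ℕ} {δ : ℝ} (h : Minorised P G n₀ δ) :
    ∃ ν : Measure X, IsProbabilityMeasure ν ∧ P ∘ₘ ν = ν := by
  obtain ⟨x₀, hx₀⟩ := hG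
  have hmi : ∀ A, MeasurableSet A → Measurable (A.indicator (fun _ : X => (1 : ℝ))) := fun A hA =>
    measurable_const.indicator hA
  have hc := tendsto_pow_div h.2.1 (h.le_one hx₀) h.1
  obtain ⟨ν, hν, hclose⟩ := exists_measure_of_uniform_cauchy (μ := fun k => (P ^ k) x₀) hc
    fun A hA k j => by
      have h0 := (oscLE_indicator A G).iterate hP h (hmi A hA) (abs_indicator_one_le A) k
      rw [mul_one] at h0
      have h1 := h0.abs_integral_sub_le (carriedBy_pow P hP j (Or.inl hx₀))
        (carriedBy_pow P hP 0 (Or.inl hx₀)) (measurable_integral_pow P (hmi A hA) k)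
        (abs_integral_pow_le P (abs_indicator_one_le A) k)
      rw [← integral_pow_add P (hmi A hA) (abs_indicator_one_le A),
        ← integral_pow_add P (hmi A hA) (abs_indicator_one_le A), integral_pow_indicator hA,
        integral_pow_indicator hA, zero_add] at h1
      exact h1
  refine ⟨ν, hν, ?_⟩
  have : IsProbabilityMeasure (P ∘ₘ ν) := by infer_instance
  ext A hA
  rw [← measureReal_eq_measureReal_iff]
  have h1 : ∀ k, |(P ∘ₘ ν).real A - ν.real A| ≤
      (1 - δ) ^ (k / n₀) + (1 - δ) ^ ((k + 1) / n₀) := fun k => by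
    have h2 := abs_integral_sub_le_of_measureReal (fun A hA => hclose A hA k)
      (g := fun x => (P x).real A) (P.measurable_coe hA).ennreal_toReal
      (fun x => measureReal_nonneg) fun x => measureReal_le_one
    have h3 := comp_real_apply (P := P) (ρ := ν) hA 1
    have h6 : ∀ z, ∫ y, A.indicator (fun _ => (1 : ℝ)) y ∂(P z) = (P z).real A := fun z => by
      rw [integral_indicator_const _ hA, smul_eq_mul, mul_one]
    have h4 := integral_pow_add P (hmi A hA) (abs_indicator_one_le A) k 1 x₀
    have h5 := hclose A hA (k + 1)
    simp only [integral_pow_indicator hA, pow_one, h6] at h3 h4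
    rw [← h3, ← h4] at h2
    rw [abs_le] at h2 h5 ⊢
    constructor <;> linarith
  have h2 := hc.add (hc.comp (tendsto_add_atTop_nat 1))
  rw [add_zero] at h2
  exact sub_eq_zero.1 (abs_nonpos_iff.1 (ge_of_tendsto' h2 h1))

omit [IsMarkovKernel P] in
lemma comp_pow_eq {ρ : Measure X} (h : P ∘ₘ ρ = ρ) (k : ℕ) : (P ^ k) ∘ₘ ρ = ρ := by
  induction k with
  | zero => rw [pow_zero]; exact Measure.id_comp
  | succ k ih => rw [Kernel.pow_add, pow_one, ← Measure.comp_assoc, h, ih]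

omit [IsMarkovKernel P] in
lemma carriedBy_of_invariant {G : Set X} (hP : ∀ x, CarriedBy (P x) G) {ρ : Measure X}
    (h : P ∘ₘ ρ = ρ) : CarriedBy ρ G := by
  intro S hS hGS
  rw [← h, ae_iff]
  change (P ∘ₘ ρ) Sᶜ = 0
  rw [Measure.bind_apply hS.compl (Kernel.aemeasurable _),
    lintegral_eq_zero_iff (P.measurable_coe hS.compl)]
  exact ae_of_all _ fun z => ae_iff.1 (hP z S hS hGS)

/-- A minorised chain has at most one invariant probability measure. -/
lemma Minorised.invariant_unique {G : Set X} (hG : G.Nonempty) (hP : ∀ x, CarriedBy (P x) G)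
    {n₀ : ℕ} {δ : ℝ} (h : Minorised P G n₀ δ) {ν ν' : Measure X} [IsProbabilityMeasure ν]
    [IsProbabilityMeasure ν'] (hν : P ∘ₘ ν = ν) (hν' : P ∘ₘ ν' = ν') : ν = ν' := by
  obtain ⟨x₀, hx₀⟩ := hG
  ext A hA
  rw [← measureReal_eq_measureReal_iff]
  have h1 : ∀ k, |ν.real A - ν'.real A| ≤ (1 - δ) ^ (k / n₀) := fun k => by
    have hmi : Measurable (A.indicator (fun _ : X => (1 : ℝ))) := measurable_const.indicator hA
    have h0 := (oscLE_indicator A G).iterate hP h hmi (abs_indicator_one_le A) k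
    rw [mul_one] at h0
    have h1 := h0.abs_integral_sub_le (carriedBy_of_invariant hP hν)
      (carriedBy_of_invariant hP hν') (measurable_integral_pow P hmi k)
      (abs_integral_pow_le P (abs_indicator_one_le A) k)
    simp only [integral_pow_indicator hA] at h1
    rwa [← comp_real_apply hA, ← comp_real_apply hA, comp_pow_eq hν, comp_pow_eq hν'] at h1
  exact sub_eq_zero.1 (abs_nonpos_iff.1
    (ge_of_tendsto' (tendsto_pow_div h.2.1 (h.le_one hx₀) h.1) h1))

variable (P)

lemma jumpLaw_pathAt_apply (ρ : Measure X) [IsProbabilityMeasure ρ] (t : ℝ) {A : Set X}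
    (hA : MeasurableSet A) :
    (jumpLaw P ρ).map (fun w => pathAt 1 w t) A =
      ∫⁻ τ, ((P ^ arrivalCount 1 τ t) ∘ₘ ρ) A ∂clockLaw := by
  have hm : Measurable fun w : (ℕ → ℝ) × (ℕ → X) => pathAt 1 w t :=
    (measurable_pathAt 1).comp (measurable_id.prodMk measurable_const)
  rw [Measure.map_apply hm hA, jumpLaw, Measure.prod_apply (hm hA)]
  refine lintegral_congr fun τ => ?_
  rw [← chainLaw_map_apply, Measure.map_apply (measurable_pi_apply _) hA]
  rfl

/-- If the expectation of `a` at the number of arrivals up to time `t` does not depend on `t`, then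
`a 0 = a 1`: up to a small time `t` there is no arrival with probability `e^{-t}`, and there are at
least two with probability `O(t²)`. -/
lemma eq_of_integral_arrivalCount_eq {a : ℕ → ℝ} (ha01 : ∀ i, 0 ≤ a i ∧ a i ≤ 1)
    (h : ∀ t : ℝ, 0 < t → ∫ τ, a (arrivalCount 1 τ t) ∂clockLaw = a 0) : a 0 = a 1 := by
  have hbd : ∀ i j, |a i - a j| ≤ 1 := fun i j => by
    have h1 := ha01 i
    have h2 := ha01 j
    rw [abs_le]; constructor <;> linarith
  have key : ∀ t : ℝ, 0 < t → |a 0 - a 1| ≤ 1 - Real.exp (-t) := by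
    intro t ht
    have hN : Measurable fun τ => arrivalCount 1 τ t :=
      (measurable_arrivalCount 1).comp (measurable_id.prodMk measurable_const)
    have hNa : Measurable fun τ => a (arrivalCount 1 τ t) := (measurable_of_countable a).comp hN
    have hai : Integrable (fun τ => a (arrivalCount 1 τ t)) clockLaw :=
      integrable_of_bound hNa (C := 1) fun τ => by
        rw [abs_of_nonneg (ha01 _).1]; exact (ha01 _).2
    have hm0 : MeasurableSet {τ | arrivalCount 1 τ t = 0} := hN (measurableSet_singleton 0)
    have hm2 : MeasurableSet {τ | 2 ≤ arrivalCount 1 τ t} := hN measurableSet_Ici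
    have hle : ∀ τ, |a (arrivalCount 1 τ t) - a 1| ≤
        {τ | arrivalCount 1 τ t = 0}.indicator (fun _ => |a 0 - a 1|) τ +
          {τ | 2 ≤ arrivalCount 1 τ t}.indicator (fun _ => 1) τ := by
      intro τ
      simp only [indicator, mem_ofPred_eq]
      generalize arrivalCount 1 τ t = k
      rcases k with _ | _ | k
      · simp
      · simp
      · simpa using hbd _ _
    have hi0 : Integrable ({τ | arrivalCount 1 τ t = 0}.indicator fun _ => |a 0 - a 1|)
        clockLaw := (integrable_const _).indicator hm0
    have hi2 : Integrable ({τ | 2 ≤ arrivalCount 1 τ t}.indicator fun _ => (1 : ℝ)) clockLaw :=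
      (integrable_const _).indicator hm2
    have h3 : 0 < 1 - Real.exp (-t) := by
      have := Real.exp_lt_one_iff.2 (show -t < 0 by linarith); linarith
    have h2 : |a 0 - a 1| ≤ |a 0 - a 1| * Real.exp (-t) + (1 - Real.exp (-t)) ^ 2 := by
      calc |a 0 - a 1| = |∫ τ, (a (arrivalCount 1 τ t) - a 1) ∂clockLaw| := by
            rw [integral_sub hai (integrable_const _), h t ht, integral_const, probReal_univ,
              one_smul]
        _ ≤ ∫ τ, |a (arrivalCount 1 τ t) - a 1| ∂clockLaw := abs_integral_le_integral_abs
        _ ≤ ∫ τ, ({τ | arrivalCount 1 τ t = 0}.indicator (fun _ => |a 0 - a 1|) τ +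
              {τ | 2 ≤ arrivalCount 1 τ t}.indicator (fun _ => 1) τ) ∂clockLaw :=
            integral_mono (hai.sub (integrable_const _)).abs (hi0.add hi2) hle
        _ = |a 0 - a 1| * clockLaw.real {τ | arrivalCount 1 τ t = 0} +
              clockLaw.real {τ | 2 ≤ arrivalCount 1 τ t} := by
            rw [integral_add hi0 hi2, integral_indicator_const _ hm0,
              integral_indicator_const _ hm2, smul_eq_mul, smul_eq_mul, mul_one, mul_comm]
        _ ≤ _ := by
            refine add_le_add (le_of_eq ?_) ?_
            · rw [Measure.real, clockLaw_arrivalCount_zero ht.le,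
                ENNReal.toReal_ofReal (Real.exp_pos _).le]
            · have := ENNReal.toReal_mono (by finiteness) (clockLaw_two_le_arrivalCount ht.le)
              rwa [ENNReal.toReal_pow, ENNReal.toReal_ofReal h3.le] at this
    nlinarith
  have hlim : Tendsto (fun t : ℝ => 1 - Real.exp (-t)) (𝓝[>] 0) (𝓝 0) := by
    have : Continuous fun t : ℝ => 1 - Real.exp (-t) := by fun_prop
    have h2 := (this.tendsto 0).mono_left (nhdsWithin_le_nhds (s := Ioi 0))
    simpa using h2
  exact sub_eq_zero.1 (abs_nonpos_iff.1
    (ge_of_tendsto hlim (eventually_mem_nhdsWithin.mono fun t ht => key t ht)))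

/-- A probability measure is invariant for the jump process of unit rate if and only if it is
invariant for the embedded chain. -/
lemma jumpLaw_invariant_iff (ρ : Measure X) [IsProbabilityMeasure ρ] :
    (∀ t : ℝ, 0 ≤ t → (jumpLaw P ρ).map (fun w => pathAt 1 w t) = ρ) ↔ P ∘ₘ ρ = ρ := by
  constructor
  · intro h
    have : IsProbabilityMeasure (P ∘ₘ ρ) := by infer_instance
    have hpr : ∀ k : ℕ, IsProbabilityMeasure ((P ^ k) ∘ₘ ρ) := fun k => by infer_instance
    have h0 : Measure.bind ρ ⇑(P ^ 0) = ρ := by rw [pow_zero]; exact Measure.id_comp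
    ext A hA
    rw [← measureReal_eq_measureReal_iff]
    have key := eq_of_integral_arrivalCount_eq (a := fun k => ((P ^ k) ∘ₘ ρ).real A)
      (fun i => ⟨measureReal_nonneg, measureReal_le_one⟩) fun t ht => by
        have hN : Measurable fun τ => arrivalCount 1 τ t :=
          (measurable_arrivalCount 1).comp (measurable_id.prodMk measurable_const)
        have h2 := jumpLaw_pathAt_apply P ρ t hA
        rw [h t ht.le] at h2
        simp only [h0]
        obtain ⟨m, hm⟩ : ∃ m : ℕ → ℝ≥0∞, ∀ k, Measure.bind ρ ⇑(P ^ k) A = m k := ⟨_, fun _ => rfl⟩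
        have hmt : ∀ k, m k < ∞ := fun k => by rw [← hm]; exact measure_lt_top _ _
        simp only [hm, Measure.real] at h2 ⊢
        have hmm : Measurable fun τ => m (arrivalCount 1 τ t) := (measurable_of_countable m).comp hN
        rw [h2, integral_toReal hmm.aemeasurable (ae_of_all _ fun τ => hmt _)]
    simp only [h0, pow_one] at key
    exact key.symm
  · intro h t _
    ext A hA
    rw [jumpLaw_pathAt_apply P ρ t hA]
    simp [comp_pow_eq h]

end Doeblin


/-! ### Norms of continuous functions on the sphere -/

section Norms

variable {n : ℕ}

/-- A continuous function on the sphere, as an element of `L^p(σ)`. -/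
noncomputable def toL (n : ℕ) (p : ℝ≥0∞) [Fact (1 ≤ p)] : C(Sph n, ℝ) →L[ℝ] Lp ℝ p (surf n) :=
  ContinuousMap.toLp p (surf n) ℝ

/-- The norm of a continuous function on the sphere in `L^p(σ)`. -/
noncomputable def nrm (p : ℝ≥0∞) [Fact (1 ≤ p)] (f : C(Sph n, ℝ)) : ℝ := ‖toL n p f‖

variable (p : ℝ≥0∞) [Fact (1 ≤ p)]

lemma nrm_nonneg (f : C(Sph n, ℝ)) : 0 ≤ nrm p f := norm_nonneg _

lemma eLpNorm_eq_nrm (f : C(Sph n, ℝ)) : eLpNorm f p (surf n) = ENNReal.ofReal (nrm p f) := by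
  rw [nrm, Lp.norm_def, ENNReal.ofReal_toReal (Lp.eLpNorm_ne_top _)]
  exact (eLpNorm_congr_ae (ContinuousMap.coeFn_toLp (surf n) f)).symm

lemma nrm_add_le (f g : C(Sph n, ℝ)) : nrm p (f + g) ≤ nrm p f + nrm p g := by
  rw [nrm, map_add]; exact norm_add_le _ _

lemma nrm_smul (c : ℝ) (f : C(Sph n, ℝ)) : nrm p (c • f) = |c| * nrm p f := by
  rw [nrm, map_smul, norm_smul]; rfl

lemma nrm_zero : nrm p (0 : C(Sph n, ℝ)) = 0 := by rw [nrm, map_zero, norm_zero]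

/-- Minkowski's integral inequality. -/
lemma nrm_integral_le {X : Type*} [MeasurableSpace X] {μ : Measure X} {f : X → C(Sph n, ℝ)}
    (hf : Integrable f μ) : nrm p (∫ x, f x ∂μ) ≤ ∫ x, nrm p (f x) ∂μ := by
  rw [nrm, ← ContinuousLinearMap.integral_comp_comm _ hf]
  exact norm_integral_le_integral_norm _

lemma continuous_nrm : Continuous (nrm (n := n) p) := (toL n p).continuous.norm

/-- `‖f‖_p ≤ c₀ ‖f‖_∞` and `‖f‖_2 ≤ c₀ ‖f‖_p` for `p = 2, ∞`. -/
noncomputable def normConst (n : ℕ) : ℝ := max 1 √(area n)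

lemma one_le_normConst : 1 ≤ normConst n := le_max_left _ _

lemma normConst_pos : 0 < normConst n := one_pos.trans_le one_le_normConst

lemma area_nonneg : 0 ≤ area n := measureReal_nonneg

lemma surf_univ : surf n univ = ENNReal.ofReal (area n) := by
  rw [area, ofReal_measureReal]

lemma integrable_continuousMap (f : C(Sph n, ℝ)) : Integrable f (surf n) :=
  f.continuous.integrable_of_hasCompactSupport (.of_compactSpace _)

lemma nrm_le_of_bound (hp : p = 2 ∨ p = ∞) {f : C(Sph n, ℝ)} {C : ℝ} (hC : 0 ≤ C)
    (h : ∀ᵐ θ ∂(surf n), |f θ| ≤ C) : nrm p f ≤ normConst n * C := by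
  have h1 := eLpNorm_le_of_ae_bound (f := f) (μ := surf n) (p := p) (C := C) h
  rw [eLpNorm_eq_nrm, surf_univ] at h1
  rcases hp with rfl | rfl
  · rw [ENNReal.ofReal_rpow_of_nonneg area_nonneg (by norm_num),
      ← ENNReal.ofReal_mul (Real.rpow_nonneg area_nonneg _), ENNReal.ofReal_le_ofReal_iff
        (mul_nonneg (Real.rpow_nonneg area_nonneg _) hC)] at h1
    refine h1.trans (mul_le_mul_of_nonneg_right ?_ hC)
    rw [normConst, Real.sqrt_eq_rpow]
    refine le_trans (le_of_eq ?_) (le_max_right _ _)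
    norm_num
  · simp only [ENNReal.toReal_top, inv_zero, ENNReal.rpow_zero, one_mul] at h1
    rw [ENNReal.ofReal_le_ofReal_iff hC] at h1
    exact h1.trans (le_mul_of_one_le_left hC one_le_normConst)

lemma nrm_top_le_iff {f : C(Sph n, ℝ)} {C : ℝ} (hC : 0 ≤ C) :
    nrm ∞ f ≤ C ↔ ∀ θ, |f θ| ≤ C := by
  have h0 : nrm ∞ f ≤ C ↔ eLpNorm f ∞ (surf n) ≤ ENNReal.ofReal C := by
    rw [eLpNorm_eq_nrm, ENNReal.ofReal_le_ofReal_iff hC]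
  rw [h0, eLpNorm_exponent_top]
  refine ⟨fun h => ?_, fun h => eLpNormEssSup_le_of_ae_bound (ae_of_all _ h)⟩
  have hae : ∀ᵐ θ ∂(surf n), |f θ| ≤ C := by
    filter_upwards [ae_le_eLpNormEssSup (f := f) (μ := surf n)] with θ hθ
    have := hθ.trans h
    rwa [← ofReal_norm, ENNReal.ofReal_le_ofReal_iff hC] at this
  have ho : IsOpen {θ | C < |f θ|} := isOpen_lt continuous_const (by fun_prop)
  have h1 : surf n {θ | C < |f θ|} = 0 := by
    rw [ae_iff] at hae
    simpa only [not_le] using hae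
  have h2 := (ho.measure_eq_zero_iff (surf n)).1 h1
  intro θ
  by_contra hc
  exact (h2.subset (not_le.1 hc : θ ∈ {θ | C < |f θ|})).elim

lemma nrm_top_eq (f : C(Sph n, ℝ)) : nrm ∞ f = ‖f‖ := by
  refine le_antisymm ((nrm_top_le_iff (norm_nonneg f)).2 fun θ => f.norm_coe_le_norm θ) ?_
  exact (f.norm_le (nrm_nonneg _ _)).2 ((nrm_top_le_iff (nrm_nonneg _ _)).1 le_rfl)

lemma abs_le_nrm_top (f : C(Sph n, ℝ)) (θ : Sph n) : |f θ| ≤ nrm ∞ f :=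
  (nrm_top_le_iff (nrm_nonneg _ _)).1 le_rfl θ

lemma nrm_two_le (hp : p = 2 ∨ p = ∞) (f : C(Sph n, ℝ)) : nrm 2 f ≤ normConst n * nrm p f := by
  rcases hp with rfl | rfl
  · exact le_mul_of_one_le_left (nrm_nonneg _ _) one_le_normConst
  · exact nrm_le_of_bound 2 (Or.inl rfl) (nrm_nonneg _ _) (ae_of_all _ (abs_le_nrm_top f))

lemma abs_integral_mul_le (f g : C(Sph n, ℝ)) :
    |∫ θ, f θ * g θ ∂(surf n)| ≤ nrm 2 f * nrm 2 g := by
  have h := abs_real_inner_le_norm (toL n 2 g) (toL n 2 f)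
  rw [toL, ContinuousMap.inner_toLp, mul_comm] at h
  simpa only [nrm, toL, conj_trivial] using h

lemma nrm_abs (f : C(Sph n, ℝ)) : nrm p |f| = nrm p f := by
  have h := eLpNorm_eq_nrm p |f|
  have h2 : eLpNorm (⇑|f|) p (surf n) = eLpNorm f p (surf n) := by
    refine eLpNorm_congr_norm_ae (ae_of_all _ fun θ => ?_)
    simp
  rw [h2, eLpNorm_eq_nrm] at h
  exact ((ENNReal.ofReal_eq_ofReal_iff (nrm_nonneg _ _) (nrm_nonneg _ _)).1 h).symm

lemma integral_abs_mul_le (f g : C(Sph n, ℝ)) :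
    ∫ θ, |f θ| * |g θ| ∂(surf n) ≤ nrm 2 f * nrm 2 g := by
  have h := (le_abs_self _).trans (abs_integral_mul_le |f| |g|)
  rwa [nrm_abs, nrm_abs] at h

lemma integral_abs_le (f : C(Sph n, ℝ)) :
    ∫ θ, |f θ| ∂(surf n) ≤ normConst n * nrm 2 f := by
  have h := integral_abs_mul_le f 1
  have h1 := nrm_le_of_bound (n := n) 2 (Or.inl rfl) (f := 1) zero_le_one (by simp)
  simp only [ContinuousMap.one_apply, abs_one, mul_one] at h h1
  calc _ ≤ _ := h
    _ ≤ nrm 2 f * normConst n := mul_le_mul_of_nonneg_left h1 (nrm_nonneg _ _)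
    _ = _ := mul_comm _ _

lemma eLpNorm_le_iff_nrm (f g : C(Sph n, ℝ)) {Y : Type*} [PseudoMetricSpace Y] (x x' : Y)
    (K : ℝ≥0) :
    eLpNorm f p (surf n) ≤ K * (eLpNorm g p (surf n) + edist x x') ↔
      nrm p f ≤ K * (nrm p g + dist x x') := by
  rw [eLpNorm_eq_nrm, eLpNorm_eq_nrm, edist_dist,
    ← ENNReal.ofReal_add (nrm_nonneg _ _) dist_nonneg, ← ENNReal.ofReal_coe_nnreal (p := K),
    ← ENNReal.ofReal_mul K.coe_nonneg, ENNReal.ofReal_le_ofReal_iff]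
  exact mul_nonneg K.2 (add_nonneg (nrm_nonneg _ _) dist_nonneg)

lemma edist_le_iff_nrm (g : C(Sph n, ℝ)) {Y Z : Type*} [PseudoMetricSpace Y]
    [PseudoMetricSpace Z] (u u' : Z) (x x' : Y) (K : ℝ≥0) :
    edist u u' ≤ K * (eLpNorm g p (surf n) + edist x x') ↔
      dist u u' ≤ K * (nrm p g + dist x x') := by
  rw [eLpNorm_eq_nrm, edist_dist, edist_dist,
    ← ENNReal.ofReal_add (nrm_nonneg _ _) dist_nonneg, ← ENNReal.ofReal_coe_nnreal (p := K),
    ← ENNReal.ofReal_mul K.coe_nonneg, ENNReal.ofReal_le_ofReal_iff]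
  exact mul_nonneg K.2 (add_nonneg (nrm_nonneg _ _) dist_nonneg)

end Norms

namespace GrowthModel

/-! ### Elementary bounds for the growth model -/

variable {n : ℕ}

lemma mem_A_iff {p : ℝ≥0∞} [Fact (1 ≤ p)] {a : ℝ} (ha : 0 < a) {r : Cplus n} :
    r ∈ A n p a ↔ (∀ θ, a ≤ r.1 θ) ∧ nrm p r.1 ≤ a⁻¹ := by
  have : eLpNorm r.1 p (surf n) ≤ ENNReal.ofReal a⁻¹ ↔ nrm p r.1 ≤ a⁻¹ := by
    rw [eLpNorm_eq_nrm, ENNReal.ofReal_le_ofReal_iff (by positivity)]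
  rw [← this]; rfl

lemma mem_A_top_iff {a : ℝ} (ha : 0 < a) {r : Cplus n} :
    r ∈ A n ∞ a ↔ ∀ θ, a ≤ r.1 θ ∧ r.1 θ ≤ a⁻¹ := by
  rw [mem_A_iff ha, nrm_top_le_iff (by positivity), forall_and]
  refine and_congr_right fun _ => forall_congr' fun θ => ?_
  rw [abs_of_pos (r.2 θ)]

lemma A_anti {p : ℝ≥0∞} {a a' : ℝ} (ha' : 0 < a') (h : a' ≤ a) : A n p a ⊆ A n p a' :=
  fun _ hr => ⟨fun θ => h.trans (hr.1 θ), hr.2.trans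
    (ENNReal.ofReal_le_ofReal (inv_anti₀ ha' h))⟩

lemma A_top_subset_two {a : ℝ} (ha : 0 < a) : A n ∞ a ⊆ A n 2 (a / normConst n) := by
  intro r hr
  rw [mem_A_iff (div_pos ha normConst_pos)]
  rw [mem_A_iff ha] at hr
  refine ⟨fun θ => (div_le_self ha.le one_le_normConst).trans (hr.1 θ), ?_⟩
  rw [inv_div, div_eq_mul_inv]
  exact (nrm_two_le ∞ (Or.inr rfl) _).trans (mul_le_mul_of_nonneg_left hr.2 normConst_pos.le)

lemma div_normConst_mem {a : ℝ} (ha : a ∈ Ioo (0 : ℝ) 1) : a / normConst n ∈ Ioo (0 : ℝ) 1 :=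
  ⟨div_pos ha.1 normConst_pos, (div_le_self ha.1.le one_le_normConst).trans_lt ha.2⟩

/-- A positive continuous function has a positive lower bound. -/
lemma exists_lower (r : Cplus n) : ∃ c : ℝ, 0 < c ∧ ∀ θ, c ≤ r.1 θ := by
  rcases isEmpty_or_nonempty (Sph n) with h | h
  · exact ⟨1, one_pos, fun θ => h.elim θ⟩
  · obtain ⟨θ₀, h₀⟩ := r.1.continuous.exists_forall_le_of_hasCompactSupport (.of_compactSpace _)
    exact ⟨r.1 θ₀, r.2 θ₀, h₀⟩

/-- Every lower bound `c ≤ r` and every bound `nrm p r ≤ C` are realised in some `𝒜_p(a)`. -/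
lemma exists_mem_A (c C : ℝ) (hc : 0 < c) : ∃ a ∈ Ioo (0 : ℝ) 1, a ≤ c ∧ C ≤ a⁻¹ := by
  refine ⟨min c (1 + 1 + |C|)⁻¹, ⟨lt_min hc (by positivity), ?_⟩, min_le_left _ _, ?_⟩
  · refine (min_le_right _ _).trans_lt (inv_lt_one_of_one_lt₀ ?_)
    have := abs_nonneg C
    linarith
  · have h := inv_anti₀ (lt_min hc (by positivity)) (min_le_right c (1 + 1 + |C|)⁻¹)
    rw [inv_inv] at h
    have := le_abs_self C
    linarith

lemma exists_mem_A_top (r : Cplus n) : ∃ a ∈ Ioo (0 : ℝ) 1, r ∈ A n ∞ a := by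
  obtain ⟨c, hc, hr⟩ := exists_lower r
  obtain ⟨a, ha, hac, haC⟩ := exists_mem_A c (nrm ∞ r.1) hc
  exact ⟨a, ha, (mem_A_iff ha.1).2 ⟨fun θ => hac.trans (hr θ), haC⟩⟩

variable (M : GrowthModel n)

lemma Ae_top_subset_two {a : ℝ} (ha : 0 < a) : M.Ae ∞ a ⊆ M.Ae 2 (a / normConst n) := by
  rintro q ⟨h1, h2, r', h3, h4⟩
  exact ⟨h1, A_top_subset_two ha h2, r', A_top_subset_two ha h3, h4⟩

/-- Almost every transported particle lies in the set `𝒜ᵉ_p(a)`, also after the domain grows. -/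
lemma ae_mem_Ae {p : ℝ≥0∞} {a : ℝ} {r r' : Cplus n} (hr : r ∈ A n p a) (hr' : r' ∈ A n p a)
    (hle : r ≤ r') : ∀ᵐ ξ ∂(surf n), (r', M.H r ξ) ∈ M.Ae p a := by
  filter_upwards [M.admissible r] with ξ hξ
  exact ⟨hξ r' hle, hr', r, hr, hle, mem_range_self ξ⟩

include M in
lemma surf_ne_zero : surf n ≠ 0 := fun h => by
  have := M.area_pos
  simp [area, h] at this

lemma exists_mem_Ae {p : ℝ≥0∞} {a : ℝ} {r : Cplus n} (hr : r ∈ A n p a) :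
    ∃ ξ, (r, M.H r ξ) ∈ M.Ae p a :=
  have : (ae (surf n)).NeBot := ae_neBot.2 M.surf_ne_zero
  (M.ae_mem_Ae hr hr le_rfl).exists

/-- The drift `b(r, x)` as a continuous function. -/
noncomputable def bC (q : Cplus n × Eucl n) : C(Sph n, ℝ) := (area n / M.y q) • (M.dens q).1

lemma bC_apply (q : Cplus n × Eucl n) (θ : Sph n) : M.bC q θ = M.b q θ := rfl

lemma measurable_dens_coe : Measurable fun q => (M.dens q).1 :=
  measurable_subtype_coe.comp M.measurable_dens

lemma measurable_bC : Measurable M.bC :=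
  (M.measurable_y.const_div _).smul M.measurable_dens_coe

lemma dens_nonneg (q : Cplus n × Eucl n) (θ : Sph n) : 0 ≤ (M.dens q).1 θ := ((M.dens q).2 θ).le

lemma integrable_pow_mul_dens (q : Cplus n × Eucl n) :
    Integrable (fun θ => q.1.1 θ ^ (n - 1) * (M.dens q).1 θ) (surf n) :=
  integrable_continuousMap (q.1.1 ^ (n - 1) * (M.dens q).1)

lemma le_y {q : Cplus n × Eucl n} {a : ℝ} (ha : 0 ≤ a) (h : ∀ θ, a ≤ q.1.1 θ) :
    area n * a ^ (n - 1) ≤ M.y q := by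
  refine mul_le_mul_of_nonneg_left ?_ M.area_pos.le
  calc a ^ (n - 1) = ∫ θ, a ^ (n - 1) * (M.dens q).1 θ ∂(surf n) := by
        rw [integral_const_mul, M.integral_dens, mul_one]
    _ ≤ _ := integral_mono ((integrable_continuousMap _).const_mul _)
        (M.integrable_pow_mul_dens q) fun θ =>
          mul_le_mul_of_nonneg_right (pow_le_pow_left₀ ha (h θ) _) (M.dens_nonneg q θ)

lemma y_pos (q : Cplus n × Eucl n) : 0 < M.y q := by
  obtain ⟨c, hc, h⟩ := exists_lower q.1
  exact (mul_pos M.area_pos (pow_pos hc _)).trans_le (M.le_y hc.le h)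

lemma area_div_y_le {q : Cplus n × Eucl n} {a : ℝ} (ha : 0 < a) (h : ∀ θ, a ≤ q.1.1 θ) :
    area n / M.y q ≤ (a ^ (n - 1))⁻¹ := by
  rw [div_le_iff₀ (M.y_pos q), inv_mul_eq_div, le_div_iff₀ (pow_pos ha _)]
  exact M.le_y ha.le h

lemma area_div_y_nonneg (q : Cplus n × Eucl n) : 0 ≤ area n / M.y q :=
  div_nonneg M.area_pos.le (M.y_nonneg q)

lemma b_nonneg (q : Cplus n × Eucl n) (θ : Sph n) : 0 ≤ M.b q θ :=
  mul_nonneg (M.area_div_y_nonneg q) (M.dens_nonneg q θ)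

lemma nrm_bC_le {p : ℝ≥0∞} [Fact (1 ≤ p)] {q : Cplus n × Eucl n} {a : ℝ} (ha : 0 < a)
    (h : ∀ θ, a ≤ q.1.1 θ) : nrm p (M.bC q) ≤ (a ^ (n - 1))⁻¹ * nrm p (M.dens q).1 := by
  rw [bC, nrm_smul, abs_of_nonneg (M.area_div_y_nonneg q)]
  exact mul_le_mul_of_nonneg_right (M.area_div_y_le ha h) (nrm_nonneg _ _)

/-- The volume growth is normalised: `∫ r^{n-1} b(r, x) dσ = 1`. -/
lemma integral_pow_mul_b (q : Cplus n × Eucl n) :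
    ∫ θ, q.1.1 θ ^ (n - 1) * M.b q θ ∂(surf n) = 1 := by
  have h : ∀ θ, q.1.1 θ ^ (n - 1) * M.b q θ =
      area n / M.y q * (q.1.1 θ ^ (n - 1) * (M.dens q).1 θ) := fun θ => by rw [b]; ring
  simp_rw [h]
  rw [integral_const_mul, div_mul_eq_mul_div]
  exact div_self (M.y_pos q).ne'

/-! ### Boundedness and Lipschitz bounds for `F`, `b` and `h` -/

lemma lipF_iff {p : ℝ≥0∞} [Fact (1 ≤ p)] {a : ℝ} {K : ℝ≥0} : M.LipF p a K ↔
    ∀ q ∈ M.Ae ∞ a, ∀ q' ∈ M.Ae ∞ a, nrm p ((M.dens q).1 - (M.dens q').1) ≤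
      K * (nrm p (q.1.1 - q'.1.1) + dist q.2 q'.2) :=
  forall₄_congr fun q _ q' _ => eLpNorm_le_iff_nrm p ((M.dens q).1 - (M.dens q').1)
    (q.1.1 - q'.1.1) q.2 q'.2 K

lemma lipB_iff {p : ℝ≥0∞} [Fact (1 ≤ p)] {a : ℝ} {K : ℝ≥0} : M.LipB p a K ↔
    ∀ q ∈ M.Ae ∞ a, ∀ q' ∈ M.Ae ∞ a, nrm p (M.bC q - M.bC q') ≤
      K * (nrm p (q.1.1 - q'.1.1) + dist q.2 q'.2) :=
  forall₄_congr fun q _ q' _ => eLpNorm_le_iff_nrm p (M.bC q - M.bC q')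
    (q.1.1 - q'.1.1) q.2 q'.2 K

lemma lipH_iff {a : ℝ} {K : ℝ≥0} : M.LipH a K ↔
    ∀ q ∈ M.Ae ∞ a, ∀ q' ∈ M.Ae ∞ a, ∀ z z' : Sph n, dist (M.H q.1 z) (M.H q'.1 z') ≤
      K * (nrm 2 (q.1.1 - q'.1.1) + dist z z') :=
  forall₄_congr fun q _ q' _ => forall₂_congr fun z z' => edist_le_iff_nrm 2
    (q.1.1 - q'.1.1) _ _ z z' K

lemma liph_iff {a : ℝ} {K : ℝ≥0} : M.Liph a K ↔
    ∀ q ∈ M.Ae ∞ a, ∀ q' ∈ M.Ae ∞ a, dist (M.h q) (M.h q') ≤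
      K * (nrm 2 (q.1.1 - q'.1.1) + dist q.2 q'.2) :=
  forall₄_congr fun q _ q' _ => edist_le_iff_nrm 2 (q.1.1 - q'.1.1) _ _ q.2 q'.2 K

lemma bddF_iff {p : ℝ≥0∞} [Fact (1 ≤ p)] {a : ℝ} {B : ℝ≥0} : M.BddF p a B ↔
    ∀ q ∈ M.Ae ∞ a, nrm p (M.dens q).1 ≤ B := by
  refine forall₂_congr fun q _ => ?_
  rw [eLpNorm_eq_nrm, ← ENNReal.ofReal_coe_nnreal, ENNReal.ofReal_le_ofReal_iff B.coe_nonneg]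

variable {M}

/-- Under (U), `F` is bounded on `𝒜ᵉ_∞(a)`. -/
lemma UpperF.exists_bound (h : M.UpperF) {a : ℝ} (ha : a ∈ Ioo (0 : ℝ) 1) :
    ∃ B : ℝ, 0 ≤ B ∧ ∀ q ∈ M.Ae ∞ a, ∀ θ, (M.dens q).1 θ ≤ B := by
  obtain ⟨B, hB⟩ := h _ (div_normConst_mem ha)
  exact ⟨|B|, abs_nonneg B, fun q hq θ =>
    (hB q (M.Ae_top_subset_two ha.1 hq) θ).trans (le_abs_self B)⟩

lemma UpperF.bddF (h : M.UpperF) {p : ℝ≥0∞} [Fact (1 ≤ p)] (hp : p = 2 ∨ p = ∞) {a : ℝ}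
    (ha : a ∈ Ioo (0 : ℝ) 1) : ∃ B, M.BddF p a B := by
  obtain ⟨B, hB0, hB⟩ := h.exists_bound ha
  refine ⟨(normConst n * B).toNNReal, M.bddF_iff.2 fun q hq => ?_⟩
  rw [Real.coe_toNNReal _ (mul_nonneg normConst_pos.le hB0)]
  refine nrm_le_of_bound p hp hB0 (ae_of_all _ fun θ => ?_)
  rw [abs_of_nonneg (M.dens_nonneg q θ)]
  exact hB q hq θ

lemma nrm_sub_le_of_mem_A {p : ℝ≥0∞} [Fact (1 ≤ p)] (hp : p = 2 ∨ p = ∞) {a : ℝ} (ha : 0 < a)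
    {r r' : Cplus n} (hr : r ∈ A n ∞ a) (hr' : r' ∈ A n ∞ a) :
    nrm p (r.1 - r'.1) ≤ normConst n * a⁻¹ := by
  rw [mem_A_top_iff ha] at hr hr'
  refine nrm_le_of_bound p hp (by positivity) (ae_of_all _ fun θ => ?_)
  have h1 := hr θ
  have h2 := hr' θ
  rw [ContinuousMap.sub_apply, abs_le]
  constructor <;> linarith

lemma dist_sph_le (z z' : Sph n) : dist z z' ≤ 2 := by
  have h := dist_triangle (z : Eucl n) 0 (z' : Eucl n)
  rw [dist_zero_right, dist_zero_left, norm_eq_of_mem_sphere, norm_eq_of_mem_sphere] at h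
  rw [Subtype.dist_eq]; linarith

/-- The Lipschitz bounds on `F` and `H` bound `F` on `𝒜ᵉ_∞(a)`, since the domains and, through the
Lipschitz bound on `H`, also the particle positions in `𝒜ᵉ_∞(a)` form a bounded set. -/
lemma LipF.bddF {p : ℝ≥0∞} [Fact (1 ≤ p)] (hp : p = 2 ∨ p = ∞) {a : ℝ} (ha : 0 < a) {K K' : ℝ≥0}
    (hF : M.LipF p a K) (hH : M.LipH a K') : ∃ B, M.BddF p a B := by
  rw [lipF_iff] at hF
  rw [lipH_iff] at hH
  rcases (M.Ae ∞ a).eq_empty_or_nonempty with he | ⟨q₀, hq₀⟩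
  · exact ⟨0, M.bddF_iff.2 fun q hq => by simp [he] at hq⟩
  set c := normConst n * a⁻¹
  have hc : 0 ≤ c := mul_nonneg normConst_pos.le (by positivity)
  set B := nrm p (M.dens q₀).1 + K * (c + K' * (c + 2))
  have hB : 0 ≤ B := add_nonneg (nrm_nonneg _ _) (by positivity)
  refine ⟨B.toNNReal, M.bddF_iff.2 fun q hq => ?_⟩
  rw [Real.coe_toNNReal _ hB]
  have hdist : dist q.2 q₀.2 ≤ K' * (c + 2) := by
    obtain ⟨-, -, r, hr, -, z, hz⟩ := hq
    obtain ⟨-, -, r₀, hr₀, -, z₀, hz₀⟩ := hq₀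
    obtain ⟨ξ, hξ⟩ := M.exists_mem_Ae hr
    obtain ⟨ξ₀, hξ₀⟩ := M.exists_mem_Ae hr₀
    rw [← hz, ← hz₀]
    refine (hH _ hξ _ hξ₀ z z₀).trans ?_
    gcongr
    · exact nrm_sub_le_of_mem_A (Or.inl rfl) ha hr hr₀
    · exact dist_sph_le z z₀
  have h1 : nrm p ((M.dens q).1 - (M.dens q₀).1) ≤ K * (c + K' * (c + 2)) := by
    refine (hF q hq q₀ hq₀).trans ?_
    gcongr
    exact nrm_sub_le_of_mem_A hp ha hq.2.1 hq₀.2.1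
  have h2 := nrm_add_le p (M.dens q₀).1 ((M.dens q).1 - (M.dens q₀).1)
  rw [add_sub_cancel] at h2
  linarith

lemma abs_y_sub_le {p : ℝ≥0∞} [Fact (1 ≤ p)] (hp : p = 2 ∨ p = ∞) {a : ℝ} (ha : 0 < a)
    {q q' : Cplus n × Eucl n} (hq : q.1 ∈ A n ∞ a) (hq' : q'.1 ∈ A n ∞ a) :
    |M.y q - M.y q'| ≤ area n * (normConst n ^ 2 * ((n - 1 : ℕ) * a⁻¹ ^ (n - 1 - 1) *
      nrm p (q.1.1 - q'.1.1) * nrm p (M.dens q).1 +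
        a⁻¹ ^ (n - 1) * nrm p ((M.dens q).1 - (M.dens q').1))) := by
  have hnn : ∀ f : C(Sph n, ℝ), 0 ≤ nrm p f := nrm_nonneg p
  rw [mem_A_top_iff ha] at hq hq'
  rw [y, y, ← mul_sub, abs_mul, abs_of_pos M.area_pos,
    ← integral_sub (M.integrable_pow_mul_dens q) (M.integrable_pow_mul_dens q')]
  refine mul_le_mul_of_nonneg_left ?_ M.area_pos.le
  set L : ℝ := (n - 1 : ℕ) * a⁻¹ ^ (n - 1 - 1) with hL
  set L' := a⁻¹ ^ (n - 1)
  have hL0 : 0 ≤ L := by positivity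
  have hL'0 : 0 ≤ L' := by positivity
  have hpt : ∀ θ, |q.1.1 θ ^ (n - 1) * (M.dens q).1 θ - q'.1.1 θ ^ (n - 1) * (M.dens q').1 θ| ≤
      L * (|(q.1.1 - q'.1.1) θ| * |(M.dens q).1 θ|) +
        L' * |((M.dens q).1 - (M.dens q').1) θ| := by
    intro θ
    have h1 := hq θ
    have h2 := hq' θ
    have h3 : |q.1.1 θ ^ (n - 1) - q'.1.1 θ ^ (n - 1)| ≤ |(q.1.1 - q'.1.1) θ| * L := by
      refine (abs_pow_sub_pow_le _ _ _).trans ?_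
      rw [mul_assoc, hL, ContinuousMap.sub_apply]
      gcongr
      rw [abs_of_pos (q.1.2 θ), abs_of_pos (q'.1.2 θ)]
      exact max_le h1.2 h2.2
    have h4 : q'.1.1 θ ^ (n - 1) ≤ L' := pow_le_pow_left₀ (q'.1.2 θ).le h2.2 _
    calc _ = |(q.1.1 θ ^ (n - 1) - q'.1.1 θ ^ (n - 1)) * (M.dens q).1 θ +
          q'.1.1 θ ^ (n - 1) * ((M.dens q).1 - (M.dens q').1) θ| := by
            rw [ContinuousMap.sub_apply]; congr 1; ring
      _ ≤ _ := abs_add_le _ _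
      _ ≤ _ := by
        rw [abs_mul, abs_mul, abs_of_nonneg (pow_nonneg (q'.1.2 θ).le _)]
        have h5 := mul_le_mul_of_nonneg_right h3 (abs_nonneg ((M.dens q).1 θ))
        have h6 := mul_le_mul_of_nonneg_right h4 (abs_nonneg (((M.dens q).1 - (M.dens q').1) θ))
        linarith
  have hi1 : Integrable (fun θ => |(q.1.1 - q'.1.1) θ| * |(M.dens q).1 θ|) (surf n) :=
    integrable_continuousMap (|q.1.1 - q'.1.1| * |(M.dens q).1|)
  have hi2 : Integrable (fun θ => |((M.dens q).1 - (M.dens q').1) θ|) (surf n) :=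
    integrable_continuousMap |(M.dens q).1 - (M.dens q').1|
  have hb1 := integral_abs_mul_le (q.1.1 - q'.1.1) (M.dens q).1
  have hb2 := integral_abs_le ((M.dens q).1 - (M.dens q').1)
  have hc1 : nrm 2 (q.1.1 - q'.1.1) * nrm 2 (M.dens q).1 ≤
      (normConst n * nrm p (q.1.1 - q'.1.1)) * (normConst n * nrm p (M.dens q).1) :=
    mul_le_mul (nrm_two_le p hp _) (nrm_two_le p hp _) (nrm_nonneg _ _)
      (mul_nonneg normConst_pos.le (nrm_nonneg _ _))
  have hc2 := mul_le_mul_of_nonneg_left (nrm_two_le p hp ((M.dens q).1 - (M.dens q').1))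
    (normConst_pos (n := n)).le
  calc _ ≤ ∫ θ, |q.1.1 θ ^ (n - 1) * (M.dens q).1 θ - q'.1.1 θ ^ (n - 1) * (M.dens q').1 θ|
        ∂(surf n) := abs_integral_le_integral_abs
    _ ≤ ∫ θ, (L * (|(q.1.1 - q'.1.1) θ| * |(M.dens q).1 θ|) +
        L' * |((M.dens q).1 - (M.dens q').1) θ|) ∂(surf n) :=
      integral_mono (((M.integrable_pow_mul_dens q).sub (M.integrable_pow_mul_dens q')).abs)
        ((hi1.const_mul _).add (hi2.const_mul _)) hpt
    _ = L * ∫ θ, |(q.1.1 - q'.1.1) θ| * |(M.dens q).1 θ| ∂(surf n) +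
        L' * ∫ θ, |((M.dens q).1 - (M.dens q').1) θ| ∂(surf n) := by
      rw [integral_add (hi1.const_mul _) (hi2.const_mul _), integral_const_mul,
        integral_const_mul]
    _ ≤ L * ((normConst n * nrm p (q.1.1 - q'.1.1)) * (normConst n * nrm p (M.dens q).1)) +
        L' * (normConst n * (normConst n * nrm p ((M.dens q).1 - (M.dens q').1))) := by
      gcongr
      · exact hb1.trans hc1
      · exact hb2.trans hc2
    _ = _ := by ring

end GrowthModel

/-- The Lipschitz bound on `b = ω_n F / y` from those on `F` and `y`, with a constant which does
not depend on the model. -/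
lemma exists_lipB {n : ℕ} {p : ℝ≥0∞} [Fact (1 ≤ p)] (hp : p = 2 ∨ p = ∞) {a : ℝ} (ha : 0 < a)
    (K B : ℝ≥0) : ∃ C : ℝ≥0, ∀ M : GrowthModel n, M.LipF p a K → M.BddF p a B → M.LipB p a C := by
  set L : ℝ := normConst n ^ 2 * ((n - 1 : ℕ) * a⁻¹ ^ (n - 1 - 1) * B + a⁻¹ ^ (n - 1) * K)
  have hL : 0 ≤ L := by positivity
  set e : ℝ := (a ^ (n - 1))⁻¹
  have he : 0 ≤ e := by positivity
  set C : ℝ := e * K + e * e * L * B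
  have hC : 0 ≤ C := by positivity
  refine ⟨C.toNNReal, fun M hF hB => M.lipB_iff.2 fun q hq q' hq' => ?_⟩
  rw [Real.coe_toNNReal _ hC]
  set D := nrm p (q.1.1 - q'.1.1) + dist q.2 q'.2 with hDdef
  have hD1 : nrm p (q.1.1 - q'.1.1) ≤ D := le_add_of_nonneg_right dist_nonneg
  have hD : 0 ≤ D := (nrm_nonneg _ _).trans hD1
  have h1 : nrm p ((M.dens q).1 - (M.dens q').1) ≤ K * D := M.lipF_iff.1 hF q hq q' hq'
  have h2 := M.bddF_iff.1 hB q hq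
  have h2' := M.bddF_iff.1 hB q' hq'
  have h3 : |M.y q - M.y q'| ≤ area n * (L * D) := by
    refine (GrowthModel.abs_y_sub_le hp ha hq.2.1 hq'.2.1).trans ?_
    refine mul_le_mul_of_nonneg_left ?_ M.area_pos.le
    calc _ ≤ normConst n ^ 2 * ((n - 1 : ℕ) * a⁻¹ ^ (n - 1 - 1) * D * B +
          a⁻¹ ^ (n - 1) * (K * D)) := by
          have : 0 ≤ nrm p (M.dens q).1 := nrm_nonneg _ _
          gcongr
      _ = _ := by ring
  have hq1 := ((GrowthModel.mem_A_iff ha).1 hq.2.1).1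
  have hq1' := ((GrowthModel.mem_A_iff ha).1 hq'.2.1).1
  have h4 := M.area_div_y_le ha hq1
  have h4' := M.area_div_y_le ha hq1'
  have hω := M.area_pos
  have hy := M.y_pos q
  have hy' := M.y_pos q'
  have h5 : |area n / M.y q - area n / M.y q'| ≤ e * e * (L * D) := by
    have : area n / M.y q - area n / M.y q' =
        (area n / M.y q) * (area n / M.y q') * ((M.y q' - M.y q) / area n) := by
      field_simp
    rw [this, abs_mul, abs_mul, abs_of_nonneg (M.area_div_y_nonneg q),
      abs_of_nonneg (M.area_div_y_nonneg q'), abs_div, abs_of_pos hω, abs_sub_comm]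
    have h6 : |M.y q - M.y q'| / area n ≤ L * D := by
      rw [div_le_iff₀ hω]; linarith
    have := M.area_div_y_nonneg q
    have := M.area_div_y_nonneg q'
    gcongr
  have h6 : M.bC q - M.bC q' = (area n / M.y q) • ((M.dens q).1 - (M.dens q').1) +
      (area n / M.y q - area n / M.y q') • (M.dens q').1 := by
    rw [GrowthModel.bC, GrowthModel.bC, smul_sub, sub_smul]; abel
  rw [h6]
  refine (nrm_add_le _ _ _).trans ?_
  rw [nrm_smul, nrm_smul, abs_of_nonneg (M.area_div_y_nonneg q)]
  calc _ ≤ e * (K * D) + (e * e * (L * D)) * B := by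
        have := nrm_nonneg p ((M.dens q).1 - (M.dens q').1)
        have := nrm_nonneg p (M.dens q').1
        gcongr
    _ = C * D := by ring

/-- The Lipschitz bound on `h`.  Since `F` is a probability density, `H(r', ·)` may be recentred
at one of its values, so that only the oscillation of `H` matters and not its size. -/
lemma exists_liph {n : ℕ} {a : ℝ} (K : ℝ≥0) :
    ∃ C : ℝ≥0, ∀ M : GrowthModel n, M.LipF 2 a K → M.LipH a K → M.Liph a C := by
  set C : ℝ := K * 2 * normConst n * K + K + 1
  have hC : 0 ≤ C := by have := (normConst_pos (n := n)).le; positivity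
  refine ⟨C.toNNReal, fun M hF hH => M.liph_iff.2 fun q hq q' hq' => ?_⟩
  rw [Real.coe_toNNReal _ hC]
  rw [GrowthModel.lipH_iff] at hH
  set D := nrm 2 (q.1.1 - q'.1.1) + dist q.2 q'.2 with hDdef
  have hD1 : nrm 2 (q.1.1 - q'.1.1) ≤ D := le_add_of_nonneg_right dist_nonneg
  have hD2 : dist q.2 q'.2 ≤ D := le_add_of_nonneg_left (nrm_nonneg _ _)
  have h1 : nrm 2 ((M.dens q).1 - (M.dens q').1) ≤ K * D := M.lipF_iff.1 hF q hq q' hq'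
  have hcont : ∀ q ∈ M.Ae ∞ a, Continuous (M.H q.1) := fun q hq => by
    refine (LipschitzWith.of_dist_le_mul (K := K) fun z z' => ?_).continuous
    have := hH q hq q hq z z'
    rwa [sub_self, nrm_zero, zero_add] at this
  have hint : ∀ f : C(Sph n, ℝ), ∀ G : Sph n → Eucl n, Continuous G →
      Integrable (fun ξ => f ξ • G ξ) (surf n) := fun f G hG =>
    (f.continuous.smul hG).integrable_of_hasCompactSupport (.of_compactSpace _)
  have hne : Nonempty (Sph n) := by
    by_contra hc
    rw [not_nonempty_iff] at hc
    exact M.surf_ne_zero (Measure.eq_zero_of_isEmpty _)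
  obtain ⟨z₀⟩ := hne
  have hF0 : ∫ ξ, ((M.dens q).1 - (M.dens q').1) ξ ∂(surf n) = 0 := by
    have := integral_sub (integrable_continuousMap (M.dens q).1)
      (integrable_continuousMap (M.dens q').1)
    rw [M.integral_dens, M.integral_dens, sub_self] at this
    exact this
  have hdec : (∫ ξ, (M.dens q).1 ξ • M.H q.1 ξ ∂(surf n)) -
      (∫ ξ, (M.dens q').1 ξ • M.H q'.1 ξ ∂(surf n)) =
      (∫ ξ, ((M.dens q).1 - (M.dens q').1) ξ • (M.H q.1 ξ - M.H q.1 z₀) ∂(surf n)) +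
        ∫ ξ, (M.dens q').1 ξ • (M.H q.1 ξ - M.H q'.1 ξ) ∂(surf n) := by
    have e1 : ∫ ξ, ((M.dens q).1 - (M.dens q').1) ξ • M.H q.1 z₀ ∂(surf n) = 0 := by
      rw [integral_smul_const, hF0, zero_smul]
    have e2 : ∀ ξ, ((M.dens q).1 - (M.dens q').1) ξ • (M.H q.1 ξ - M.H q.1 z₀) =
        (M.dens q).1 ξ • M.H q.1 ξ - (M.dens q').1 ξ • M.H q.1 ξ -
          ((M.dens q).1 - (M.dens q').1) ξ • M.H q.1 z₀ := fun ξ => by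
      rw [smul_sub, ContinuousMap.sub_apply, sub_smul]
    have e3 : ∀ ξ, (M.dens q').1 ξ • (M.H q.1 ξ - M.H q'.1 ξ) =
        (M.dens q').1 ξ • M.H q.1 ξ - (M.dens q').1 ξ • M.H q'.1 ξ := fun ξ => smul_sub _ _ _
    have i1 := hint (M.dens q).1 _ (hcont q hq)
    have i2 := hint (M.dens q').1 _ (hcont q hq)
    have i3 := hint (M.dens q').1 _ (hcont q' hq')
    have i4 := hint ((M.dens q).1 - (M.dens q').1) (fun _ => M.H q.1 z₀) continuous_const
    have i12 : Integrable (fun ξ => (M.dens q).1 ξ • M.H q.1 ξ - (M.dens q').1 ξ • M.H q.1 ξ)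
        (surf n) := i1.sub i2
    simp_rw [e2, e3]
    rw [integral_sub i12 i4, e1, integral_sub i2 i3, integral_sub i1 i2]
    abel
  have hb1 : ‖∫ ξ, ((M.dens q).1 - (M.dens q').1) ξ • (M.H q.1 ξ - M.H q.1 z₀) ∂(surf n)‖ ≤
      K * 2 * normConst n * K * D := by
    have hi : Integrable (fun ξ => |((M.dens q).1 - (M.dens q').1) ξ|) (surf n) :=
      integrable_continuousMap |(M.dens q).1 - (M.dens q').1|
    calc _ ≤ ∫ ξ, |((M.dens q).1 - (M.dens q').1) ξ| * (K * 2) ∂(surf n) := by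
          refine norm_integral_le_of_norm_le (hi.mul_const _) (ae_of_all _ fun ξ => ?_)
          rw [norm_smul, Real.norm_eq_abs]
          gcongr
          have := hH q hq q hq ξ z₀
          rw [sub_self, nrm_zero, zero_add, dist_eq_norm] at this
          exact this.trans (by gcongr; exact GrowthModel.dist_sph_le ξ z₀)
      _ ≤ (normConst n * (K * D)) * (K * 2) := by
          rw [integral_mul_const]
          gcongr
          exact (integral_abs_le _).trans
            (mul_le_mul_of_nonneg_left h1 (normConst_pos (n := n)).le)
      _ = _ := by ring
  have hb2 : ‖∫ ξ, (M.dens q').1 ξ • (M.H q.1 ξ - M.H q'.1 ξ) ∂(surf n)‖ ≤ K * D := by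
    calc _ ≤ ∫ ξ, (M.dens q').1 ξ * (K * D) ∂(surf n) := by
          refine norm_integral_le_of_norm_le ((integrable_continuousMap _).mul_const _)
            (ae_of_all _ fun ξ => ?_)
          rw [norm_smul, Real.norm_eq_abs, abs_of_nonneg (M.dens_nonneg q' ξ)]
          refine mul_le_mul_of_nonneg_left ?_ (M.dens_nonneg q' ξ)
          have := hH q hq q' hq' ξ ξ
          rw [dist_self, add_zero, dist_eq_norm] at this
          exact this.trans (by gcongr)
      _ = K * D := by rw [integral_mul_const, M.integral_dens, one_mul]
  rw [dist_eq_norm, GrowthModel.h, GrowthModel.h]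
  have : (∫ ξ, (M.dens q).1 ξ • M.H q.1 ξ ∂(surf n)) - q.2 -
      ((∫ ξ, (M.dens q').1 ξ • M.H q'.1 ξ ∂(surf n)) - q'.2) =
      ((∫ ξ, ((M.dens q).1 - (M.dens q').1) ξ • (M.H q.1 ξ - M.H q.1 z₀) ∂(surf n)) +
        ∫ ξ, (M.dens q').1 ξ • (M.H q.1 ξ - M.H q'.1 ξ) ∂(surf n)) - (q.2 - q'.2) := by
    rw [← hdec]; abel
  rw [this]
  calc _ ≤ _ := (norm_sub_le _ _).trans (add_le_add_left (norm_add_le _ _) _)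
    _ ≤ K * 2 * normConst n * K * D + K * D + D := by
        refine add_le_add (add_le_add hb1 hb2) ?_
        rwa [← dist_eq_norm]
    _ = C * D := by ring


/-! ### Invariant measures of the frozen particle -/

namespace GrowthModel

variable {n : ℕ} (M : GrowthModel n)

lemma measurableSet_dom_section (r : Cplus n) : MeasurableSet {x | (r, x) ∈ M.dom} :=
  (M.isOpen_dom.preimage (Continuous.prodMk_right r)).measurableSet

lemma ae_hitKernel {q : Cplus n × Eucl n} {s : Sph n → Prop} (h : ∀ᵐ ξ ∂(surf n), s ξ) :
    ∀ᵐ ξ ∂(M.hitKernel q), s ξ := by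
  rw [hitKernel_apply]
  exact withDensity_absolutelyContinuous _ _ h

/-- After one jump the particle lies in the section of `𝒜ᵉ_p(a)`, wherever it started. -/
lemma carriedBy_frozenKernel {p : ℝ≥0∞} {a : ℝ} {r : Cplus n} (hr : r ∈ A n p a) (x : Eucl n) :
    CarriedBy (M.frozenKernel r x) {y | (r, y) ∈ M.Ae p a} := by
  intro S hS hGS
  rw [frozenKernel_apply]
  refine (ae_map_iff (p := fun y => y ∈ S) (M.measurable_H_right r).aemeasurable hS).2 ?_
  exact (M.ae_hitKernel (M.ae_mem_Ae hr hr le_rfl)).mono fun ξ hξ => hGS hξ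

lemma section_nonempty {p : ℝ≥0∞} {a : ℝ} {r : Cplus n} (hr : r ∈ A n p a) :
    {y | (r, y) ∈ M.Ae p a}.Nonempty := by
  obtain ⟨ξ, hξ⟩ := M.exists_mem_Ae hr
  exact ⟨_, hξ⟩

/-- A measure which is invariant for the embedded chain gives full mass to the domain of `F`. -/
lemma isInvariant_iff {r : Cplus n} {ν : Measure (Eucl n)} :
    M.IsInvariant r ν ↔ IsProbabilityMeasure ν ∧ M.frozenKernel r ∘ₘ ν = ν := by
  constructor
  · rintro ⟨h1, -, h2⟩
    exact ⟨h1, (jumpLaw_invariant_iff (M.frozenKernel r) ν).1 h2⟩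
  · rintro ⟨h1, h2⟩
    refine ⟨h1, ?_, (jumpLaw_invariant_iff (M.frozenKernel r) ν).2 h2⟩
    obtain ⟨a, -, hr⟩ := exists_mem_A_top r
    have h := carriedBy_of_invariant (M.carriedBy_frozenKernel hr) h2 _
      (M.measurableSet_dom_section r) fun x hx => hx.1
    exact (prob_compl_eq_zero_iff (M.measurableSet_dom_section r)).1 h

variable {M}

lemma existsUnique_isInvariant {p : ℝ≥0∞} {a : ℝ} {r : Cplus n} (hr : r ∈ A n p a) {n₀ : ℕ} {δ : ℝ}
    (h : Minorised (M.frozenKernel r) {y | (r, y) ∈ M.Ae p a} n₀ δ) :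
    ∃! μ, M.IsInvariant r μ := by
  obtain ⟨μ, hμ, hinv⟩ := h.exists_invariant (M.section_nonempty hr) (M.carriedBy_frozenKernel hr)
  refine ⟨μ, M.isInvariant_iff.2 ⟨hμ, hinv⟩, fun μ' hμ' => ?_⟩
  obtain ⟨h1, h2⟩ := M.isInvariant_iff.1 hμ'
  exact h.invariant_unique (M.section_nonempty hr) (M.carriedBy_frozenKernel hr) h2 hinv

/-- A lower bound on `F` gives Doeblin's condition for a single step, with the normalised image of
the surface measure under `H(r, ·)`. -/
lemma minorised_of_lower {p : ℝ≥0∞} {a : ℝ} {r : Cplus n} {c : ℝ} (hc : 0 < c)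
    (h : ∀ q ∈ M.Ae p a, ∀ θ, c ≤ (M.dens q).1 θ) :
    Minorised (M.frozenKernel r) {y | (r, y) ∈ M.Ae p a} 1 (c * area n) := by
  have hω := M.area_pos
  refine ⟨le_rfl, mul_pos hc hω, ENNReal.ofReal (area n)⁻¹ • (surf n).map (M.H r), ⟨?_⟩, ?_⟩
  · rw [Measure.smul_apply, Measure.map_apply (M.measurable_H_right r) .univ, preimage_univ,
      surf_univ, smul_eq_mul, ← ENNReal.ofReal_mul (inv_nonneg.2 hω.le), inv_mul_cancel₀ hω.ne',
      ENNReal.ofReal_one]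
  · intro x hx
    rw [pow_one, frozenKernel_apply, smul_smul, ← ENNReal.ofReal_mul (mul_pos hc hω).le,
      mul_inv_cancel_right₀ hω.ne', ← Measure.map_smul]
    refine Measure.map_mono ?_ (M.measurable_H_right r)
    rw [hitKernel_apply, ← withDensity_const]
    exact withDensity_mono (ae_of_all _ fun θ => ENNReal.ofReal_le_ofReal (h _ hx θ))

lemma IsInvariant.ae_mem {r : Cplus n} {ν : Measure (Eucl n)} (h : M.IsInvariant r ν) {p : ℝ≥0∞}
    {a : ℝ} (hr : r ∈ A n p a) : CarriedBy ν {y | (r, y) ∈ M.Ae p a} :=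
  carriedBy_of_invariant (M.carriedBy_frozenKernel hr) (M.isInvariant_iff.1 h).2

lemma IsInvariant.ae_dens_le {r : Cplus n} {ν : Measure (Eucl n)} (h : M.IsInvariant r ν)
    {p : ℝ≥0∞} {a : ℝ} (hr : r ∈ A n p a) {B : ℝ} (hB0 : 0 ≤ B)
    (hB : ∀ q ∈ M.Ae p a, ∀ θ, (M.dens q).1 θ ≤ B) : ∀ᵐ x ∂ν, ‖(M.dens (r, x)).1‖ ≤ B := by
  refine h.ae_mem hr {x | ‖(M.dens (r, x)).1‖ ≤ B} ?_ fun x hx => ?_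
  · exact measurableSet_le (M.measurable_dens_coe.comp measurable_prodMk_left).norm
      measurable_const
  · refine (ContinuousMap.norm_le _ hB0).2 fun θ => ?_
    rw [Real.norm_of_nonneg (M.dens_nonneg _ θ)]
    exact hB _ hx θ

/-! ### The averaged density and the averaged drift -/

lemma IsInvariant.integrable_dens (hU : M.UpperF) {r : Cplus n} {ν : Measure (Eucl n)}
    (h : M.IsInvariant r ν) : Integrable (fun x => (M.dens (r, x)).1) ν := by
  have := h.1
  obtain ⟨a, ha, hr⟩ := exists_mem_A_top r
  obtain ⟨B, hB0, hB⟩ := hU.exists_bound ha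
  exact .of_bound (M.measurable_dens_coe.comp measurable_prodMk_left).aestronglyMeasurable B
    (h.ae_dens_le hr hB0 hB)

lemma norm_bC_le {q : Cplus n × Eucl n} {a : ℝ} (ha : 0 < a) (h : ∀ θ, a ≤ q.1.1 θ) :
    ‖M.bC q‖ ≤ (a ^ (n - 1))⁻¹ * ‖(M.dens q).1‖ := by
  rw [← nrm_top_eq, ← nrm_top_eq]
  exact M.nrm_bC_le ha h

lemma IsInvariant.integrable_bC (hU : M.UpperF) {r : Cplus n} {ν : Measure (Eucl n)}
    (h : M.IsInvariant r ν) : Integrable (fun x => M.bC (r, x)) ν := by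
  obtain ⟨c, hc, hr⟩ := exists_lower r
  refine ((h.integrable_dens hU).norm.const_mul (c ^ (n - 1))⁻¹).mono'
    (M.measurable_bC.comp measurable_prodMk_left).aestronglyMeasurable (ae_of_all _ fun x => ?_)
  exact norm_bC_le hc hr

variable (M)

/-- The stationary hitting density `∫ F(r, x, ·) dν(x)` of the frozen particle. -/
noncomputable def avgDens (r : Cplus n) (ν : Measure (Eucl n)) : C(Sph n, ℝ) :=
  ∫ x, (M.dens (r, x)).1 ∂ν

/-- The averaged drift `∫ b(r, x) dν(x)` as a continuous function. -/
noncomputable def avgB (r : Cplus n) (ν : Measure (Eucl n)) : C(Sph n, ℝ) :=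
  ∫ x, M.bC (r, x) ∂ν

variable {M}

section Average

variable (hU : M.UpperF) {r : Cplus n} {ν : Measure (Eucl n)} (h : M.IsInvariant r ν)
include hU h

lemma IsInvariant.avgDens_apply (θ : Sph n) :
    M.avgDens r ν θ = ∫ x, (M.dens (r, x)).1 θ ∂ν :=
  ContinuousMap.integral_apply (h.integrable_dens hU) θ

lemma IsInvariant.avgB_apply (θ : Sph n) : M.avgB r ν θ = ∫ x, M.b (r, x) θ ∂ν :=
  ContinuousMap.integral_apply (h.integrable_bC hU) θ

lemma IsInvariant.avgDens_nonneg (θ : Sph n) : 0 ≤ M.avgDens r ν θ := by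
  rw [h.avgDens_apply hU]
  exact integral_nonneg fun x => M.dens_nonneg _ θ

/-- The invariant measure is the law of `H(r, ξ)` for `ξ` with the stationary hitting density. -/
lemma IsInvariant.eq_map : ν = ((surf n).withDensity fun ξ =>
    ENNReal.ofReal (M.avgDens r ν ξ)).map (M.H r) := by
  have hpr := h.1
  ext S hS
  conv_lhs => rw [← (M.isInvariant_iff.1 h).2]
  have hHS := M.measurable_H_right r hS
  rw [Measure.bind_apply hS (Kernel.aemeasurable _), Measure.map_apply (M.measurable_H_right r) hS,
    withDensity_apply _ hHS]
  have hm : Measurable fun z : Eucl n × Sph n => ENNReal.ofReal ((M.dens (r, z.1)).1 z.2) :=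
    (M.measurable_dens_eval.comp
      ((measurable_prodMk_left.comp measurable_fst).prodMk measurable_snd)).ennreal_ofReal
  calc ∫⁻ x, M.frozenKernel r x S ∂ν
      = ∫⁻ x, ∫⁻ ξ in M.H r ⁻¹' S, ENNReal.ofReal ((M.dens (r, x)).1 ξ) ∂(surf n) ∂ν := by
        refine lintegral_congr fun x => ?_
        rw [frozenKernel_apply, Measure.map_apply (M.measurable_H_right r) hS, hitKernel_apply,
          withDensity_apply _ hHS]
    _ = ∫⁻ ξ in M.H r ⁻¹' S, ∫⁻ x, ENNReal.ofReal ((M.dens (r, x)).1 ξ) ∂ν ∂(surf n) :=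
        lintegral_lintegral_swap hm.aemeasurable
    _ = _ := by
        refine lintegral_congr fun ξ => ?_
        have hi : Integrable (fun x => (M.dens (r, x)).1 ξ) ν :=
          (ContinuousMap.evalCLM ℝ ξ).integrable_comp (h.integrable_dens hU)
        rw [h.avgDens_apply hU,
          ofReal_integral_eq_lintegral_ofReal hi (ae_of_all _ fun x => M.dens_nonneg _ ξ)]

lemma IsInvariant.integral_eq {E : Type*} [NormedAddCommGroup E] [NormedSpace ℝ E]
    [MeasurableSpace E] [BorelSpace E] [SecondCountableTopology E] {φ : Eucl n → E}
    (hφ : Measurable φ) :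
    ∫ x, φ x ∂ν = ∫ ξ, M.avgDens r ν ξ • φ (M.H r ξ) ∂(surf n) := by
  conv_lhs => rw [h.eq_map hU]
  rw [integral_map (M.measurable_H_right r).aemeasurable hφ.aestronglyMeasurable,
    integral_withDensity_eq_integral_toReal_smul
      (M.avgDens r ν).continuous.measurable.ennreal_ofReal (ae_of_all _ fun _ => by simp)]
  refine integral_congr_ae (ae_of_all _ fun ξ => ?_)
  simp only [ENNReal.toReal_ofReal (h.avgDens_nonneg hU ξ)]

lemma IsInvariant.integral_avgDens : ∫ ξ, M.avgDens r ν ξ ∂(surf n) = 1 := by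
  have hpr := h.1
  have := h.integral_eq hU (φ := fun _ => (1 : ℝ)) measurable_const
  simpa using this.symm

end Average

end GrowthModel

lemma integrable_smul_of_bound {n : ℕ} {φ : Sph n → C(Sph n, ℝ)} (hφ : Measurable φ) {C : ℝ}
    (hC : ∀ᵐ ξ ∂(surf n), ‖φ ξ‖ ≤ C) (f : C(Sph n, ℝ)) :
    Integrable (fun ξ => f ξ • φ ξ) (surf n) := by
  refine ((integrable_continuousMap f).norm.mul_const C).mono'
    (f.continuous.measurable.smul hφ).aestronglyMeasurable (hC.mono fun ξ hξ => ?_)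
  rw [norm_smul]
  exact mul_le_mul_of_nonneg_left hξ (norm_nonneg _)

lemma nrm_one_eq {n : ℕ} (f : C(Sph n, ℝ)) : nrm 1 f = ∫ θ, |f θ| ∂(surf n) := by
  rw [nrm, L1.norm_eq_integral_norm]
  refine integral_congr_ae ?_
  filter_upwards [ContinuousMap.coeFn_toLp (p := 1) (𝕜 := ℝ) (surf n) f] with θ hθ
  rw [toL, hθ, Real.norm_eq_abs]


/-! ### Lipschitz dependence of the averaged drift on the domain -/

namespace GrowthModel

variable {n : ℕ} {M : GrowthModel n}

lemma norm_dens_le {q : Cplus n × Eucl n} {B : ℝ} (hB0 : 0 ≤ B) (h : ∀ θ, (M.dens q).1 θ ≤ B) :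
    ‖(M.dens q).1‖ ≤ B :=
  (ContinuousMap.norm_le _ hB0).2 fun θ => by
    rw [Real.norm_of_nonneg (M.dens_nonneg _ θ)]; exact h θ

lemma measurable_transport (r r' : Cplus n) : Measurable fun ξ => (r, M.H r' ξ) :=
  measurable_prodMk_left.comp (M.measurable_H_right r')

/-- The stationary hitting density is a Lipschitz function of the domain, in `L^1`.  It is a fixed
point of `f ↦ ∫ f(ξ) F(r, H(r, ξ), ·) dσ(ξ)`, which, by the lower bound on `F`, contracts `L^1`
distances of densities. -/
lemma nrm_one_avgDens_sub_le (hU : M.UpperF) {a : ℝ} (ha : a ∈ Ioo (0 : ℝ) 1) {c : ℝ} (hc : 0 < c)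
    (hlow : ∀ q ∈ M.Ae ∞ a, ∀ θ, c ≤ (M.dens q).1 θ) {r r' : Cplus n} (hr : r ∈ A n ∞ a)
    (hr' : r' ∈ A n ∞ a) {ν ν' : Measure (Eucl n)} (hν : M.IsInvariant r ν)
    (hν' : M.IsInvariant r' ν') {d : ℝ}
    (hd : ∀ᵐ ξ ∂(surf n), nrm 1 ((M.dens (r, M.H r ξ)).1 - (M.dens (r', M.H r' ξ)).1) ≤ d) :
    nrm 1 (M.avgDens r ν - M.avgDens r' ν') ≤ (c * area n)⁻¹ * d := by
  obtain ⟨B, hB0, hB⟩ := hU.exists_bound ha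
  have hω := M.area_pos
  set f := M.avgDens r ν
  set f' := M.avgDens r' ν'
  set D : Sph n → C(Sph n, ℝ) := fun ξ => (M.dens (r, M.H r ξ)).1
  set D' : Sph n → C(Sph n, ℝ) := fun ξ => (M.dens (r', M.H r' ξ)).1
  set e : C(Sph n, ℝ) := c • 1
  have hmem := M.ae_mem_Ae hr hr le_rfl
  have hmem' := M.ae_mem_Ae hr' hr' le_rfl
  have hDm : Measurable D := M.measurable_dens_coe.comp (measurable_transport r r)
  have hDm' : Measurable D' := M.measurable_dens_coe.comp (measurable_transport r' r')
  have hDB : ∀ᵐ ξ ∂(surf n), ‖D ξ‖ ≤ B := hmem.mono fun ξ hξ => norm_dens_le hB0 (hB _ hξ)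
  have hDB' : ∀ᵐ ξ ∂(surf n), ‖D' ξ‖ ≤ B := hmem'.mono fun ξ hξ => norm_dens_le hB0 (hB _ hξ)
  have i1 : Integrable (fun ξ => f ξ • D ξ) (surf n) := integrable_smul_of_bound hDm hDB f
  have i2 : Integrable (fun ξ => f ξ • D' ξ) (surf n) := integrable_smul_of_bound hDm' hDB' f
  have i3 : Integrable (fun ξ => f' ξ • D' ξ) (surf n) := integrable_smul_of_bound hDm' hDB' f'
  have i4 : Integrable (fun ξ => (f - f') ξ • e) (surf n) :=
    (integrable_continuousMap (f - f')).smul_const e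
  have hfix : f = ∫ ξ, f ξ • D ξ ∂(surf n) := hν.integral_eq hU
    (φ := fun x => (M.dens (r, x)).1) (M.measurable_dens_coe.comp measurable_prodMk_left)
  have hfix' : f' = ∫ ξ, f' ξ • D' ξ ∂(surf n) := hν'.integral_eq hU
    (φ := fun x => (M.dens (r', x)).1) (M.measurable_dens_coe.comp measurable_prodMk_left)
  have hzero : ∫ ξ, (f - f') ξ • e ∂(surf n) = 0 := by
    rw [integral_smul_const]
    have := integral_sub (integrable_continuousMap f) (integrable_continuousMap f')
    rw [hν.integral_avgDens hU, hν'.integral_avgDens hU, sub_self] at this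
    change (∫ ξ, (f ξ - f' ξ) ∂(surf n)) • e = 0
    rw [this, zero_smul]
  have i5 : Integrable (fun ξ => f ξ • (D ξ - D' ξ)) (surf n) := by
    simp only [smul_sub]
    exact i1.sub i2
  have i6 : Integrable (fun ξ => (f - f') ξ • (D' ξ - e)) (surf n) := by
    have : (fun ξ => (f - f') ξ • (D' ξ - e)) = fun ξ =>
        (f ξ • D' ξ - f' ξ • D' ξ) - (f - f') ξ • e := by
      funext ξ; rw [smul_sub, ContinuousMap.sub_apply, sub_smul]
    rw [this]
    exact (i2.sub i3).sub i4
  have hdec : f - f' = (∫ ξ, f ξ • (D ξ - D' ξ) ∂(surf n)) +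
      ∫ ξ, (f - f') ξ • (D' ξ - e) ∂(surf n) := by
    have h1 : ∫ ξ, f ξ • (D ξ - D' ξ) ∂(surf n) =
        f - ∫ ξ, f ξ • D' ξ ∂(surf n) := by
      simp_rw [smul_sub]
      rw [integral_sub i1 i2, ← hfix]
    have h2 : ∫ ξ, (f - f') ξ • (D' ξ - e) ∂(surf n) =
        (∫ ξ, f ξ • D' ξ ∂(surf n)) - f' := by
      have : ∀ ξ, (f - f') ξ • (D' ξ - e) = (f ξ • D' ξ - f' ξ • D' ξ) - (f - f') ξ • e :=
        fun ξ => by rw [smul_sub, ContinuousMap.sub_apply, sub_smul]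
      have i23 : Integrable (fun ξ => f ξ • D' ξ - f' ξ • D' ξ) (surf n) := i2.sub i3
      simp_rw [this]
      rw [integral_sub i23 i4, hzero, sub_zero, integral_sub i2 i3, ← hfix']
    rw [h1, h2]; abel
  have hb1 : nrm 1 (∫ ξ, f ξ • (D ξ - D' ξ) ∂(surf n)) ≤ d := by
    refine (nrm_integral_le 1 i5).trans ?_
    calc _ ≤ ∫ ξ, f ξ * d ∂(surf n) := by
          refine integral_mono_of_nonneg (ae_of_all _ fun ξ => nrm_nonneg _ _)
            ((integrable_continuousMap f).mul_const d) (hd.mono fun ξ hξ => ?_)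
          simp only [nrm_smul, abs_of_nonneg (hν.avgDens_nonneg hU ξ), f]
          exact mul_le_mul_of_nonneg_left hξ (hν.avgDens_nonneg hU ξ)
      _ = d := by rw [integral_mul_const, hν.integral_avgDens hU, one_mul]
  have hb2 : nrm 1 (∫ ξ, (f - f') ξ • (D' ξ - e) ∂(surf n)) ≤
      nrm 1 (f - f') * (1 - c * area n) := by
    refine (nrm_integral_le 1 i6).trans ?_
    rw [nrm_one_eq (f - f'), ← integral_mul_const]
    refine integral_mono_of_nonneg (ae_of_all _ fun ξ => nrm_nonneg _ _)
      ((integrable_continuousMap (f - f')).abs.mul_const _) (hmem'.mono fun ξ hξ => ?_)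
    simp only [nrm_smul]
    refine mul_le_mul_of_nonneg_left (le_of_eq ?_) (abs_nonneg _)
    have hpos : ∀ θ, |(D' ξ - e) θ| = (M.dens (r', M.H r' ξ)).1 θ - c := fun θ => by
      have : (D' ξ - e) θ = (M.dens (r', M.H r' ξ)).1 θ - c := by simp [D', e]
      rw [this, abs_of_nonneg (sub_nonneg.2 (hlow _ hξ θ))]
    rw [nrm_one_eq]
    simp_rw [hpos]
    rw [integral_sub (integrable_continuousMap _) (integrable_const _), M.integral_dens,
      integral_const, smul_eq_mul, mul_comm c]
    rfl
  have h3 : nrm 1 (f - f') ≤ d + nrm 1 (f - f') * (1 - c * area n) := by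
    conv_lhs => rw [hdec]
    exact (nrm_add_le _ _ _).trans (add_le_add hb1 hb2)
  rw [inv_mul_eq_div, le_div_iff₀ (mul_pos hc hω)]
  linarith

lemma lipBar_iff (hU : M.UpperF) {ν : Cplus n → Measure (Eucl n)}
    (hν : ∀ r, M.IsInvariant r (ν r)) {p : ℝ≥0∞} [Fact (1 ≤ p)] {a : ℝ} {K : ℝ≥0} :
    M.LipBar ν p a K ↔ ∀ r ∈ A n ∞ a, ∀ r' ∈ A n ∞ a,
      nrm p (M.avgB r (ν r) - M.avgB r' (ν r')) ≤ K * nrm p (r.1 - r'.1) := by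
  refine forall₄_congr fun r _ r' _ => ?_
  have h := eLpNorm_le_iff_nrm p (M.avgB r (ν r) - M.avgB r' (ν r')) (r.1 - r'.1) (0 : ℝ) 0 K
  rw [edist_self, dist_self, add_zero, add_zero] at h
  rw [← h]
  have : (fun θ => M.bBar ν r θ - M.bBar ν r' θ) = ⇑(M.avgB r (ν r) - M.avgB r' (ν r')) := by
    funext θ
    rw [ContinuousMap.sub_apply, (hν r).avgB_apply hU, (hν r').avgB_apply hU, bBar, bBar]
  rw [this]; rfl

lemma exists_lipBar (hF : ∀ p : ℝ≥0∞, (p = 2 ∨ p = ∞) → ∀ a ∈ Ioo (0 : ℝ) 1, ∃ K, M.LipF p a K)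
    (hH : ∀ a ∈ Ioo (0 : ℝ) 1, ∃ K, M.LipH a K) (hU : M.UpperF) (hL : M.LowerF)
    {ν : Cplus n → Measure (Eucl n)} (hν : ∀ r, M.IsInvariant r (ν r)) {p : ℝ≥0∞} [Fact (1 ≤ p)]
    (hp : p = 2 ∨ p = ∞) {a : ℝ} (ha : a ∈ Ioo (0 : ℝ) 1) : ∃ K, M.LipBar ν p a K := by
  obtain ⟨K₂, hK₂⟩ := hF 2 (Or.inl rfl) a ha
  obtain ⟨Kp, hKp⟩ := hF p hp a ha
  obtain ⟨KH, hKH⟩ := hH a ha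
  obtain ⟨B', hB'⟩ := hU.bddF hp ha
  obtain ⟨Cb, hCb⟩ := exists_lipB (n := n) hp ha.1 Kp B'
  replace hCb := M.lipB_iff.1 (hCb M hKp hB')
  obtain ⟨c, hc, hlow⟩ := hL _ (div_normConst_mem (n := n) ha)
  obtain ⟨B, hB0, hB⟩ := hU.exists_bound ha
  rw [bddF_iff] at hB'
  rw [lipF_iff] at hK₂
  rw [lipH_iff] at hKH
  set w := normConst n
  have hw : 0 < w := normConst_pos
  have hω := M.area_pos
  set C₁ : ℝ := (c * area n)⁻¹ * (w * (K₂ * (1 + KH)) * w)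
  have hC₁ : 0 ≤ C₁ := by positivity
  set C : ℝ := Cb * (1 + KH * w) + C₁ * ((a ^ (n - 1))⁻¹ * B')
  have ha0 := ha.1
  have hC : 0 ≤ C := by positivity
  refine ⟨C.toNNReal, (lipBar_iff hU hν).2 fun r hr r' hr' => ?_⟩
  rw [Real.coe_toNNReal _ hC]
  have hmem := M.ae_mem_Ae hr hr le_rfl
  have hmem' := M.ae_mem_Ae hr' hr' le_rfl
  set N := nrm p (r.1 - r'.1)
  have hN : 0 ≤ N := nrm_nonneg _ _
  have h2N : nrm 2 (r.1 - r'.1) ≤ w * N := nrm_two_le p hp _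
  -- the two transported particles are compared at the same hitting angle
  have hdist : ∀ᵐ ξ ∂(surf n), dist (M.H r ξ) (M.H r' ξ) ≤ KH * nrm 2 (r.1 - r'.1) := by
    filter_upwards [hmem, hmem'] with ξ h1 h2
    have := hKH _ h1 _ h2 ξ ξ
    rwa [dist_self, add_zero] at this
  have hL1 : nrm 1 (M.avgDens r (ν r) - M.avgDens r' (ν r')) ≤ C₁ * N := by
    have hd : ∀ᵐ ξ ∂(surf n), nrm 1 ((M.dens (r, M.H r ξ)).1 - (M.dens (r', M.H r' ξ)).1) ≤
        w * (K₂ * (1 + KH)) * w * N := by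
      filter_upwards [hmem, hmem', hdist] with ξ h1 h2 h3
      rw [nrm_one_eq]
      refine (integral_abs_le _).trans ?_
      calc _ ≤ w * (K₂ * (nrm 2 (r.1 - r'.1) + KH * nrm 2 (r.1 - r'.1))) := by
            refine mul_le_mul_of_nonneg_left ((hK₂ _ h1 _ h2).trans ?_) hw.le
            refine mul_le_mul_of_nonneg_left (add_le_add_right h3 _) K₂.coe_nonneg
        _ ≤ w * (K₂ * (w * N + KH * (w * N))) := by gcongr
        _ = _ := by ring
    refine (nrm_one_avgDens_sub_le hU ha hc (fun q hq => hlow q (M.Ae_top_subset_two ha.1 hq))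
      hr hr' (hν r) (hν r') hd).trans (le_of_eq ?_)
    ring
  set f := M.avgDens r (ν r)
  set f' := M.avgDens r' (ν r')
  set D : Sph n → C(Sph n, ℝ) := fun ξ => M.bC (r, M.H r ξ)
  set D' : Sph n → C(Sph n, ℝ) := fun ξ => M.bC (r', M.H r' ξ)
  have hDm : Measurable D := M.measurable_bC.comp (measurable_transport r r)
  have hDm' : Measurable D' := M.measurable_bC.comp (measurable_transport r' r')
  have hra := ((mem_A_iff ha.1).1 hr).1
  have hra' := ((mem_A_iff ha.1).1 hr').1
  have hDB : ∀ᵐ ξ ∂(surf n), ‖D ξ‖ ≤ (a ^ (n - 1))⁻¹ * B := hmem.mono fun ξ hξ =>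
    (norm_bC_le ha.1 hra).trans
      (mul_le_mul_of_nonneg_left (norm_dens_le hB0 (hB _ hξ)) (by positivity))
  have hDB' : ∀ᵐ ξ ∂(surf n), ‖D' ξ‖ ≤ (a ^ (n - 1))⁻¹ * B := hmem'.mono fun ξ hξ =>
    (norm_bC_le ha.1 hra').trans
      (mul_le_mul_of_nonneg_left (norm_dens_le hB0 (hB _ hξ)) (by positivity))
  have i1 : Integrable (fun ξ => f ξ • D ξ) (surf n) := integrable_smul_of_bound hDm hDB f
  have i2 : Integrable (fun ξ => f ξ • D' ξ) (surf n) := integrable_smul_of_bound hDm' hDB' f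
  have i3 : Integrable (fun ξ => f' ξ • D' ξ) (surf n) := integrable_smul_of_bound hDm' hDB' f'
  have i5 : Integrable (fun ξ => f ξ • (D ξ - D' ξ)) (surf n) := by
    simp only [smul_sub]
    exact i1.sub i2
  have i6 : Integrable (fun ξ => (f - f') ξ • D' ξ) (surf n) := by
    simp only [ContinuousMap.sub_apply, sub_smul]
    exact i2.sub i3
  have e1 : M.avgB r (ν r) = ∫ ξ, f ξ • D ξ ∂(surf n) := (hν r).integral_eq hU
    (φ := fun x => M.bC (r, x)) (M.measurable_bC.comp measurable_prodMk_left)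
  have e2 : M.avgB r' (ν r') = ∫ ξ, f' ξ • D' ξ ∂(surf n) := (hν r').integral_eq hU
    (φ := fun x => M.bC (r', x)) (M.measurable_bC.comp measurable_prodMk_left)
  have hdec : M.avgB r (ν r) - M.avgB r' (ν r') = (∫ ξ, f ξ • (D ξ - D' ξ) ∂(surf n)) +
      ∫ ξ, (f - f') ξ • D' ξ ∂(surf n) := by
    rw [e1, e2]
    simp_rw [smul_sub, ContinuousMap.sub_apply, sub_smul]
    rw [integral_sub i1 i2, integral_sub i2 i3]
    abel
  rw [hdec]
  refine (nrm_add_le _ _ _).trans ?_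
  have hb1 : nrm p (∫ ξ, f ξ • (D ξ - D' ξ) ∂(surf n)) ≤ Cb * (1 + KH * w) * N := by
    refine (nrm_integral_le p i5).trans ?_
    calc _ ≤ ∫ ξ, f ξ * (Cb * (1 + KH * w) * N) ∂(surf n) := by
          refine integral_mono_of_nonneg (ae_of_all _ fun ξ => nrm_nonneg _ _)
            ((integrable_continuousMap f).mul_const _) ?_
          filter_upwards [hmem, hmem', hdist] with ξ h1 h2 h3
          simp only [nrm_smul, abs_of_nonneg ((hν r).avgDens_nonneg hU ξ), f]
          refine mul_le_mul_of_nonneg_left ((hCb _ h1 _ h2).trans ?_)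
            ((hν r).avgDens_nonneg hU ξ)
          calc _ ≤ (Cb : ℝ) * (N + KH * (w * N)) := by
                refine mul_le_mul_of_nonneg_left (add_le_add_right (h3.trans ?_) _)
                  Cb.coe_nonneg
                gcongr
            _ = _ := by ring
      _ = _ := by rw [integral_mul_const, (hν r).integral_avgDens hU, one_mul]
  have hb2 : nrm p (∫ ξ, (f - f') ξ • D' ξ ∂(surf n)) ≤
      C₁ * N * ((a ^ (n - 1))⁻¹ * B') := by
    refine (nrm_integral_le p i6).trans ?_
    calc _ ≤ ∫ ξ, |(f - f') ξ| * ((a ^ (n - 1))⁻¹ * B') ∂(surf n) := by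
          refine integral_mono_of_nonneg (ae_of_all _ fun ξ => nrm_nonneg _ _)
            ((integrable_continuousMap (f - f')).abs.mul_const _) (hmem'.mono fun ξ hξ => ?_)
          simp only [nrm_smul]
          refine mul_le_mul_of_nonneg_left ((M.nrm_bC_le ha.1 hra').trans ?_) (abs_nonneg _)
          exact mul_le_mul_of_nonneg_left (hB' _ hξ) (by positivity)
      _ ≤ _ := by
          rw [integral_mul_const, ← nrm_one_eq]
          exact mul_le_mul_of_nonneg_right hL1 (by positivity)
  calc _ ≤ _ := add_le_add hb1 hb2
    _ = _ := by ring

end GrowthModel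


/-! ### The averaged equation -/

lemma nrm_two_sq {n : ℕ} (f : C(Sph n, ℝ)) : nrm 2 f ^ 2 = ∫ θ, f θ ^ 2 ∂(surf n) := by
  have h := real_inner_self_eq_norm_sq (toL n 2 f)
  rw [nrm, ← h, toL, ContinuousMap.inner_toLp]
  simp only [conj_trivial, sq]

/-- Integration against a fixed continuous density, as a continuous linear functional. -/
noncomputable def pairing {n : ℕ} (g : C(Sph n, ℝ)) : C(Sph n, ℝ) →L[ℝ] ℝ :=
  (innerSL ℝ (toL n 2 g)).comp (toL n 2)

lemma pairing_apply {n : ℕ} (g f : C(Sph n, ℝ)) : pairing g f = ∫ θ, g θ * f θ ∂(surf n) := by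
  simp only [pairing, ContinuousLinearMap.comp_apply, innerSL_apply_apply, toL]
  rw [ContinuousMap.inner_toLp]
  simp only [conj_trivial, mul_comm]

namespace GrowthModel

variable {n : ℕ} {M : GrowthModel n}

section Average

variable (hU : M.UpperF) {r : Cplus n} {ν : Measure (Eucl n)} (h : M.IsInvariant r ν)
include hU h

lemma IsInvariant.avgB_nonneg (θ : Sph n) : 0 ≤ M.avgB r ν θ := by
  rw [h.avgB_apply hU]
  exact integral_nonneg fun x => M.b_nonneg _ θ

/-- The averaged growth rate of the volume is normalised as well. -/
lemma IsInvariant.integral_pow_mul_avgB :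
    ∫ θ, r.1 θ ^ (n - 1) * M.avgB r ν θ ∂(surf n) = 1 := by
  have hpr := h.1
  have h1 := (pairing (r.1 ^ (n - 1))).integral_comp_comm (h.integrable_bC hU)
  have h2 : ∀ x, pairing (r.1 ^ (n - 1)) (M.bC (r, x)) = 1 := fun x => by
    rw [pairing_apply]
    exact M.integral_pow_mul_b (r, x)
  simp_rw [h2] at h1
  rw [pairing_apply] at h1
  rw [integral_const, smul_eq_mul, mul_one, probReal_univ] at h1
  exact h1.symm

omit hU in
lemma IsInvariant.norm_avgB_le {p : ℝ≥0∞} {a : ℝ} (hr : r ∈ A n p a) {B : ℝ} (hB0 : 0 ≤ B)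
    (hB : ∀ q ∈ M.Ae p a, ∀ θ, (M.dens q).1 θ ≤ B) {c : ℝ} (hc : 0 < c) (hrc : ∀ θ, c ≤ r.1 θ) :
    ‖M.avgB r ν‖ ≤ (c ^ (n - 1))⁻¹ * B := by
  have hpr := h.1
  have := norm_integral_le_of_norm_le_const (μ := ν) (f := fun x => M.bC (r, x))
    (C := (c ^ (n - 1))⁻¹ * B) ((h.ae_dens_le hr hB0 hB).mono fun x hx =>
      (norm_bC_le hc hrc).trans (mul_le_mul_of_nonneg_left hx (by positivity)))
  simpa [avgB] using this

end Average

/-! ### Truncation of the vector field -/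

lemma le_inv_self {a : ℝ} (ha : a ∈ Ioo (0 : ℝ) 1) : a ≤ a⁻¹ :=
  ha.2.le.trans ((one_le_inv₀ ha.1).2 ha.2.le)

/-- The pointwise truncation of a function to the interval `[a, 1 / a]`. -/
noncomputable def trunc {a : ℝ} (ha : a ∈ Ioo (0 : ℝ) 1) (f : C(Sph n, ℝ)) : Cplus n :=
  ⟨⟨fun θ => projIcc a a⁻¹ (le_inv_self ha) (f θ), by fun_prop⟩,
    fun θ => ha.1.trans_le (projIcc a a⁻¹ (le_inv_self ha) (f θ)).2.1⟩

lemma trunc_mem {a : ℝ} (ha : a ∈ Ioo (0 : ℝ) 1) (f : C(Sph n, ℝ)) : trunc ha f ∈ A n ∞ a :=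
  (mem_A_top_iff ha.1).2 fun θ => (projIcc a a⁻¹ (le_inv_self ha) (f θ)).2

lemma trunc_eq {a : ℝ} (ha : a ∈ Ioo (0 : ℝ) 1) {f : C(Sph n, ℝ)}
    (hf : ∀ θ, f θ ∈ Icc a a⁻¹) : (trunc ha f).1 = f := by
  ext θ
  change (projIcc a a⁻¹ (le_inv_self ha) (f θ) : ℝ) = f θ
  rw [projIcc_of_mem _ (hf θ)]

lemma norm_trunc_sub_le {a : ℝ} (ha : a ∈ Ioo (0 : ℝ) 1) (f g : C(Sph n, ℝ)) :
    ‖(trunc ha f).1 - (trunc ha g).1‖ ≤ ‖f - g‖ :=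
  (ContinuousMap.norm_le _ (norm_nonneg _)).2 fun θ =>
    (abs_projIcc_sub_projIcc (le_inv_self ha)).trans ((f - g).norm_coe_le_norm θ)

/-- The vector field of the averaged equation. -/
noncomputable def field (M : GrowthModel n) (ν : Cplus n → Measure (Eucl n)) (r : Cplus n) :
    C(Sph n, ℝ) := M.avgB r (ν r)

/-- The vector field of the averaged equation, composed with the truncation. -/
noncomputable def truncField (M : GrowthModel n) (ν : Cplus n → Measure (Eucl n)) {a : ℝ}
    (ha : a ∈ Ioo (0 : ℝ) 1) (f : C(Sph n, ℝ)) : C(Sph n, ℝ) := M.field ν (trunc ha f)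

/-- `r` solves the averaged differential equation on `[0, T]`. -/
def IsSolutionOn (M : GrowthModel n) (ν : Cplus n → Measure (Eucl n)) (r₀ : Cplus n) (T : ℝ)
    (r : ℝ → Cplus n) : Prop :=
  r 0 = r₀ ∧ ∀ t ∈ Icc 0 T, HasDerivWithinAt (fun s => (r s).1) (M.field ν (r t)) (Icc 0 T) t

section ODE

variable (hU : M.UpperF) {ν : Cplus n → Measure (Eucl n)} (hν : ∀ r, M.IsInvariant r (ν r))
  (hLip : ∀ a ∈ Ioo (0 : ℝ) 1, ∃ K, M.LipBar ν ∞ a K)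
include hU hν

lemma field_apply (r : Cplus n) (θ : Sph n) : M.field ν r θ = M.bBar ν r θ :=
  (hν r).avgB_apply hU θ

lemma exists_norm_truncField_le {a : ℝ} (ha : a ∈ Ioo (0 : ℝ) 1) :
    ∃ L : ℝ≥0, ∀ f, ‖M.truncField ν ha f‖ ≤ L := by
  obtain ⟨B, hB0, hB⟩ := hU.exists_bound ha
  have ha0 := ha.1
  refine ⟨⟨(a ^ (n - 1))⁻¹ * B, by positivity⟩, fun f => ?_⟩
  exact (hν _).norm_avgB_le (trunc_mem ha f) hB0 hB ha.1
    ((mem_A_iff ha.1).1 (trunc_mem ha f)).1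

include hLip

lemma exists_field_lipschitz {a : ℝ} (ha : a ∈ Ioo (0 : ℝ) 1) :
    ∃ K : ℝ≥0, ∀ r ∈ A n ∞ a, ∀ r' ∈ A n ∞ a,
      ‖M.field ν r - M.field ν r'‖ ≤ K * ‖r.1 - r'.1‖ := by
  obtain ⟨K, hK⟩ := hLip a ha
  refine ⟨K, fun r hr r' hr' => ?_⟩
  rw [← nrm_top_eq, ← nrm_top_eq]
  exact (lipBar_iff hU hν).1 hK r hr r' hr'

lemma exists_truncField_lipschitz {a : ℝ} (ha : a ∈ Ioo (0 : ℝ) 1) :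
    ∃ K : ℝ≥0, LipschitzWith K (M.truncField ν ha) := by
  obtain ⟨K, hK⟩ := exists_field_lipschitz hU hν hLip ha
  refine ⟨K, LipschitzWith.of_dist_le_mul fun f g => ?_⟩
  rw [dist_eq_norm, dist_eq_norm]
  exact (hK _ (trunc_mem ha f) _ (trunc_mem ha g)).trans
    (mul_le_mul_of_nonneg_left (norm_trunc_sub_le ha f g) K.coe_nonneg)

lemma exists_truncated_solution {a : ℝ} (ha : a ∈ Ioo (0 : ℝ) 1) (r₀ : Cplus n) {T : ℝ}
    (hT : 0 ≤ T) : ∃ u : ℝ → C(Sph n, ℝ), u 0 = r₀.1 ∧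
      ∀ t ∈ Icc 0 T, HasDerivWithinAt u (M.truncField ν ha (u t)) (Icc 0 T) t := by
  obtain ⟨K, hK⟩ := exists_truncField_lipschitz hU hν hLip ha
  obtain ⟨L, hL⟩ := exists_norm_truncField_le hU hν ha
  have hpl : IsPicardLindelof (fun _ => M.truncField ν ha) (tmin := 0) (tmax := T)
      ⟨0, left_mem_Icc.2 hT⟩ r₀.1 (L * T.toNNReal) 0 L K :=
    .of_time_independent (fun f _ => hL f) hK.lipschitzOnWith (by simp [hT])
  exact hpl.exists_eq_forall_mem_Icc_hasDerivWithinAt₀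

omit hU hν hLip in
/-- A solution stays bounded above and away from zero. -/
lemma exists_mem_A_of_continuousOn {r : ℝ → Cplus n} {T : ℝ} (hr : ContinuousOn r (Icc 0 T)) :
    ∃ a ∈ Ioo (0 : ℝ) 1, ∀ t ∈ Icc 0 T, r t ∈ A n ∞ a := by
  rcases (Icc 0 T ×ˢ (univ : Set (Sph n))).eq_empty_or_nonempty with he | hne
  · refine ⟨1 / 2, by norm_num, fun t ht => (mem_A_top_iff (by norm_num)).2 fun θ => ?_⟩
    exact (he.subset (⟨ht, mem_univ θ⟩ : (t, θ) ∈ Icc 0 T ×ˢ (univ : Set (Sph n)))).elim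
  have hc : ContinuousOn (fun z : ℝ × Sph n => (r z.1).1 z.2) (Icc 0 T ×ˢ univ) :=
    continuous_eval.comp_continuousOn
      ((hr.comp continuousOn_fst fun z hz => hz.1).prodMk continuousOn_snd)
  have hK : IsCompact (Icc 0 T ×ˢ (univ : Set (Sph n))) := isCompact_Icc.prod isCompact_univ
  obtain ⟨z, hz, hmin⟩ := hK.exists_isMinOn hne hc
  obtain ⟨z', hz', hmax⟩ := hK.exists_isMaxOn hne hc
  obtain ⟨a, ha, h1, h2⟩ := exists_mem_A ((r z.1).1 z.2) ((r z'.1).1 z'.2) ((r z.1).2 z.2)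
  refine ⟨a, ha, fun t ht => (mem_A_top_iff ha.1).2 fun θ => ?_⟩
  exact ⟨h1.trans (hmin (⟨ht, mem_univ θ⟩ : (t, θ) ∈ Icc 0 T ×ˢ (univ : Set (Sph n)))),
    le_trans (hmax (⟨ht, mem_univ θ⟩ : (t, θ) ∈ Icc 0 T ×ˢ (univ : Set (Sph n)))) h2⟩

lemma continuousOn_field {r : ℝ → Cplus n} {T : ℝ} (hr : ContinuousOn r (Icc 0 T)) :
    ContinuousOn (fun t => M.field ν (r t)) (Icc 0 T) := by
  obtain ⟨a, ha, hA⟩ := exists_mem_A_of_continuousOn hr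
  obtain ⟨K, hK⟩ := exists_field_lipschitz hU hν hLip ha
  have h1 : LipschitzOnWith K (M.field ν) (A n ∞ a) :=
    LipschitzOnWith.of_dist_le_mul fun r hr r' hr' => by
      rw [dist_eq_norm, Subtype.dist_eq, dist_eq_norm]
      exact hK r hr r' hr'
  exact h1.continuousOn.comp hr hA

omit hU hν hLip in
lemma IsSolutionOn.continuousOn {r₀ : Cplus n} {T : ℝ} {r : ℝ → Cplus n}
    (h : M.IsSolutionOn ν r₀ T r) : ContinuousOn r (Icc 0 T) :=
  Topology.IsInducing.subtypeVal.continuousOn_iff.2 fun t ht =>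
    (h.2 t ht).continuousWithinAt

lemma IsSolutionOn.unique {r₀ : Cplus n} {T : ℝ} {r r' : ℝ → Cplus n}
    (h : M.IsSolutionOn ν r₀ T r) (h' : M.IsSolutionOn ν r₀ T r') : EqOn r r' (Icc 0 T) := by
  obtain ⟨a, ha, hA⟩ := exists_mem_A_of_continuousOn h.continuousOn
  obtain ⟨a', ha', hA'⟩ := exists_mem_A_of_continuousOn h'.continuousOn
  have hm : min a a' ∈ Ioo (0 : ℝ) 1 := ⟨lt_min ha.1 ha'.1, (min_le_left _ _).trans_lt ha.2⟩
  obtain ⟨K, hK⟩ := exists_truncField_lipschitz hU hν hLip hm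
  have key : ∀ {u : ℝ → Cplus n} {e : ℝ}, min a a' ≤ e → M.IsSolutionOn ν r₀ T u →
      (∀ t ∈ Icc 0 T, u t ∈ A n ∞ e) → ∀ t ∈ Ico 0 T,
      HasDerivWithinAt (fun s => (u s).1) (M.truncField ν hm (u t).1) (Ici t) t := by
    intro u e he hu hue t ht
    have h1 := (hu.2 t (Ico_subset_Icc_self ht)).mono_of_mem_nhdsWithin
      (Icc_mem_nhdsGE_of_mem ht)
    have h2 : trunc hm (u t).1 = u t := Subtype.ext (trunc_eq hm
      ((mem_A_top_iff hm.1).1 (A_anti hm.1 he (hue t (Ico_subset_Icc_self ht)))))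
    rwa [truncField, h2]
  have := ODE_solution_unique (v := fun _ => M.truncField ν hm) (fun _ => hK)
    (continuous_subtype_val.comp_continuousOn h.continuousOn)
    (key (min_le_left _ _) h hA) (continuous_subtype_val.comp_continuousOn h'.continuousOn)
    (key (min_le_right _ _) h' hA') (by simp [h.1, h'.1])
  exact fun t ht => Subtype.ext (this ht)

lemma IsSolutionOn.integral_eq {r₀ : Cplus n} {T : ℝ} {r : ℝ → Cplus n}
    (h : M.IsSolutionOn ν r₀ T r) {t : ℝ} (ht : t ∈ Icc 0 T) (θ : Sph n) :
    IntervalIntegrable (fun s => M.bBar ν (r s) θ) volume 0 t ∧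
      (r t).1 θ = r₀.1 θ + ∫ s in (0 : ℝ)..t, M.bBar ν (r s) θ := by
  have hcf := ((ContinuousMap.evalCLM ℝ θ).continuous).comp_continuousOn
    (continuousOn_field hU hν hLip h.continuousOn)
  have heq : (fun s => M.bBar ν (r s) θ) = (fun f : C(Sph n, ℝ) => f θ) ∘
      fun s => M.field ν (r s) := by
    funext s; exact (field_apply hU hν _ θ).symm
  have hsub : Icc 0 t ⊆ Icc 0 T := Icc_subset_Icc_right ht.2
  rw [heq]
  have hii : IntervalIntegrable ((fun f : C(Sph n, ℝ) => f θ) ∘ fun s => M.field ν (r s))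
      volume 0 t := (hcf.mono (by rwa [uIcc_of_le ht.1])).intervalIntegrable
  refine ⟨hii, ?_⟩
  have h1 := intervalIntegral.integral_eq_sub_of_hasDeriv_right_of_le ht.1
    (f := fun s => (r s).1 θ)
    (((ContinuousMap.evalCLM ℝ θ).continuous).comp_continuousOn
      (continuous_subtype_val.comp_continuousOn (h.continuousOn.mono hsub)))
    (fun x hx => by
      have hx' : x ∈ Ico 0 T := ⟨hx.1.le, hx.2.trans_le ht.2⟩
      have h2 := (h.2 x (Ico_subset_Icc_self hx')).mono_of_mem_nhdsWithin
        (Icc_mem_nhdsGT_of_mem hx')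
      exact (ContinuousMap.evalCLM ℝ θ).hasFDerivAt.comp_hasDerivWithinAt x h2) hii
  rw [h1, h.1]
  ring

lemma IsSolution.isSolutionOn {r₀ : Cplus n} {r : ℝ → Cplus n} (h : M.IsSolution ν r₀ r) {T : ℝ}
    (hT : 0 ≤ T) : M.IsSolutionOn ν r₀ T r := by
  refine ⟨h.2.1, ?_⟩
  have hc : ContinuousOn r (Icc 0 T) := h.1.mono Icc_subset_Ici_self
  have hcf := continuousOn_field hU hν hLip hc
  set g : ℝ → C(Sph n, ℝ) := IccExtend hT fun t : Icc 0 T => M.field ν (r t)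
  have hg : Continuous g := (continuousOn_iff_continuous_domRestrict.1 hcf).Icc_extend'
  have hgeq : ∀ t ∈ Icc 0 T, g t = M.field ν (r t) := fun t ht => IccExtend_of_mem hT _ ht
  have hd : ∀ t, HasDerivAt (fun t => r₀.1 + ∫ s in (0 : ℝ)..t, g s) (g t) t := fun t =>
    (intervalIntegral.integral_hasDerivAt_right (hg.intervalIntegrable _ _)
      hg.aestronglyMeasurable.stronglyMeasurableAtFilter hg.continuousAt).const_add _
  have heq : ∀ t ∈ Icc 0 T, (r t).1 = r₀.1 + ∫ s in (0 : ℝ)..t, g s := by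
    intro t ht
    ext θ
    rw [(h.2.2 t ht.1 θ).2, ContinuousMap.add_apply]
    congr 1
    have h1 := (ContinuousMap.evalCLM ℝ θ).intervalIntegral_comp_comm
      (hg.intervalIntegrable (μ := volume) 0 t)
    refine Eq.trans ?_ h1
    refine intervalIntegral.integral_congr fun s hs => ?_
    rw [uIcc_of_le ht.1] at hs
    change _ = g s θ
    rw [hgeq s ⟨hs.1, hs.2.trans ht.2⟩, field_apply hU hν]
  intro t ht
  rw [← hgeq t ht]
  exact (hd t).hasDerivWithinAt.congr heq (heq t ht)

end ODE

end GrowthModel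


/-! ### Global existence for the averaged equation -/

namespace GrowthModel

variable {n : ℕ} {M : GrowthModel n}

/-- On positive functions, a bound on the `L^n` norm is a bound on the `L^2` norm. -/
lemma nrm_two_le_sqrt (hn : 2 ≤ n) {f : C(Sph n, ℝ)} (hf : ∀ θ, 0 ≤ f θ) {Q : ℝ}
    (hQ : ∫ θ, f θ ^ n ∂(surf n) ≤ Q) : nrm 2 f ≤ √(area n + Q) := by
  refine Real.le_sqrt_of_sq_le ?_
  rw [nrm_two_sq]
  calc ∫ θ, f θ ^ 2 ∂(surf n) ≤ ∫ θ, (1 + f θ ^ n) ∂(surf n) := by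
        refine integral_mono (integrable_continuousMap (f ^ 2))
          ((integrable_const _).add (integrable_continuousMap (f ^ n))) fun θ => ?_
        rcases le_total (f θ) 1 with h | h
        · have h1 := pow_le_one₀ (n := 2) (hf θ) h
          have h2 := pow_nonneg (hf θ) n
          simp only
          linarith
        · have := pow_le_pow_right₀ h hn
          simp only
          linarith
    _ = area n + ∫ θ, f θ ^ n ∂(surf n) := by
        have hi : Integrable (fun θ => f θ ^ n) (surf n) := integrable_continuousMap (f ^ n)
        rw [integral_add (integrable_const _) hi, integral_const, smul_eq_mul, mul_one, area]
    _ ≤ _ := add_le_add_right hQ _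

variable (hU : M.UpperF) {ν : Cplus n → Measure (Eucl n)} (hν : ∀ r, M.IsInvariant r (ν r))
  (hLip : ∀ a ∈ Ioo (0 : ℝ) 1, ∃ K, M.LipBar ν ∞ a K)
include hU hν

lemma truncated_solution_mono {a : ℝ} (ha : a ∈ Ioo (0 : ℝ) 1) {T : ℝ} {u : ℝ → C(Sph n, ℝ)}
    (hu : ∀ t ∈ Icc 0 T, HasDerivWithinAt u (M.truncField ν ha (u t)) (Icc 0 T) t) (θ : Sph n) :
    MonotoneOn (fun t => u t θ) (Icc 0 T) := by
  refine monotoneOn_of_hasDerivWithinAt_nonneg (f' := fun t => M.truncField ν ha (u t) θ)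
    (convex_Icc 0 T) ?_ ?_ ?_
  · exact (ContinuousMap.evalCLM ℝ θ).continuous.comp_continuousOn
      fun t ht => (hu t ht).continuousWithinAt
  · intro t ht
    exact (ContinuousMap.evalCLM ℝ θ).hasFDerivAt.comp_hasDerivWithinAt t
      ((hu t (interior_subset ht)).mono interior_subset)
  · exact fun t _ => (hν _).avgB_nonneg hU θ

/-- As long as a solution is not affected by the truncation, its volume grows at unit rate. -/
lemma integral_pow_le_of_solution {a : ℝ} (ha : a ∈ Ioo (0 : ℝ) 1) {T : ℝ}
    {u : ℝ → C(Sph n, ℝ)}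
    (hu : ∀ t ∈ Icc 0 T, HasDerivWithinAt u (M.truncField ν ha (u t)) (Icc 0 T) t)
    (hua : ∀ t ∈ Icc 0 T, ∀ θ, u t θ ∈ Icc a a⁻¹) :
    ∀ t ∈ Icc 0 T, ∫ θ, u t θ ^ n ∂(surf n) ≤ ∫ θ, u 0 θ ^ n ∂(surf n) + n * t := by
  have hd : ∀ t ∈ Icc 0 T, HasDerivWithinAt (fun s => pairing 1 (u s ^ n))
      (pairing 1 ((n : C(Sph n, ℝ)) * u t ^ (n - 1) * M.truncField ν ha (u t)))
      (Icc 0 T) t := fun t ht =>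
    (pairing (n := n) 1).hasFDerivAt.comp_hasDerivWithinAt t ((hu t ht).fun_pow n)
  have hval : ∀ t ∈ Icc 0 T,
      pairing 1 ((n : C(Sph n, ℝ)) * u t ^ (n - 1) * M.truncField ν ha (u t)) = n := by
    intro t ht
    have h1 := (hν (trunc ha (u t))).integral_pow_mul_avgB hU
    rw [trunc_eq ha (hua t ht)] at h1
    rw [pairing_apply]
    calc _ = ∫ θ, (n : ℝ) * (u t θ ^ (n - 1) *
          M.avgB (trunc ha (u t)) (ν (trunc ha (u t))) θ) ∂(surf n) := by
          refine integral_congr_ae (ae_of_all _ fun θ => ?_)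
          simp [truncField, field, mul_assoc]
      _ = n := by rw [integral_const_mul, h1, mul_one]
  intro t ht
  have h := norm_image_sub_le_of_norm_deriv_le_segment' hd (C := n)
    (fun s hs => by rw [hval s (Ico_subset_Icc_self hs)]; simp) t ht
  have h1 := (le_abs_self _).trans h
  rw [pairing_apply, pairing_apply] at h1
  simp only [ContinuousMap.one_apply, one_mul, ContinuousMap.pow_apply, sub_zero] at h1
  linarith

include hLip

/-- The growth of the volume controls `‖r_t‖_2` independently of the truncation.  By (U) it then
controls the vector field, hence `‖r_t‖_∞`, so that a generous truncation is never active. -/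
lemma exists_isSolutionOn (hn : 2 ≤ n) (r₀ : Cplus n) {T : ℝ} (hT : 0 ≤ T) :
    ∃ r, M.IsSolutionOn ν r₀ T r := by
  obtain ⟨c, hc, hrc⟩ := exists_lower r₀
  set Q := ∫ θ, r₀.1 θ ^ n ∂(surf n) + n * T
  -- `a₂` from the volume bound, `L` from (U) at `a₂`, and the truncation level `a` from `L`
  obtain ⟨a₂, ha₂, ha₂c, ha₂Q⟩ := exists_mem_A c √(area n + Q) hc
  obtain ⟨B, hB⟩ := hU a₂ ha₂
  set L := (c ^ (n - 1))⁻¹ * |B|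
  have hL : 0 ≤ L := by positivity
  obtain ⟨a, ha, hac, haL⟩ := exists_mem_A c (‖r₀.1‖ + L * T + 1) hc
  obtain ⟨u, hu0, hu⟩ := exists_truncated_solution hU hν hLip ha r₀ hT
  have hmono := truncated_solution_mono hU hν ha hu
  have hcont : ContinuousOn u (Icc 0 T) := fun t ht => (hu t ht).continuousWithinAt
  have h0T : (0 : ℝ) ∈ Icc 0 T := left_mem_Icc.2 hT
  have hlow : ∀ t ∈ Icc 0 T, ∀ θ, c ≤ u t θ := fun t ht θ => by
    have := hmono θ h0T ht ht.1
    simp only [hu0] at this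
    exact (hrc θ).trans this
  have hIcc : ∀ t ∈ Icc 0 T, ‖u t‖ ≤ a⁻¹ → ∀ s ∈ Icc 0 t, ∀ θ, u s θ ∈ Icc a a⁻¹ := by
    intro t ht htn s hs θ
    have hs' : s ∈ Icc 0 T := ⟨hs.1, hs.2.trans ht.2⟩
    exact ⟨hac.trans (hlow s hs' θ), (hmono θ hs' ht hs.2).trans
      (((le_abs_self _).trans ((u t).norm_coe_le_norm θ)).trans htn)⟩
  have hbound : ∀ t ∈ Icc 0 T, ‖u t‖ ≤ a⁻¹ → ‖u t‖ ≤ ‖r₀.1‖ + L * T := by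
    intro t ht htn
    have hsub : Icc 0 t ⊆ Icc 0 T := Icc_subset_Icc_right ht.2
    have hu' : ∀ s ∈ Icc 0 t, HasDerivWithinAt u (M.truncField ν ha (u s)) (Icc 0 t) s :=
      fun s hs => (hu s (hsub hs)).mono hsub
    have hua := hIcc t ht htn
    have hvol := integral_pow_le_of_solution hU hν ha hu' hua
    have hfield : ∀ s ∈ Ico 0 t, ‖M.truncField ν ha (u s)‖ ≤ L := by
      intro s hs
      have hs' := Ico_subset_Icc_self hs
      have htr : (trunc ha (u s)).1 = u s := trunc_eq ha (hua s hs')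
      have hlow' : ∀ θ, c ≤ (trunc ha (u s)).1 θ := by
        rw [htr]; exact hlow s (hsub hs')
      refine (hν _).norm_avgB_le (p := 2) (a := a₂) ?_ (abs_nonneg B)
        (fun q hq θ => (hB q hq θ).trans (le_abs_self B)) hc hlow'
      refine (mem_A_iff ha₂.1).2 ⟨fun θ => ha₂c.trans (hlow' θ), ?_⟩
      rw [htr]
      refine (nrm_two_le_sqrt hn (fun θ => hc.le.trans (hlow s (hsub hs') θ)) ?_).trans ha₂Q
      refine (hvol s hs').trans ?_
      rw [hu0]
      have hsT : s ≤ T := hs.2.le.trans ht.2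
      have : (n : ℝ) * s ≤ n * T := by gcongr
      exact add_le_add_right this _
    have h1 := norm_image_sub_le_of_norm_deriv_le_segment' hu' hfield t (right_mem_Icc.2 ht.1)
    rw [sub_zero, hu0] at h1
    have h2 : ‖u t‖ ≤ ‖r₀.1‖ + ‖u t - r₀.1‖ := by
      have := norm_add_le r₀.1 (u t - r₀.1)
      rwa [add_sub_cancel] at this
    have h3 : L * t ≤ L * T := mul_le_mul_of_nonneg_left ht.2 hL
    linarith
  have hTT : T ∈ Icc 0 T := right_mem_Icc.2 hT
  have hend : ‖u T‖ ≤ a⁻¹ := by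
    by_contra hcon
    push Not at hcon
    have hLT : 0 ≤ L * T := mul_nonneg hL hT
    have h0 : ‖u 0‖ ≤ a⁻¹ := by rw [hu0]; linarith
    -- at a time when the norm equals `1 / a`, `hbound` still applies and gives a smaller norm
    obtain ⟨t, ht, hte⟩ := intermediate_value_Icc hT hcont.norm ⟨h0, hcon.le⟩
    have := hbound t ht hte.le
    simp only at hte
    linarith
  have htr : ∀ t ∈ Icc 0 T, (trunc ha (u t)).1 = u t := fun t ht =>
    trunc_eq ha (hIcc T hTT hend t ht)
  refine ⟨fun t => trunc ha (u t), Subtype.ext ((htr 0 h0T).trans hu0), fun t ht => ?_⟩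
  exact (hu t ht).congr htr (htr t ht)

omit hU hν hLip in
lemma IsSolutionOn.mono {r₀ : Cplus n} {T T' : ℝ} (hT : T ≤ T') {r : ℝ → Cplus n}
    (h : M.IsSolutionOn ν r₀ T' r) : M.IsSolutionOn ν r₀ T r :=
  have hsub : Icc 0 T ⊆ Icc 0 T' := Icc_subset_Icc_right hT
  ⟨h.1, fun t ht => (h.2 t (hsub ht)).mono hsub⟩

/-- The solutions on the intervals `[0, N]` are glued by uniqueness. -/
theorem exists_isSolution (hn : 2 ≤ n) (r₀ : Cplus n) : ∃ r : ℝ → Cplus n, M.IsSolution ν r₀ r ∧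
    (∀ r' : ℝ → Cplus n, M.IsSolution ν r₀ r' → EqOn r' r (Ici 0)) ∧
    ∀ T : ℝ, ∃ a₁ ∈ Ioo (0 : ℝ) 1, ∀ t ∈ Icc 0 T, r t ∈ A n ∞ a₁ := by
  choose u hu using fun N : ℕ => exists_isSolutionOn hU hν hLip hn r₀ (Nat.cast_nonneg (α := ℝ) N)
  set r : ℝ → Cplus n := fun t => u ⌈t⌉₊ t
  have hr : ∀ N : ℕ, EqOn r (u N) (Icc 0 N) := by
    intro N t ht
    have hle : ((⌈t⌉₊ : ℕ) : ℝ) ≤ N := by exact_mod_cast Nat.ceil_le.2 ht.2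
    exact IsSolutionOn.unique hU hν hLip (hu ⌈t⌉₊) ((hu N).mono hle) ⟨ht.1, Nat.le_ceil t⟩
  have hceil : ∀ t : ℝ, 0 ≤ t → t ∈ Icc (0 : ℝ) ⌈t⌉₊ := fun t ht => ⟨ht, Nat.le_ceil t⟩
  have hcN : ∀ N : ℕ, ContinuousOn r (Icc 0 N) := fun N =>
    (hu N).continuousOn.congr (hr N)
  have hcont : ContinuousOn r (Ici 0) := by
    intro t ht
    have h1 : t ∈ Icc (0 : ℝ) (⌈t⌉₊ + 1 : ℕ) :=
      ⟨ht, (Nat.le_ceil t).trans (by push_cast; linarith)⟩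
    refine ((hcN (⌈t⌉₊ + 1)) t h1).mono_of_mem_nhdsWithin ?_
    have h2 : Iio ((⌈t⌉₊ + 1 : ℕ) : ℝ) ∈ 𝓝 t := Iio_mem_nhds
      ((Nat.le_ceil t).trans_lt (by push_cast; linarith))
    filter_upwards [self_mem_nhdsWithin, mem_nhdsWithin_of_mem_nhds h2] with s hs hs'
    exact ⟨hs, (le_of_lt hs')⟩
  have hsol : M.IsSolution ν r₀ r := by
    refine ⟨hcont, ?_, fun t ht θ => ?_⟩
    · rw [hr 0 (by simp)]; exact (hu 0).1
    · have h1 := (hu ⌈t⌉₊).integral_eq hU hν hLip (hceil t ht) θ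
      have heq : EqOn (fun s => M.bBar ν (u ⌈t⌉₊ s) θ) (fun s => M.bBar ν (r s) θ) (uIcc 0 t) :=
        fun s hs => by
          rw [uIcc_of_le ht] at hs
          simp only
          rw [hr ⌈t⌉₊ ⟨hs.1, hs.2.trans (Nat.le_ceil t)⟩]
      refine ⟨h1.1.congr fun s hs => heq (uIoc_subset_uIcc hs), ?_⟩
      rw [hr ⌈t⌉₊ (hceil t ht), h1.2, intervalIntegral.integral_congr heq]
  refine ⟨r, hsol, fun r' hr' t ht => ?_, fun T => ?_⟩
  · exact IsSolutionOn.unique hU hν hLip (hr'.isSolutionOn hU hν hLip (T := t) ht)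
      (hsol.isSolutionOn hU hν hLip ht) (right_mem_Icc.2 ht)
  · exact exists_mem_A_of_continuousOn (hcont.mono Icc_subset_Ici_self)

end GrowthModel


/-! ### Decay of correlations for a minorised chain -/

section Correlation

variable {X : Type*} [MeasurableSpace X] {P : Kernel X X} [IsMarkovKernel P]

lemma integral_comp_measure {ρ : Measure X} [IsProbabilityMeasure ρ] {κ : Kernel X X}
    [IsMarkovKernel κ] {f : X → ℝ} (hf : Measurable f) {C : ℝ} (hC : ∀ x, |f x| ≤ C) :
    ∫ y, f y ∂(κ ∘ₘ ρ) = ∫ x, ∫ y, f y ∂(κ x) ∂ρ := by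
  rw [← Measure.snd_compProd, Measure.snd, integral_map measurable_snd.aemeasurable
    hf.aestronglyMeasurable, Measure.integral_compProd]
  exact integrable_of_bound (f := fun z : X × X => f z.2) (hf.comp measurable_snd)
    fun z => hC z.2

lemma chainLaw_map_pair (κ : Kernel X X) [IsMarkovKernel κ] (μ : Measure X)
    [IsProbabilityMeasure μ] (i k : ℕ) :
    (chainLaw κ μ).map (fun w => (w i, w (i + k))) =
      Measure.bind μ ⇑(κ ^ i) ⊗ₘ (κ ^ k) := by
  ext s hs
  have h := lintegral_chainLaw_pair κ μ i k (f := s.indicator 1) (measurable_one.indicator hs)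
  have hm : Measurable fun w : ℕ → X => (w i, w (i + k)) := by fun_prop
  rw [Measure.map_apply hm hs, Measure.compProd_apply hs, ← chainLaw_map_apply,
    lintegral_map (Kernel.measurable_kernel_prodMk_left hs) (measurable_pi_apply i),
    ← lintegral_indicator_one (hm hs)]
  refine Eq.trans h (lintegral_congr fun w => ?_)
  rw [← lintegral_indicator_one (measurable_prodMk_left hs)]
  rfl

variable {H : Type*} [NormedAddCommGroup H] [InnerProductSpace ℝ H] [MeasurableSpace H]
  [BorelSpace H] [SecondCountableTopology H] [CompleteSpace H]

/-- For a minorised chain, a function of mean zero decorrelates exponentially fast. -/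
lemma Minorised.abs_integral_inner_le {G : Set X} (hP : ∀ x, CarriedBy (P x) G) {n₀ : ℕ} {δ : ℝ}
    (h : Minorised P G n₀ δ) {ν : Measure X} [IsProbabilityMeasure ν] (hν : P ∘ₘ ν = ν)
    {γ : X → H} (hγ : Measurable γ) {C : ℝ} (hC : ∀ x, ‖γ x‖ ≤ C) (hγ0 : ∫ y, γ y ∂ν = 0)
    {x : X} (hx : x ∈ G) (i k : ℕ) :
    |∫ w, inner ℝ (γ (w i)) (γ (w (i + k))) ∂(chainLaw P (Measure.dirac x))| ≤
      (1 - δ) ^ (k / n₀) * (2 * C ^ 2) := by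
  have hC0 : 0 ≤ C := (norm_nonneg _).trans (hC x)
  have hδ1 : 0 ≤ 1 - δ := sub_nonneg.2 (h.le_one hx)
  have hbd : ∀ z y, |inner ℝ (γ z) (γ y)| ≤ C ^ 2 := fun z y => by
    refine (abs_real_inner_le_norm _ _).trans ?_
    rw [sq]
    exact mul_le_mul (hC z) (hC y) (norm_nonneg _) hC0
  have hm : Measurable fun z : X × X => inner ℝ (γ z.1) (γ z.2) :=
    (hγ.comp measurable_fst).inner (hγ.comp measurable_snd)
  have hmz : ∀ z, Measurable fun y => inner ℝ (γ z) (γ y) := fun z =>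
    hm.comp measurable_prodMk_left
  set g : X → ℝ := fun z => ∫ y, inner ℝ (γ z) (γ y) ∂((P ^ k) z)
  have hgm : Measurable g :=
    (hm.stronglyMeasurable.integral_kernel_prod_right' (κ := P ^ k)).measurable
  have hgG : ∀ z ∈ G, |g z| ≤ (1 - δ) ^ (k / n₀) * (2 * C ^ 2) := by
    intro z hz
    have hosc : OscLE (fun y => inner ℝ (γ z) (γ y)) G (2 * C ^ 2) :=
      ⟨-C ^ 2, fun y _ => by have := abs_le.1 (hbd z y); constructor <;> linarith⟩
    have h1 := (hosc.iterate hP h (hmz z) (hbd z) k).abs_integral_sub_le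
      (ρ := Measure.dirac z) (ρ' := ν)
      (fun S hS hGS => (ae_dirac_iff (p := fun x => x ∈ S) hS).2 (hGS hz))
      (carriedBy_of_invariant hP hν) (measurable_integral_pow P (hmz z) k)
      (abs_integral_pow_le P (hbd z) k)
    have hγi : Integrable γ ν := .of_bound hγ.aestronglyMeasurable C (ae_of_all _ hC)
    rw [integral_dirac' _ _ (measurable_integral_pow P (hmz z) k).stronglyMeasurable,
      ← integral_comp_measure (hmz z) (hbd z), comp_pow_eq hν, integral_inner hγi, hγ0,
      inner_zero_right, sub_zero] at h1
    exact h1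
  have hρ : IsProbabilityMeasure ((P ^ i) x) := inferInstance
  have hii : Measure.bind (Measure.dirac x) ⇑(P ^ i) = (P ^ i) x :=
    Measure.dirac_bind (Kernel.measurable _) x
  have hmp : Measurable fun w : ℕ → X => (w i, w (i + k)) := by fun_prop
  have h1 : ∫ w, inner ℝ (γ (w i)) (γ (w (i + k))) ∂(chainLaw P (Measure.dirac x)) =
      ∫ z, g z ∂((P ^ i) x) := by
    rw [← integral_map (f := fun z : X × X => inner ℝ (γ z.1) (γ z.2)) hmp.aemeasurable
      hm.aestronglyMeasurable, chainLaw_map_pair, hii, Measure.integral_compProd]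
    exact integrable_of_bound hm fun z => hbd z.1 z.2
  rw [h1]
  have hae : ∀ᵐ z ∂((P ^ i) x), ‖g z‖ ≤ (1 - δ) ^ (k / n₀) * (2 * C ^ 2) :=
    carriedBy_pow P hP i (Or.inl hx) {z | ‖g z‖ ≤ (1 - δ) ^ (k / n₀) * (2 * C ^ 2)}
      (measurableSet_le hgm.norm measurable_const) hgG
  simpa using norm_integral_le_of_norm_le_const hae

/-- Summability of the correlations, with explicit bound on the sum. -/
lemma sum_pow_div_le {δ : ℝ} (hδ : 0 < δ) (hδ1 : δ ≤ 1) {n₀ : ℕ} (hn : 1 ≤ n₀) (m : ℕ) :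
    ∑ k ∈ Finset.range m, (1 - δ) ^ (k / n₀) ≤ n₀ / δ := by
  have h0 : 0 ≤ 1 - δ := by linarith
  have h1 : ∀ l : ℕ, ∑ k ∈ Finset.range (n₀ * l), (1 - δ) ^ (k / n₀) =
      n₀ * ∑ j ∈ Finset.range l, (1 - δ) ^ j := by
    intro l
    induction l with
    | zero => simp
    | succ l ih =>
      rw [mul_add, mul_one, Finset.sum_range_add, ih, Finset.sum_range_succ, mul_add]
      congr 1
      rw [Finset.sum_congr rfl fun k hk => ?_, Finset.sum_const, Finset.card_range, nsmul_eq_mul]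
      rw [Nat.mul_add_div (by lia), Nat.div_eq_of_lt (Finset.mem_range.1 hk), add_zero]
  calc _ ≤ ∑ k ∈ Finset.range (n₀ * m), (1 - δ) ^ (k / n₀) :=
        Finset.sum_le_sum_of_subset_of_nonneg
          (Finset.range_subset_range.2 (Nat.le_mul_of_pos_left m (by lia)))
          fun _ _ _ => pow_nonneg h0 _
    _ ≤ n₀ / δ := by
      rw [h1, div_eq_mul_inv]
      refine mul_le_mul_of_nonneg_left ?_ (Nat.cast_nonneg _)
      have h2 : (∑ j ∈ Finset.range m, (1 - δ) ^ j) * δ = 1 - (1 - δ) ^ m := by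
        have := geom_sum_mul_neg (1 - δ) m
        rwa [sub_sub_cancel] at this
      rw [← one_div, le_div_iff₀ hδ, h2]
      linarith [pow_nonneg h0 m]

/-- Schur's test for a summable convolution kernel. -/
lemma sum_sum_mul_le {r : ℕ → ℝ} (hr : ∀ k, 0 ≤ r k) {S : ℝ}
    (hS : ∀ m, ∑ k ∈ Finset.range m, r k ≤ S) (a : ℕ → ℝ) (m : ℕ) :
    ∑ i ∈ Finset.range m, ∑ j ∈ Finset.range m, |a i| * |a j| * r (Nat.dist i j) ≤
      2 * S * ∑ i ∈ Finset.range m, a i ^ 2 := by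
  have hrow : ∀ i ∈ Finset.range m, ∑ j ∈ Finset.range m, r (Nat.dist i j) ≤ 2 * S := by
    intro i hi
    have him : i + 1 ≤ m := Finset.mem_range.1 hi
    rw [← Finset.sum_range_add_sum_Ico _ him, two_mul]
    refine add_le_add ?_ ?_
    · rw [Finset.sum_congr rfl fun j hj => by
        rw [Nat.dist_comm, Nat.dist_eq_sub_of_le (Nat.lt_succ_iff.1 (Finset.mem_range.1 hj))],
        Finset.sum_flip]
      exact hS _
    · rw [Finset.sum_congr rfl fun j hj => by
        rw [Nat.dist_eq_sub_of_le ((Nat.le_succ i).trans (Finset.mem_Ico.1 hj).1)],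
        Finset.sum_Ico_eq_sum_range]
      refine le_trans ?_ (hS (1 + (m - (i + 1))))
      rw [Finset.sum_range_add]
      refine le_trans (le_of_eq ?_) (le_add_of_nonneg_left (Finset.sum_nonneg fun k _ => hr k))
      refine Finset.sum_congr rfl fun k _ => ?_
      congr 1
      lia
  have hsym : ∑ i ∈ Finset.range m, ∑ j ∈ Finset.range m, a j ^ 2 * r (Nat.dist i j) =
      ∑ i ∈ Finset.range m, ∑ j ∈ Finset.range m, a i ^ 2 * r (Nat.dist i j) := by
    rw [Finset.sum_comm]
    simp_rw [Nat.dist_comm]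
  have hle : ∑ i ∈ Finset.range m, ∑ j ∈ Finset.range m, a i ^ 2 * r (Nat.dist i j) ≤
      2 * S * ∑ i ∈ Finset.range m, a i ^ 2 := by
    rw [Finset.mul_sum]
    refine Finset.sum_le_sum fun i hi => ?_
    rw [← Finset.mul_sum, mul_comm]
    exact mul_le_mul_of_nonneg_right (hrow i hi) (sq_nonneg _)
  have h1 : ∑ i ∈ Finset.range m, ∑ j ∈ Finset.range m, 2 * (|a i| * |a j| * r (Nat.dist i j)) ≤
      ∑ i ∈ Finset.range m, ∑ j ∈ Finset.range m,
        (a i ^ 2 * r (Nat.dist i j) + a j ^ 2 * r (Nat.dist i j)) := by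
    refine Finset.sum_le_sum fun i _ => Finset.sum_le_sum fun j _ => ?_
    rw [← add_mul, ← mul_assoc]
    refine mul_le_mul_of_nonneg_right ?_ (hr _)
    rw [← sq_abs (a i), ← sq_abs (a j), ← mul_assoc]
    exact two_mul_le_add_sq _ _
  simp_rw [Finset.sum_add_distrib] at h1
  rw [hsym] at h1
  simp_rw [← Finset.mul_sum] at h1
  simp_rw [← Finset.mul_sum] at hle ⊢
  linarith

/-- The second moment of a weighted sum along a minorised chain. -/
lemma Minorised.integral_norm_sq_sum_le {G : Set X} (hP : ∀ x, CarriedBy (P x) G) {n₀ : ℕ} {δ : ℝ}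
    (h : Minorised P G n₀ δ) {ν : Measure X} [IsProbabilityMeasure ν] (hν : P ∘ₘ ν = ν)
    {γ : X → H} (hγ : Measurable γ) {C : ℝ} (hC : ∀ x, ‖γ x‖ ≤ C) (hγ0 : ∫ y, γ y ∂ν = 0)
    {x : X} (hx : x ∈ G) (a : ℕ → ℝ) (m : ℕ) :
    ∫ w, ‖∑ i ∈ Finset.range m, a i • γ (w i)‖ ^ 2 ∂(chainLaw P (Measure.dirac x)) ≤
      2 * (n₀ / δ) * (2 * C ^ 2) * ∑ i ∈ Finset.range m, a i ^ 2 := by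
  have hC0 : 0 ≤ C := (norm_nonneg _).trans (hC x)
  have hδ1 : 0 ≤ 1 - δ := sub_nonneg.2 (h.le_one hx)
  set I : ℕ → ℕ → ℝ := fun i j =>
    ∫ w, inner ℝ (γ (w i)) (γ (w j)) ∂(chainLaw P (Measure.dirac x))
  have hI : ∀ i j, |I i j| ≤ (1 - δ) ^ (Nat.dist i j / n₀) * (2 * C ^ 2) := by
    intro i j
    rcases le_total i j with hij | hij
    · have := h.abs_integral_inner_le hP hν hγ hC hγ0 hx i (j - i)
      rw [Nat.add_sub_cancel' hij] at this
      rwa [Nat.dist_eq_sub_of_le hij]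
    · have := h.abs_integral_inner_le hP hν hγ hC hγ0 hx j (i - j)
      rw [Nat.add_sub_cancel' hij] at this
      rw [Nat.dist_comm, Nat.dist_eq_sub_of_le hij]
      refine le_trans (le_of_eq ?_) this
      simp only [I]
      congr 1
      exact integral_congr_ae (ae_of_all _ fun w => real_inner_comm _ _)
  have hint : ∀ i j, Integrable (fun w : ℕ → X => inner ℝ (γ (w i)) (γ (w j)))
      (chainLaw P (Measure.dirac x)) := fun i j => by
    refine integrable_of_bound (C := C * C) ((hγ.comp (measurable_pi_apply i)).inner
      (hγ.comp (measurable_pi_apply j))) fun w => ?_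
    exact (abs_real_inner_le_norm _ _).trans (mul_le_mul (hC _) (hC _) (norm_nonneg _) hC0)
  have hexp : ∀ w : ℕ → X, ‖∑ i ∈ Finset.range m, a i • γ (w i)‖ ^ 2 =
      ∑ i ∈ Finset.range m, ∑ j ∈ Finset.range m,
        a i * a j * inner ℝ (γ (w i)) (γ (w j)) := fun w => by
    rw [← real_inner_self_eq_norm_sq, sum_inner]
    refine Finset.sum_congr rfl fun i _ => ?_
    rw [inner_sum]
    refine Finset.sum_congr rfl fun j _ => ?_
    rw [real_inner_smul_left, real_inner_smul_right, mul_assoc]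
  simp_rw [hexp]
  rw [integral_finsetSum _ fun i _ => integrable_finsetSum _ fun j _ => (hint i j).const_mul _]
  simp_rw [fun i => integral_finsetSum (Finset.range m)
    (f := fun j (w : ℕ → X) => a i * a j * inner ℝ (γ (w i)) (γ (w j)))
    (μ := chainLaw P (Measure.dirac x)) fun j _ => (hint i j).const_mul _, integral_const_mul]
  have hschur := sum_sum_mul_le (r := fun k => (1 - δ) ^ (k / n₀)) (fun k => pow_nonneg hδ1 _)
    (sum_pow_div_le h.2.1 (h.le_one hx) h.1) a m
  calc _ ≤ ∑ i ∈ Finset.range m, ∑ j ∈ Finset.range m,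
        |a i| * |a j| * (1 - δ) ^ (Nat.dist i j / n₀) * (2 * C ^ 2) := by
        refine Finset.sum_le_sum fun i _ => Finset.sum_le_sum fun j _ => ?_
        refine (le_abs_self _).trans ?_
        rw [abs_mul, abs_mul, mul_assoc _ _ (2 * C ^ 2)]
        exact mul_le_mul_of_nonneg_left (hI i j) (by positivity)
    _ ≤ _ := by
        simp_rw [← Finset.sum_mul]
        have := mul_le_mul_of_nonneg_right hschur (show 0 ≤ 2 * C ^ 2 by positivity)
        refine this.trans (le_of_eq (by ring))

lemma Minorised.lintegral_norm_sq_sum_le {G : Set X} (hP : ∀ x, CarriedBy (P x) G) {n₀ : ℕ} {δ : ℝ}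
    (h : Minorised P G n₀ δ) {ν : Measure X} [IsProbabilityMeasure ν] (hν : P ∘ₘ ν = ν)
    {γ : X → H} (hγ : Measurable γ) {C : ℝ} (hC : ∀ x, ‖γ x‖ ≤ C) (hγ0 : ∫ y, γ y ∂ν = 0)
    {x : X} (hx : x ∈ G) (a : ℕ → ℝ) (m : ℕ) :
    ∫⁻ w, ENNReal.ofReal (‖∑ i ∈ Finset.range m, a i • γ (w i)‖ ^ 2)
        ∂(chainLaw P (Measure.dirac x)) ≤
      ENNReal.ofReal (2 * (n₀ / δ) * (2 * C ^ 2) * ∑ i ∈ Finset.range m, a i ^ 2) := by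
  have hm : Measurable fun w : ℕ → X => ∑ i ∈ Finset.range m, a i • γ (w i) :=
    Finset.measurable_fun_sum _ fun i _ => (hγ.comp (measurable_pi_apply i)).const_smul (a i)
  have hi : Integrable (fun w : ℕ → X => ‖∑ i ∈ Finset.range m, a i • γ (w i)‖ ^ 2)
      (chainLaw P (Measure.dirac x)) := by
    refine integrable_of_bound (C := (∑ i ∈ Finset.range m, |a i| * C) ^ 2)
      (hm.norm.pow_const 2) fun w => ?_
    rw [abs_of_nonneg (sq_nonneg _)]
    refine pow_le_pow_left₀ (norm_nonneg _) ((norm_sum_le _ _).trans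
      (Finset.sum_le_sum fun i _ => ?_)) 2
    rw [norm_smul]
    exact mul_le_mul_of_nonneg_left (hC _) (norm_nonneg _)
  rw [← ofReal_integral_eq_lintegral_ofReal hi (ae_of_all _ fun w => sq_nonneg _)]
  exact ENNReal.ofReal_le_ofReal (h.integral_norm_sq_sum_le hP hν hγ hC hγ0 hx a m)

end Correlation

/-! ### Occupation times of the clock -/

/-- The occupation measure of the arrival count over the time interval `(u, u + t]`. -/
noncomputable def occ (τ : ℕ → ℝ) (u t : ℝ) : Measure ℕ :=
  (volume.restrict (Ioc u (u + t))).map (arrivalCount 1 τ)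

lemma measurable_arrivalCount_right (ε : ℝ≥0) (τ : ℕ → ℝ) : Measurable (arrivalCount ε τ) :=
  (measurable_arrivalCount ε).comp measurable_prodMk_left

instance (τ : ℕ → ℝ) (u t : ℝ) : IsFiniteMeasure (occ τ u t) := by
  unfold occ; infer_instance

lemma IsClock.occ_restrict {τ : ℕ → ℝ} (hτ : IsClock τ) {u t : ℝ} (hu : 0 ≤ u) :
    (occ τ u t).restrict (Finset.range (arrivalCount 1 τ (u + t) + 1)) = occ τ u t := by
  refine Measure.restrict_eq_self_of_ae_mem ?_
  refine (ae_map_iff (measurable_arrivalCount_right 1 τ).aemeasurable .of_discrete).2 ?_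
  filter_upwards [ae_restrict_mem measurableSet_Ioc] with s hs
  simp only [Finset.coe_range, mem_Iio]
  exact Nat.lt_succ_of_le (hτ.arrivalCount_mono one_pos (hu.trans hs.1.le) hs.2)

lemma IsClock.integral_arrivalCount {τ : ℕ → ℝ} (hτ : IsClock τ) {u t : ℝ} (hu : 0 ≤ u)
    (ht : 0 ≤ t) (ψ : ℕ → ℝ) : ∫ s in u..(u + t), ψ (arrivalCount 1 τ s) =
      ∑ i ∈ Finset.range (arrivalCount 1 τ (u + t) + 1), (occ τ u t).real {i} * ψ i := by
  have h1 : ∫ s in u..(u + t), ψ (arrivalCount 1 τ s) = ∫ i, ψ i ∂(occ τ u t) := by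
    rw [intervalIntegral.integral_of_le (by linarith), occ,
      integral_map (measurable_arrivalCount_right 1 τ).aemeasurable
        Measurable.of_discrete.aestronglyMeasurable]
  rw [h1, ← hτ.occ_restrict hu]
  rw [setIntegral_finset _ (IntegrableOn.finset ..), hτ.occ_restrict hu]
  simp

/-- The clocks and pairs of times without an arrival in between. -/
def sameCount : Set ((ℕ → ℝ) × ℝ × ℝ) :=
  {z | arrivalCount 1 z.1 z.2.1 = arrivalCount 1 z.1 z.2.2}

lemma measurableSet_sameCount : MeasurableSet sameCount := by
  have h1 : Measurable fun z : (ℕ → ℝ) × ℝ × ℝ => arrivalCount 1 z.1 z.2.1 :=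
    (measurable_arrivalCount 1).comp
      (measurable_fst.prodMk (measurable_fst.comp measurable_snd))
  have h2 : Measurable fun z : (ℕ → ℝ) × ℝ × ℝ => arrivalCount 1 z.1 z.2.2 :=
    (measurable_arrivalCount 1).comp
      (measurable_fst.prodMk (measurable_snd.comp measurable_snd))
  exact (h1.prodMk h2) (MeasurableSet.of_discrete (s := {p : ℕ × ℕ | p.1 = p.2}))

/-- The probability that there is no arrival between two times decays exponentially, so that the
occupation measure of a long interval is spread out. -/
lemma lintegral_sum_sq_occ_le {u t : ℝ} (hu : 0 ≤ u) :
    ∫⁻ τ, ∑ i ∈ Finset.range (arrivalCount 1 τ (u + t) + 1),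
      occ τ u t {i} ^ 2 ∂clockLaw ≤ ENNReal.ofReal (2 * t) := by
  set I := volume.restrict (Ioc u (u + t))
  have hpt : ∀ᵐ τ ∂clockLaw, ∑ i ∈ Finset.range (arrivalCount 1 τ (u + t) + 1),
      occ τ u t {i} ^ 2 = ∫⁻ z, sameCount.indicator 1 (τ, z) ∂(I.prod I) := by
    filter_upwards [ae_isClock] with τ hτ
    have hm : Measurable fun z => sameCount.indicator (1 : (ℕ → ℝ) × ℝ × ℝ → ℝ≥0∞) (τ, z) :=
      (measurable_one.indicator measurableSet_sameCount).comp measurable_prodMk_left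
    rw [lintegral_prod _ hm.aemeasurable]
    have h1 : ∀ s, ∫⁻ s', sameCount.indicator (1 : (ℕ → ℝ) × ℝ × ℝ → ℝ≥0∞)
          (τ, s, s') ∂I = occ τ u t {arrivalCount 1 τ s} := by
      intro s
      have hms := measurable_arrivalCount_right 1 τ (measurableSet_singleton (arrivalCount 1 τ s))
      rw [occ, Measure.map_apply (measurable_arrivalCount_right 1 τ) (measurableSet_singleton _),
        ← lintegral_indicator_one hms]
      refine lintegral_congr fun s' => ?_
      by_cases hs : arrivalCount 1 τ s = arrivalCount 1 τ s'
      · rw [indicator_of_mem (show (τ, s, s') ∈ _ from hs),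
          indicator_of_mem (show s' ∈ _ from hs.symm)]; rfl
      · rw [indicator_of_notMem (show (τ, s, s') ∉ _ from hs),
          indicator_of_notMem (show s' ∉ _ from fun h => hs (Eq.symm h))]
    simp_rw [h1]
    rw [← lintegral_map (f := fun i => occ τ u t {i}) Measurable.of_discrete
      (measurable_arrivalCount_right 1 τ)]
    change _ = ∫⁻ i, occ τ u t {i} ∂(occ τ u t)
    conv_rhs => rw [← hτ.occ_restrict hu]
    rw [lintegral_finset]
    exact Finset.sum_congr rfl fun i _ => by rw [hτ.occ_restrict hu, sq]
  rw [lintegral_congr_ae hpt, lintegral_lintegral_swap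
    (f := fun τ z => sameCount.indicator 1 (τ, z))
    (measurable_one.indicator measurableSet_sameCount).aemeasurable]
  have hcl : ∀ z : ℝ × ℝ, 0 ≤ z.1 → 0 ≤ z.2 →
      ∫⁻ τ, sameCount.indicator (1 : (ℕ → ℝ) × ℝ × ℝ → ℝ≥0∞) (τ, z)
        ∂clockLaw = ENNReal.ofReal (Real.exp (-|z.2 - z.1|)) := by
    intro z h1 h2
    have e1 : ∫⁻ τ, sameCount.indicator (1 : (ℕ → ℝ) × ℝ × ℝ → ℝ≥0∞) (τ, z)
        ∂clockLaw = clockLaw {τ | arrivalCount 1 τ z.1 = arrivalCount 1 τ z.2} := by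
      exact lintegral_indicator_one (measurable_prodMk_right (y := z) measurableSet_sameCount)
    rw [e1]
    rcases le_total z.1 z.2 with h | h
    · rw [clockLaw_arrivalCount_eq h1 h, abs_of_nonneg (sub_nonneg.2 h)]
    · simp_rw [eq_comm (a := arrivalCount 1 _ z.1)]
      rw [clockLaw_arrivalCount_eq h2 h, abs_sub_comm, abs_of_nonneg (sub_nonneg.2 h)]
  have hmexp : Measurable fun z : ℝ × ℝ => ENNReal.ofReal (Real.exp (-|z.2 - z.1|)) := by fun_prop
  have hI0 : ∀ᵐ s ∂I, 0 ≤ s := by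
    filter_upwards [ae_restrict_mem measurableSet_Ioc] with s hs using hu.trans hs.1.le
  have hII : ∀ᵐ z ∂(I.prod I), 0 ≤ z.1 ∧ 0 ≤ z.2 := by
    have h1 := Measure.quasiMeasurePreserving_fst (μ := I) (ν := I) |>.ae hI0
    have h2 := Measure.quasiMeasurePreserving_snd (μ := I) (ν := I) |>.ae hI0
    exact h1.and h2
  rw [lintegral_congr_ae (hII.mono fun z hz => hcl z hz.1 hz.2),
    lintegral_prod _ hmexp.aemeasurable]
  have hexp : ∫⁻ x : ℝ, ENNReal.ofReal (Real.exp (-|x|)) = ENNReal.ofReal 2 := by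
    have hcont : Continuous fun x : ℝ => Real.exp (-|x|) := by fun_prop
    have hi : Integrable fun x : ℝ => Real.exp (-|x|) := by
      rw [← integrableOn_univ, ← Iic_union_Ioi (a := (0 : ℝ))]
      refine IntegrableOn.union ?_ ?_
      · exact (integrableOn_exp_Iic 0).congr_fun (fun x hx => by
          rw [abs_of_nonpos hx, neg_neg]) measurableSet_Iic
      · exact (integrableOn_exp_neg_Ioi 0).congr_fun (fun x hx => by
          rw [abs_of_pos hx]) measurableSet_Ioi
    rw [← ofReal_integral_eq_lintegral_ofReal hi (ae_of_all _ fun x => (Real.exp_pos _).le),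
      integral_comp_abs (f := fun x => Real.exp (-x)), integral_exp_neg_Ioi_zero, mul_one]
  calc _ ≤ ∫⁻ s, ENNReal.ofReal 2 ∂I := by
        refine lintegral_mono fun s => ?_
        refine (lintegral_mono' Measure.restrict_le_self le_rfl).trans (le_of_eq ?_)
        rw [← hexp]
        exact lintegral_sub_right_eq_self (fun x => ENNReal.ofReal (Real.exp (-|x|))) s
    _ = _ := by
        rw [lintegral_const, Measure.restrict_apply_univ, Real.volume_Ioc, add_sub_cancel_left,
          ← ENNReal.ofReal_mul (by norm_num)]


/-! ### Ergodicity of the frozen particle -/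

namespace GrowthModel

variable {n : ℕ} {M : GrowthModel n}

/-- The drift as a function of the particle, with values in `L^2(σ)`. -/
noncomputable def driftL (M : GrowthModel n) (r : Cplus n) (y : Eucl n) : Lp ℝ 2 (surf n) :=
  toL n 2 (M.bC (r, y))

lemma stronglyMeasurable_driftL (r : Cplus n) : StronglyMeasurable (M.driftL r) :=
  (toL n 2).continuous.comp_stronglyMeasurable
    (M.measurable_bC.comp measurable_prodMk_left).stronglyMeasurable

lemma norm_driftL_le {r : Cplus n} {a : ℝ} (ha : 0 < a) {B : ℝ≥0} (hB : M.BddF 2 a B) {y : Eucl n}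
    (hy : (r, y) ∈ M.Ae ∞ a) : ‖M.driftL r y‖ ≤ (a ^ (n - 1))⁻¹ * B := by
  change nrm 2 (M.bC (r, y)) ≤ _
  have h1 : nrm 2 (M.dens (r, y)).1 ≤ B := M.bddF_iff.1 hB _ hy
  have h2 : nrm 2 (M.bC (r, y)) ≤ (a ^ (n - 1))⁻¹ * nrm 2 (M.dens (r, y)).1 :=
    M.nrm_bC_le ha ((mem_A_iff (p := ∞) ha).1 hy.2.1).1
  exact h2.trans (mul_le_mul_of_nonneg_left h1 (inv_nonneg.2 (pow_nonneg ha.le _)))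

/-- The Bochner integral in `L^2(σ)` of the drift is its pointwise average. -/
lemma integral_driftL_ae_eq {r : Cplus n} {ν : Measure (Eucl n)} [IsProbabilityMeasure ν] {b₀ : ℝ}
    (h : ∀ᵐ y ∂ν, ‖M.driftL r y‖ ≤ b₀) :
    ⇑(∫ y, M.driftL r y ∂ν) =ᵐ[surf n] fun θ => ∫ y, M.b (r, y) θ ∂ν := by
  have hint : Integrable (M.driftL r) ν :=
    .of_bound (stronglyMeasurable_driftL r).aestronglyMeasurable b₀ h
  have hm : Measurable fun z : Eucl n × Sph n => M.bC (r, z.1) z.2 := by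
    have h1 : Continuous fun z : C(Sph n, ℝ) × Sph n => z.1 z.2 := by fun_prop
    exact h1.measurable.comp (((M.measurable_bC.comp measurable_prodMk_left).comp
      measurable_fst).prodMk measurable_snd)
  have hprod : Integrable (fun z : Eucl n × Sph n => M.bC (r, z.1) z.2) (ν.prod (surf n)) := by
    rw [integrable_prod_iff hm.aestronglyMeasurable]
    refine ⟨ae_of_all _ fun y => integrable_continuousMap (M.bC (r, y)), ?_⟩
    refine .of_bound hm.norm.stronglyMeasurable.integral_prod_right'.aestronglyMeasurable
      (normConst n * b₀) (h.mono fun y hy => ?_)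
    rw [Real.norm_of_nonneg (integral_nonneg fun _ => norm_nonneg _)]
    exact (integral_abs_le _).trans (mul_le_mul_of_nonneg_left hy normConst_pos.le)
  refine Integrable.ae_eq_of_forall_setIntegral_eq _ _ ((Lp.memLp _).integrable (by norm_num))
    hprod.swap.integral_prod_left fun S hS _ => ?_
  have hSf : surf n S ≠ ∞ := measure_ne_top _ _
  rw [← L2.inner_indicatorConstLp_one (𝕜 := ℝ) hS hSf, ← integral_inner hint]
  have h1 : ∀ y, inner ℝ (indicatorConstLp 2 hS hSf (1 : ℝ)) (M.driftL r y) =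
      ∫ θ in S, M.bC (r, y) θ ∂(surf n) := fun y => by
    rw [L2.inner_indicatorConstLp_one (𝕜 := ℝ) hS hSf]
    exact integral_congr_ae (ae_restrict_of_ae (ContinuousMap.coeFn_toLp (surf n) _))
  simp_rw [h1]
  refine integral_integral_swap (f := fun y θ => M.bC (r, y) θ) ?_
  have : (ν.prod ((surf n).restrict S)) = (ν.prod (surf n)).restrict (univ ×ˢ S) := by
    rw [← Measure.prod_restrict, Measure.restrict_univ]
  exact this ▸ hprod.restrict

noncomputable instance instMeasurableSpaceL : MeasurableSpace (Lp ℝ 2 (surf n)) := borel _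

instance instBorelSpaceL : BorelSpace (Lp ℝ 2 (surf n)) := ⟨rfl⟩

instance instSecondCountableTopologyL : SecondCountableTopology (Lp ℝ 2 (surf n)) := by
  have : Fact ((2 : ℝ≥0∞) ≠ ∞) := ⟨ENNReal.ofNat_ne_top⟩
  have : IsSeparable (surf n) := isSeparable_of_sigmaFinite _
  exact Lp.SecondCountableTopology

/-- For a fixed clock, the centred time average of the drift is a weighted sum along the embedded
chain, whose weights are the normalised occupation times. -/
lemma eLpNorm_average_eq {r : Cplus n} {ν : Measure (Eucl n)} [IsProbabilityMeasure ν] {b₀ : ℝ}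
    (hν : ∀ᵐ y ∂ν, ‖M.driftL r y‖ ≤ b₀) {τ : ℕ → ℝ} (hτ : IsClock τ) (w : ℕ → Eucl n) {t : ℝ}
    (ht : 0 ≤ t) {t₀ : ℝ} (ht₀ : 0 ≤ t₀) :
    eLpNorm (fun θ => t⁻¹ * ∫ s in t₀..(t₀ + t),
      (M.b (r, pathAt 1 (τ, w) s) θ - ∫ y, M.b (r, y) θ ∂ν)) 2 (surf n) ^ 2 =
    ENNReal.ofReal (‖∑ i ∈ Finset.range (arrivalCount 1 τ (t₀ + t) + 1),
      (t⁻¹ * (occ τ t₀ t).real {i}) • (M.driftL r (w i) - ∫ y, M.driftL r y ∂ν)‖ ^ 2) := by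
  set N := arrivalCount 1 τ (t₀ + t) + 1
  set c : ℕ → ℝ := fun i => t⁻¹ * (occ τ t₀ t).real {i}
  set m := ∫ y, M.driftL r y ∂ν with hm
  set f : C(Sph n, ℝ) := ∑ i ∈ Finset.range N, c i • M.bC (r, w i)
  set C := ∑ i ∈ Finset.range N, c i
  have e1 : ∑ i ∈ Finset.range N, c i • (M.driftL r (w i) - m) = toL n 2 f - C • m := by
    rw [map_sum, Finset.sum_smul, ← Finset.sum_sub_distrib]
    refine Finset.sum_congr rfl fun i _ => ?_
    rw [map_smul, ← smul_sub, driftL]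
  have e2 : ⇑(toL n 2 f - C • m) =ᵐ[surf n] fun θ => t⁻¹ * ∫ s in t₀..(t₀ + t),
      (M.b (r, pathAt 1 (τ, w) s) θ - ∫ y, M.b (r, y) θ ∂ν) := by
    filter_upwards [Lp.coeFn_sub (toL n 2 f) (C • m), Lp.coeFn_smul C m,
      ContinuousMap.coeFn_toLp (p := 2) (𝕜 := ℝ) (surf n) f, integral_driftL_ae_eq hν]
      with θ h1 h2 h3 h4
    have h5 := hτ.integral_arrivalCount ht₀ ht
      fun i => M.b (r, w i) θ - ∫ y, M.b (r, y) θ ∂ν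
    have h6 : f θ = ∑ i ∈ Finset.range N, c i * M.b (r, w i) θ := by
      simp only [f, ContinuousMap.coe_sum, Finset.sum_apply, ContinuousMap.smul_apply,
        smul_eq_mul, M.bC_apply]
    have h7 : (toL n 2 f) θ = f θ := h3
    have h8 : m θ = ∫ y, M.b (r, y) θ ∂ν := h4
    have h9 : ∫ s in t₀..(t₀ + t), (M.b (r, pathAt 1 (τ, w) s) θ - ∫ y, M.b (r, y) θ ∂ν) =
        ∑ i ∈ Finset.range N, (occ τ t₀ t).real {i} *
          (M.b (r, w i) θ - ∫ y, M.b (r, y) θ ∂ν) := h5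
    rw [h1, Pi.sub_apply, h2, Pi.smul_apply, smul_eq_mul, h9, h7, h8, h6, Finset.sum_mul,
      ← Finset.sum_sub_distrib, Finset.mul_sum]
    refine Finset.sum_congr rfl fun i _ => ?_
    simp only [c]
    ring
  rw [e1, eLpNorm_congr_ae e2.symm, ENNReal.ofReal_pow (norm_nonneg _), Lp.norm_def,
    ENNReal.ofReal_toReal (Lp.eLpNorm_ne_top _)]

open Classical in
/-- The drift, set to zero where its norm exceeds `b₀`, and centred at `m`. -/
noncomputable def centredDrift (M : GrowthModel n) (r : Cplus n) (b₀ : ℝ) (m : Lp ℝ 2 (surf n))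
    (y : Eucl n) : Lp ℝ 2 (surf n) := (if ‖M.driftL r y‖ ≤ b₀ then M.driftL r y else 0) - m

lemma centredDrift_eq {r : Cplus n} {b₀ : ℝ} (m : Lp ℝ 2 (surf n)) {y : Eucl n}
    (h : ‖M.driftL r y‖ ≤ b₀) : M.centredDrift r b₀ m y = M.driftL r y - m := by
  rw [centredDrift, if_pos h]

lemma measurable_centredDrift (r : Cplus n) (b₀ : ℝ) (m : Lp ℝ 2 (surf n)) :
    Measurable (M.centredDrift r b₀ m) := by
  have hβm : Measurable (M.driftL r) := (stronglyMeasurable_driftL r).measurable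
  exact (Measurable.ite (measurableSet_le hβm.norm measurable_const) hβm
    measurable_const).sub_const m

lemma norm_centredDrift_le {r : Cplus n} {b₀ : ℝ} (hb₀ : 0 ≤ b₀) {m : Lp ℝ 2 (surf n)}
    (hm : ‖m‖ ≤ b₀) (y : Eucl n) : ‖M.centredDrift r b₀ m y‖ ≤ 2 * b₀ := by
  rw [centredDrift]
  refine (norm_sub_le _ _).trans ?_
  rw [two_mul]
  refine add_le_add ?_ hm
  split_ifs with hy
  · exact hy
  · rwa [norm_zero]

lemma integral_centredDrift {r : Cplus n} {ν : Measure (Eucl n)} [IsProbabilityMeasure ν] {b₀ : ℝ}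
    (h : ∀ᵐ y ∂ν, ‖M.driftL r y‖ ≤ b₀) :
    ∫ y, M.centredDrift r b₀ (∫ y, M.driftL r y ∂ν) y ∂ν = 0 := by
  rw [integral_congr_ae (h.mono fun y hy => centredDrift_eq _ hy),
    integral_sub (.of_bound (stronglyMeasurable_driftL r).aestronglyMeasurable b₀ h)
      (integrable_const _), integral_const, probReal_univ, one_smul, sub_self]

/-- Mean square bound for the time averages.  For a fixed clock the bound is the sum of the squares
of the occupation weights, whose expectation is of order `1 / t`. -/
lemma lintegral_average_le {r : Cplus n} {ν : Measure (Eucl n)} (hν : M.IsInvariant r ν) {a : ℝ}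
    (ha : 0 < a) {B : ℝ≥0} (hB : M.BddF 2 a B) {n₀ : ℕ} {δ : ℝ}
    (h : Minorised (M.frozenKernel r) {y | (r, y) ∈ M.Ae ∞ a} n₀ δ) {x : Eucl n}
    (hx : (r, x) ∈ M.Ae ∞ a) {t : ℝ} (ht : 0 < t) {t₀ : ℝ} (ht₀ : 0 ≤ t₀) :
    ∫⁻ w, eLpNorm (fun θ => t⁻¹ * ∫ s in t₀..(t₀ + t),
        (M.b (r, pathAt 1 w s) θ - ∫ y, M.b (r, y) θ ∂ν)) 2 (surf n) ^ 2
      ∂(M.frozenLaw r (Measure.dirac x)) ≤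
    ENNReal.ofReal (2 * (n₀ / δ) * (2 * (2 * ((a ^ (n - 1))⁻¹ * B)) ^ 2) * (2 / t)) := by
  obtain ⟨hpr, hinv⟩ := M.isInvariant_iff.1 hν
  have hr : r ∈ A n ∞ a := hx.2.1
  have hP := M.carriedBy_frozenKernel hr
  have hδ := h.2.1
  set b₀ : ℝ := (a ^ (n - 1))⁻¹ * B
  have hb₀ : 0 ≤ b₀ := by positivity
  have hβm : Measurable (M.driftL r) := (stronglyMeasurable_driftL r).measurable
  have hS : MeasurableSet {y | ‖M.driftL r y‖ ≤ b₀} := measurableSet_le hβm.norm measurable_const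
  have hGS : {y | (r, y) ∈ M.Ae ∞ a} ⊆ {y | ‖M.driftL r y‖ ≤ b₀} := fun y hy =>
    norm_driftL_le ha hB hy
  have hνS : ∀ᵐ y ∂ν, ‖M.driftL r y‖ ≤ b₀ := hν.ae_mem hr _ hS hGS
  set m := ∫ y, M.driftL r y ∂ν with hm
  have hmb : ‖m‖ ≤ b₀ := by
    have := norm_integral_le_of_norm_le_const hνS
    rwa [probReal_univ, mul_one] at this
  have hγ0 : ∫ y, M.centredDrift r b₀ m y ∂ν = 0 := integral_centredDrift hνS
  have hchain : ∀ᵐ w ∂(chainLaw (M.frozenKernel r) (Measure.dirac x)),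
      ∀ i, ‖M.driftL r (w i)‖ ≤ b₀ := by
    rw [ae_all_iff]
    intro i
    have h1 := carriedBy_pow (M.frozenKernel r) hP i (Or.inl hx) _ hS hGS
    have h2 := chainLaw_map_apply (M.frozenKernel r) (Measure.dirac x) i
    rw [Measure.dirac_bind (Kernel.measurable _)] at h2
    rw [← h2] at h1
    exact ae_of_ae_map (measurable_pi_apply i).aemeasurable h1
  set K : ℝ := 2 * (n₀ / δ) * (2 * (2 * b₀) ^ 2)
  have hK : 0 ≤ K := by positivity
  have hclock : ∀ τ, IsClock τ → ∫⁻ w, eLpNorm (fun θ => t⁻¹ * ∫ s in t₀..(t₀ + t),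
        (M.b (r, pathAt 1 (τ, w) s) θ - ∫ y, M.b (r, y) θ ∂ν)) 2 (surf n) ^ 2
      ∂(chainLaw (M.frozenKernel r) (Measure.dirac x)) ≤
      ENNReal.ofReal (K * t⁻¹ ^ 2) * ∑ i ∈ Finset.range (arrivalCount 1 τ (t₀ + t) + 1),
        occ τ t₀ t {i} ^ 2 := by
    intro τ hτ
    have e3 : ∀ i, occ τ t₀ t {i} ^ 2 = ENNReal.ofReal ((occ τ t₀ t).real {i} ^ 2) := fun i => by
      rw [ENNReal.ofReal_pow measureReal_nonneg, ofReal_measureReal]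
    simp_rw [e3]
    rw [lintegral_congr_ae (g := fun w => ENNReal.ofReal
      (‖∑ i ∈ Finset.range (arrivalCount 1 τ (t₀ + t) + 1),
        (t⁻¹ * (occ τ t₀ t).real {i}) • M.centredDrift r b₀ m (w i)‖ ^ 2))
      (hchain.mono fun w hw => by
        have hc : ∀ i, M.centredDrift r b₀ m (w i) = M.driftL r (w i) - m :=
          fun i => centredDrift_eq m (hw i)
        simp only [hc]
        exact eLpNorm_average_eq hνS hτ w ht.le ht₀)]
    refine (h.lintegral_norm_sq_sum_le hP hinv (measurable_centredDrift r b₀ m)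
      (norm_centredDrift_le hb₀ hmb) hγ0 hx _ _).trans (le_of_eq ?_)
    rw [← ENNReal.ofReal_sum_of_nonneg fun i _ => sq_nonneg _,
      ← ENNReal.ofReal_mul (by positivity)]
    congr 1
    simp only [mul_pow]
    rw [← Finset.mul_sum]
    ring
  rw [frozenLaw, jumpLaw]
  refine (lintegral_prod_le _).trans ((lintegral_mono_ae (ae_isClock.mono hclock)).trans ?_)
  calc ∫⁻ τ, ENNReal.ofReal (K * t⁻¹ ^ 2) *
        ∑ i ∈ Finset.range (arrivalCount 1 τ (t₀ + t) + 1), occ τ t₀ t {i} ^ 2 ∂clockLaw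
      ≤ ENNReal.ofReal (K * t⁻¹ ^ 2) * ENNReal.ofReal (2 * t) := by
        rw [lintegral_const_mul' _ _ ENNReal.ofReal_ne_top]
        gcongr
        exact lintegral_sum_sq_occ_le ht₀
    _ = _ := by
      rw [← ENNReal.ofReal_mul (by positivity)]
      congr 1
      field_simp

/-- Existence and uniqueness of `ν_r` are Doeblin's theorem for the embedded chain; the rate of
convergence of the time averages is `O(1 / t)`. -/
theorem assumptionE (hB : ∀ a ∈ Ioo (0 : ℝ) 1, ∃ B, M.BddF 2 a B) (hm : M.Minorisation) :
    M.AssumptionE := by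
  refine ⟨fun r => ?_, fun ν hν a ha => ?_⟩
  · obtain ⟨a, ha, hr⟩ := exists_mem_A_top r
    obtain ⟨n₀, hn₀, δ, hδ, hall⟩ := hm a ha
    obtain ⟨m, hmp, hle⟩ := hall r
    exact existsUnique_isInvariant hr ⟨hn₀, hδ, m, hmp, hle⟩
  · obtain ⟨n₀, hn₀, δ, hδ, hall⟩ := hm a ha
    obtain ⟨B, hB⟩ := hB a ha
    set K := 2 * (n₀ / δ) * (2 * (2 * ((a ^ (n - 1))⁻¹ * (B : ℝ))) ^ 2)
    refine ⟨fun t => (K * (2 / t)).toNNReal, ?_, fun t ht r x hx t₀ ht₀ => ?_⟩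
    · have h1 : Tendsto (fun t : ℝ => K * (2 / t)) atTop (𝓝 (K * 0)) :=
        (tendsto_const_nhds.div_atTop tendsto_id).const_mul K
      rw [mul_zero] at h1
      have h2 := (continuous_real_toNNReal.tendsto 0).comp h1
      rwa [Real.toNNReal_zero] at h2
    · obtain ⟨m, hmp, hle⟩ := hall r
      exact lintegral_average_le (hν r) ha.1 hB ⟨hn₀, hδ, m, hmp, hle⟩ hx ht ht₀

end GrowthModel


/-! ### One jump of the growth process -/

namespace GrowthModel

variable {n : ℕ} (M : GrowthModel n)

lemma scale_pos {ε : ℝ≥0} (hε : 0 < ε) (q : Cplus n × Eucl n) : 0 < M.scale ε q :=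
  mul_pos (Real.rpow_pos_of_pos (NNReal.coe_pos.2 hε) _) (Real.rpow_pos_of_pos (M.y_pos q) _)

/-- The scale is at most this multiple of `ε^{1/n}` as long as `a ≤ r`. -/
noncomputable def scaleConst (n : ℕ) (a : ℝ) : ℝ :=
  (area n * a ^ (n - 1)) ^ (-(1 / ((n : ℝ) - 1)))

include M in
lemma scaleConst_pos {a : ℝ} (ha : 0 < a) : 0 < scaleConst n a :=
  Real.rpow_pos_of_pos (mul_pos M.area_pos (pow_pos ha _)) _

lemma scale_le (hn : 2 ≤ n) (ε : ℝ≥0) {q : Cplus n × Eucl n} {a : ℝ} (ha : 0 < a)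
    (h : ∀ θ, a ≤ q.1.1 θ) : M.scale ε q ≤ (ε : ℝ) ^ (1 / (n : ℝ)) * scaleConst n a := by
  have h2 : (2 : ℝ) ≤ n := by exact_mod_cast hn
  refine mul_le_mul_of_nonneg_left ?_ (Real.rpow_nonneg ε.coe_nonneg _)
  refine Real.rpow_le_rpow_of_nonpos (mul_pos M.area_pos (pow_pos ha _)) (M.le_y ha.le h) ?_
  rw [Left.neg_nonpos_iff]
  exact div_nonneg zero_le_one (by linarith)

lemma scale_pow (hn : 2 ≤ n) (ε : ℝ≥0) (q : Cplus n × Eucl n) :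
    M.scale ε q ^ (n - 1) = ((ε : ℝ) ^ (1 / (n : ℝ))) ^ (n - 1) / M.y q := by
  have h2 : (2 : ℝ) ≤ n := by exact_mod_cast hn
  have h3 : (n : ℝ) - 1 ≠ 0 := by linarith
  rw [scale, mul_pow, ← Real.rpow_natCast (M.y q ^ _), ← Real.rpow_mul (M.y_nonneg q),
    Nat.cast_sub (by lia), Nat.cast_one, neg_mul, one_div_mul_cancel h3, Real.rpow_neg_one,
    div_eq_mul_inv _ (M.y q)]

lemma root_pow (hn : 2 ≤ n) (ε : ℝ≥0) :
    ((ε : ℝ) ^ (1 / (n : ℝ))) ^ (n - 1) * (ε : ℝ) ^ (1 / (n : ℝ)) = ε := by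
  rw [← pow_succ, Nat.sub_add_cancel (by lia), one_div,
    Real.rpow_inv_natCast_pow ε.coe_nonneg (by lia)]

/-- A jump adds at most `Λ ε^{1/n}` to the domain. -/
lemma jump_le (hn : 2 ≤ n) {G : BumpFamily n} {Λ : ℝ}
    (hΛ : ∀ η ∈ Ioo (0 : ℝ) 1, ∀ t, η ^ (n - 1) * G.g η t ≤ Λ) {ε : ℝ≥0} (hε : 0 < ε)
    {q : Cplus n × Eucl n} (hq : M.scale ε q < 1) (t : Icc (-1 : ℝ) 1) :
    (ε : ℝ) / M.y q * G.g (M.scale ε q) t ≤ Λ * (ε : ℝ) ^ (1 / (n : ℝ)) := by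
  have h := hΛ _ ⟨M.scale_pos hε q, hq⟩ t
  rw [M.scale_pow hn] at h
  have he := root_pow hn ε
  have hpos : 0 ≤ (ε : ℝ) ^ (1 / (n : ℝ)) := Real.rpow_nonneg ε.coe_nonneg _
  have h2 := mul_le_mul_of_nonneg_right h hpos
  refine le_trans (le_of_eq ?_) h2
  nth_rw 1 [← he]
  ring

lemma update_apply (G : BumpFamily n) (ε : ℝ≥0) (q : Cplus n × Eucl n) (ξ θ : Sph n) :
    (M.update G ε (q, ξ)).1.1 θ =
      q.1.1 θ + (ε : ℝ) / M.y q * G.g (M.scale ε q) (sphInner ξ θ) := rfl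

lemma le_update (G : BumpFamily n) (ε : ℝ≥0) (q : Cplus n × Eucl n) (ξ : Sph n) :
    q.1 ≤ (M.update G ε (q, ξ)).1 := fun θ => by
  change q.1.1 θ ≤ (M.update G ε (q, ξ)).1.1 θ
  rw [update_apply]
  have h2 : 0 ≤ (ε : ℝ) / M.y q := div_nonneg ε.2 (M.y_nonneg _)
  have := mul_nonneg h2 (G.nonneg (M.scale ε q) (sphInner ξ θ))
  linarith

/-- After a jump the state lies in `𝒜ᵉ_p(a)` as soon as the domain is in `𝒜_p(a)` before and after
the jump; nothing is required of the particle before the jump. -/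
lemma ae_update_mem_Ae (G : BumpFamily n) (ε : ℝ≥0) {q : Cplus n × Eucl n} {p : ℝ≥0∞} {a : ℝ}
    (hq : q.1 ∈ A n p a) : ∀ᵐ ξ ∂(surf n),
      (M.update G ε (q, ξ)).1 ∈ A n p a → M.update G ε (q, ξ) ∈ M.Ae p a := by
  filter_upwards [M.admissible q.1] with ξ hξ h
  exact ⟨hξ _ (M.le_update G ε q ξ), h, q.1, hq, M.le_update G ε q ξ, mem_range_self ξ⟩

lemma ae_stepKernel {G : BumpFamily n} {ε : ℝ≥0} {q : Cplus n × Eucl n}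
    {S : Set (Cplus n × Eucl n)} (hS : MeasurableSet S)
    (h : ∀ᵐ ξ ∂(surf n), M.update G ε (q, ξ) ∈ S) : ∀ᵐ q' ∂(M.stepKernel G ε q), q' ∈ S := by
  rw [stepKernel_apply]
  exact (ae_map_iff (p := fun q' => q' ∈ S)
    ((M.measurable_update G ε).comp measurable_prodMk_left).aemeasurable hS).2 (M.ae_hitKernel h)

lemma measurableSet_le_fst :
    MeasurableSet {z : (Cplus n × Eucl n) × (Cplus n × Eucl n) | z.1.1 ≤ z.2.1} := by
  have : IsClosed {z : Cplus n × Cplus n | z.1 ≤ z.2} := by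
    have h : {z : Cplus n × Cplus n | z.1 ≤ z.2} = ⋂ θ, {z | z.1.1 θ ≤ z.2.1 θ} := by
      ext z
      simp only [mem_iInter]
      rfl
    rw [h]
    exact isClosed_iInter fun θ => isClosed_le (by fun_prop) (by fun_prop)
  exact this.measurableSet.preimage ((measurable_fst.comp measurable_fst).prodMk
    (measurable_fst.comp measurable_snd))

/-- Almost surely the domain grows. -/
lemma ae_chainLaw_monotone (G : BumpFamily n) (ε : ℝ≥0) (p₀ : Cplus n × Eucl n) :
    ∀ᵐ w ∂(chainLaw (M.stepKernel G ε) (Measure.dirac p₀)),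
      w 0 = p₀ ∧ Monotone fun k => (w k).1 := by
  have h0 := ae_chainLaw_zero (M.stepKernel G ε) (Measure.dirac p₀) (S := {p₀}) (by simp)
  have h1 := ae_chainLaw_step (M.stepKernel G ε) (Measure.dirac p₀) measurableSet_le_fst
    fun q => M.ae_stepKernel (measurableSet_le_fst.preimage measurable_prodMk_left)
      (ae_of_all _ fun ξ => M.le_update G ε q ξ)
  filter_upwards [h0, h1] with w hw0 hw1
  exact ⟨hw0, monotone_nat_of_le_succ hw1⟩

lemma isClosed_le_coe (a : ℝ) : IsClosed {r : Cplus n | ∀ θ, a ≤ r.1 θ} := by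
  have h : {r : Cplus n | ∀ θ, a ≤ r.1 θ} = ⋂ θ, {r : Cplus n | a ≤ r.1 θ} := by
    ext r
    simp only [mem_iInter]
    rfl
  rw [h]
  exact isClosed_iInter fun θ => isClosed_le (f := fun _ : Cplus n => a) (g := fun r => r.1 θ)
    (by fun_prop) (by fun_prop)

lemma measurableSet_A {p : ℝ≥0∞} [Fact (1 ≤ p)] {a : ℝ} (ha : 0 < a) :
    MeasurableSet {q : Cplus n × Eucl n | q.1 ∈ A n p a} := by
  have : IsClosed {r : Cplus n | r ∈ A n p a} := by
    have h : {r : Cplus n | r ∈ A n p a} =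
        {r : Cplus n | ∀ θ, a ≤ r.1 θ} ∩ {r | nrm p r.1 ≤ a⁻¹} := by
      ext r
      exact mem_A_iff ha
    rw [h]
    exact (isClosed_le_coe a).inter
      (isClosed_le ((continuous_nrm p).comp continuous_subtype_val) continuous_const)
  exact this.measurableSet.preimage measurable_fst

lemma measurableSet_lipschitz_dens (L : ℝ≥0) :
    MeasurableSet {q : Cplus n × Eucl n | LipschitzWith L (M.dens q).1} := by
  have : IsClosed {f : C(Sph n, ℝ) | LipschitzWith L f} := by
    have h : {f : C(Sph n, ℝ) | LipschitzWith L f} =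
        ⋂ x, ⋂ y, {f : C(Sph n, ℝ) | dist (f x) (f y) ≤ L * dist x y} := by
      ext f
      simp only [mem_iInter]
      exact lipschitzWith_iff_dist_le_mul
    rw [h]
    exact isClosed_iInter fun x => isClosed_iInter fun y =>
      isClosed_le (by fun_prop) continuous_const
  exact this.measurableSet.preimage M.measurable_dens_coe

/-! ### The smoothed drift approximates the drift -/

lemma continuous_g_sphInner {G : BumpFamily n} (η : ℝ) (z : Sph n) :
    Continuous fun θ => G.g η (sphInner z θ) :=
  (G.g η).continuous.comp (sphInnerC z).continuous

lemma integral_g (G : BumpFamily n) {η : ℝ} (hη : 0 < η) (z : Sph n) :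
    ∫ θ, G.g η (sphInner z θ) ∂(surf n) = area n := by
  have h := G.conv_one η hη z
  simp only [conv, one_mul] at h
  exact (inv_mul_eq_one₀ fun h0 => by rw [h0] at h; simp at h).1 h |>.symm

lemma abs_conv_sub_le {G : BumpFamily n} {η : ℝ} (hη : 0 < η) {f : Sph n → ℝ} {L : ℝ≥0}
    (hf : LipschitzWith L f) (z : Sph n) : |conv f (G.g η) z - f z| ≤ L * (2 * η) := by
  have hω : area n ≠ 0 := fun h0 => by
    have h := G.conv_one η hη z
    rw [conv, h0] at h
    simp at h
  have hg := integral_g G hη z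
  have hgc := continuous_g_sphInner (G := G) η z
  have hgi : Integrable (fun θ => G.g η (sphInner z θ)) (surf n) :=
    hgc.integrable_of_hasCompactSupport (.of_compactSpace _)
  have hfi : Integrable (fun θ => f θ * G.g η (sphInner z θ)) (surf n) :=
    (hf.continuous.mul hgc).integrable_of_hasCompactSupport (.of_compactSpace _)
  have h1 : conv f (G.g η) z - f z =
      (area n)⁻¹ * ∫ θ, (f θ - f z) * G.g η (sphInner z θ) ∂(surf n) := by
    simp_rw [sub_mul]
    rw [integral_sub hfi (hgi.const_mul _), integral_const_mul, hg, conv, mul_sub]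
    field_simp
  rw [h1, abs_mul, abs_of_nonneg (inv_nonneg.2 area_nonneg)]
  have h2 : |∫ θ, (f θ - f z) * G.g η (sphInner z θ) ∂(surf n)| ≤ L * (2 * η) * area n := by
    rw [← hg, ← integral_const_mul, ← Real.norm_eq_abs]
    refine norm_integral_le_of_norm_le (hgi.const_mul _) (ae_of_all _ fun θ => ?_)
    rw [norm_mul, Real.norm_of_nonneg (G.nonneg _ _)]
    by_cases hd : 2 * η < dist z θ
    · rw [G.support η hη z θ hd]; simp
    · refine mul_le_mul_of_nonneg_right ?_ (G.nonneg _ _)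
      rw [← dist_eq_norm]
      refine (hf.dist_le_mul θ z).trans ?_
      rw [dist_comm]
      gcongr
      exact not_lt.1 hd
  calc _ ≤ (area n)⁻¹ * (L * (2 * η) * area n) :=
        mul_le_mul_of_nonneg_left h2 (inv_nonneg.2 area_nonneg)
    _ = _ := by field_simp

lemma eLpNorm_bEps_sub_le (hn : 2 ≤ n) (G : BumpFamily n) {ε : ℝ≥0} (hε : 0 < ε) {a : ℝ}
    (ha : 0 < a) {q : Cplus n × Eucl n} (hq : ∀ θ, a ≤ q.1.1 θ) {L : ℝ≥0}
    (hL : LipschitzWith L (M.dens q).1) :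
    eLpNorm (fun θ => M.bEps G ε q θ - M.b q θ) 2 (surf n) ≤
      surf n univ ^ (2 : ℝ≥0∞).toReal⁻¹ * ENNReal.ofReal
        ((a ^ (n - 1))⁻¹ * L * (2 * ((ε : ℝ) ^ (1 / (n : ℝ)) * scaleConst n a))) := by
  refine eLpNorm_le_of_ae_bound (f := fun θ => M.bEps G ε q θ - M.b q θ)
    (ae_of_all _ fun z => ?_)
  have hb : LipschitzWith (Real.toNNReal ((a ^ (n - 1))⁻¹ * L)) (M.b q) := by
    refine LipschitzWith.of_dist_le_mul fun x y => ?_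
    rw [Real.coe_toNNReal _ (by positivity), b, b, Real.dist_eq, ← mul_sub, abs_mul,
      abs_of_nonneg (M.area_div_y_nonneg q), mul_assoc]
    have := hL.dist_le_mul x y
    rw [Real.dist_eq] at this
    have := M.area_div_y_le ha hq
    have := M.area_div_y_nonneg q
    gcongr
  refine (abs_conv_sub_le (M.scale_pos hε q) hb z).trans ?_
  rw [Real.coe_toNNReal _ (by positivity)]
  have := M.scale_le hn ε ha hq
  gcongr

lemma tendsto_root (hn : 2 ≤ n) :
    Tendsto (fun ε : ℝ≥0 => (ε : ℝ) ^ (1 / (n : ℝ))) (𝓝[>] 0) (𝓝 0) := by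
  have hn0 : (n : ℝ) ≠ 0 := by positivity
  have h : Continuous fun ε : ℝ≥0 => (ε : ℝ) ^ (1 / (n : ℝ)) :=
    NNReal.continuous_coe.rpow_const fun _ => Or.inr (by positivity)
  have := h.tendsto 0
  rw [NNReal.coe_zero, Real.zero_rpow (one_div_ne_zero hn0)] at this
  exact this.mono_left nhdsWithin_le_nhds

lemma eventually_scale_lt_one (hn : 2 ≤ n) {a : ℝ} (ha : 0 < a) : ∀ᶠ ε : ℝ≥0 in 𝓝[>] 0,
    ∀ q : Cplus n × Eucl n, (∀ θ, a ≤ q.1.1 θ) → M.scale ε q < 1 := by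
  have h := (tendsto_root hn).mul_const (scaleConst n a)
  rw [zero_mul] at h
  filter_upwards [h.eventually (gt_mem_nhds one_pos)] with ε hε q hq
  exact (M.scale_le hn ε ha hq).trans_lt hε

/-- The Lipschitz bound makes the smoothing error uniformly small. -/
lemma eventually_eLpNorm_bEps_sub_lt (hn : 2 ≤ n) (G : BumpFamily n) {a : ℝ} (ha : 0 < a)
    (L : ℝ≥0) {c : ℝ} (hc : 0 < c) : ∀ᶠ ε : ℝ≥0 in 𝓝[>] 0,
      ∀ q : Cplus n × Eucl n, (∀ θ, a ≤ q.1.1 θ) → LipschitzWith L (M.dens q).1 →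
        eLpNorm (fun θ => M.bEps G ε q θ - M.b q θ) 2 (surf n) < ENNReal.ofReal c := by
  have h1 := ((((tendsto_root hn).mul_const (scaleConst n a)).const_mul 2).const_mul
    ((a ^ (n - 1))⁻¹ * (L : ℝ)))
  rw [zero_mul, mul_zero, mul_zero] at h1
  have h2 := ENNReal.Tendsto.const_mul (a := surf n univ ^ (2 : ℝ≥0∞).toReal⁻¹)
    (ENNReal.tendsto_ofReal h1) (Or.inr (ENNReal.rpow_ne_top_of_nonneg (by positivity)
      (measure_ne_top _ _)))
  rw [ENNReal.ofReal_zero, mul_zero] at h2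
  filter_upwards [h2.eventually (gt_mem_nhds (ENNReal.ofReal_pos.2 hc)), self_mem_nhdsWithin]
    with ε hε hε0 q hq hL
  exact (M.eLpNorm_bEps_sub_le hn G hε0 ha hq hL).trans_lt hε

lemma eventually_eLpNorm_bEps_sub_lt_of_fixed (hn : 2 ≤ n) (G : BumpFamily n)
    (q : Cplus n × Eucl n) {c : ℝ} (hc : 0 < c) : ∀ᶠ ε : ℝ≥0 in 𝓝[>] 0,
      eLpNorm (fun θ => M.bEps G ε q θ - M.b q θ) 2 (surf n) < ENNReal.ofReal c := by
  have hm : MemLp (M.b q) 2 (surf n) :=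
    (M.bC q).continuous.memLp_of_hasCompactSupport (.of_compactSpace _)
  have h1 : Tendsto (fun ε : ℝ≥0 => M.scale ε q) (𝓝[>] 0) (𝓝[>] 0) := by
    refine tendsto_nhdsWithin_iff.2 ⟨?_, ?_⟩
    · have := (tendsto_root hn).mul_const (M.y q ^ (-(1 / ((n : ℝ) - 1))))
      rwa [zero_mul] at this
    · filter_upwards [self_mem_nhdsWithin] with ε hε using M.scale_pos hε q
  exact ((G.approx _ hm).comp h1).eventually (gt_mem_nhds (ENNReal.ofReal_pos.2 hc))

/-! ### The stopped process -/

/-- The chain leaves `{‖R‖_∞ ≤ 1/δ}` at most by the last jump before `ζ^ε(δ)`. -/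
lemma norm_le_of_stopped {ε : ℝ≥0} (hε : 0 < ε) {δ : ℝ}
    {w : (ℕ → ℝ) × (ℕ → Cplus n × Eucl n)} (hτ : IsClock w.1) {t : ℝ} (ht : 0 ≤ t) {k : ℕ}
    (hk : arrivalCount ε w.1 (min (t : EReal) (zeta ε δ w)).toReal = k + 1) :
    eLpNorm (w.2 k).1.1 ∞ (surf n) ≤ ENNReal.ofReal δ⁻¹ := by
  by_contra hc
  rw [not_le] at hc
  have hz0 : 0 ≤ zeta ε δ w := by
    refine le_sInf ?_
    rintro _ ⟨s, hs, rfl⟩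
    exact EReal.coe_nonneg.2 hs.1.le
  have hm0 : 0 ≤ min (t : EReal) (zeta ε δ w) := le_min (by exact_mod_cast ht) hz0
  have hlt := hτ.strictMono_arrival hε (Nat.lt_succ_self k)
  obtain ⟨s, hs1, hs2⟩ := exists_between hlt
  have hs0 : 0 < s := (hτ.arrival_nonneg hε k).trans_lt hs1
  have hcount : arrivalCount ε w.1 s = k := (hτ.arrivalCount_eq_iff hε hs0.le).2 ⟨hs1.le, hs2⟩
  have hzs : zeta ε δ w ≤ s := sInf_le ⟨s, ⟨hs0, by rwa [pathAt, hcount]⟩, rfl⟩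
  have hms : (min (t : EReal) (zeta ε δ w)).toReal ≤ s := by
    have := EReal.toReal_le_toReal ((min_le_right _ _).trans hzs)
      (ne_bot_of_le_ne_bot (by simp) hm0) (EReal.coe_ne_top s)
    rwa [EReal.toReal_coe] at this
  have := hτ.arrivalCount_mono hε (EReal.toReal_nonneg hm0) hms
  lia

/-- If `F` is uniformly Lipschitz, then the smoothing error at the time `t ∧ ζ^ε(δ)` is almost
surely small as soon as `ε` is small: this state is either the initial one, or the result of a jump
from a state in a fixed set `𝒜_∞(a)`. -/
theorem UnifLipF.assumptionC {M : GrowthModel n} (hn : 2 ≤ n) (hM : M.UnifLipF) (G : BumpFamily n)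
    (r₀ : Cplus n) (x₀ : ℝ≥0 → Eucl n)
    (hx₀ : (∃ x, (r₀, x) ∈ M.dom ∧ ∀ ε, x₀ ε = x) ∨
      ∃ a ∈ Ioo (0 : ℝ) 1, ∀ ε ∈ Ioc (0 : ℝ≥0) 1, (r₀, x₀ ε) ∈ M.Ae ∞ a) :
    M.AssumptionC G r₀ x₀ := by
  intro t ht δ hδ c hc
  obtain ⟨Λ, hΛ⟩ := G.bounded
  have hle1 : ∀ᶠ ε : ℝ≥0 in 𝓝[>] 0, ε ∈ Ioc (0 : ℝ≥0) 1 :=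
    Ioc_mem_nhdsGT one_pos
  have hinit : ∀ᶠ ε : ℝ≥0 in 𝓝[>] 0, eLpNorm (fun θ => M.bEps G ε (r₀, x₀ ε) θ -
      M.b (r₀, x₀ ε) θ) 2 (surf n) < ENNReal.ofReal c := by
    rcases hx₀ with ⟨x, -, hx⟩ | ⟨a, ha, hx⟩
    · simp_rw [hx]
      exact M.eventually_eLpNorm_bEps_sub_lt_of_fixed hn G _ hc
    · obtain ⟨L, hL⟩ := hM a ha
      filter_upwards [hle1, M.eventually_eLpNorm_bEps_sub_lt hn G ha.1 L hc] with ε hε h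
      exact h _ (hx ε hε).2.1.1 (hL _ (hx ε hε))
  obtain ⟨c₀, hc₀, hr₀⟩ := exists_lower r₀
  -- the domain is in `𝒜_∞(a₀)` before the last jump, and in `𝒜_∞(a)` after it
  obtain ⟨a₀, ha₀, hac₀, haC₀⟩ := exists_mem_A c₀ δ⁻¹ hc₀
  obtain ⟨a, ha, hac, haC⟩ := exists_mem_A a₀ (a₀⁻¹ + |Λ|) ha₀.1
  obtain ⟨L, hL⟩ := hM a ha
  refine tendsto_const_nhds.congr' ?_
  filter_upwards [hinit, hle1, M.eventually_eLpNorm_bEps_sub_lt hn G ha₀.1 L hc,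
    M.eventually_scale_lt_one hn ha₀.1] with ε hε1 hε2 hε3 hε4
  have hroot : (ε : ℝ) ^ (1 / (n : ℝ)) ≤ 1 :=
    Real.rpow_le_one ε.coe_nonneg (by exact_mod_cast hε2.2) (by positivity)
  set R : Set ((Cplus n × Eucl n) × (Cplus n × Eucl n)) :=
    {z | z.1.1 ∈ A n ∞ a₀}ᶜ ∪ {z | LipschitzWith L (M.dens z.2).1}
  have hR : MeasurableSet R :=
    ((measurableSet_A ha₀.1).preimage measurable_fst).compl.union
      ((M.measurableSet_lipschitz_dens L).preimage measurable_snd)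
  have hstep := ae_chainLaw_step (M.stepKernel G ε) (Measure.dirac (r₀, x₀ ε)) hR fun q => by
    refine M.ae_stepKernel (hR.preimage measurable_prodMk_left) ?_
    by_cases hq : q.1 ∈ A n ∞ a₀
    · have hq' := (mem_A_top_iff ha₀.1).1 hq
      have hu : ∀ ξ, (M.update G ε (q, ξ)).1 ∈ A n ∞ a := fun ξ => by
        refine (mem_A_top_iff ha.1).2 fun θ => ⟨?_, ?_⟩
        · exact (hac.trans (hq' θ).1).trans (M.le_update G ε q ξ θ)
        · rw [M.update_apply]
          have h1 := M.jump_le hn hΛ hε2.1 (hε4 q fun θ => (hq' θ).1) (sphInner ξ θ)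
          have h2 : Λ * (ε : ℝ) ^ (1 / (n : ℝ)) ≤ |Λ| := by
            calc _ ≤ |Λ| * 1 := mul_le_mul (le_abs_self _) hroot
                  (Real.rpow_nonneg ε.coe_nonneg _) (abs_nonneg _)
              _ = _ := mul_one _
          linarith [(hq' θ).2]
      filter_upwards [M.ae_update_mem_Ae G ε (A_anti ha.1 hac hq)] with ξ hξ
      exact Or.inr (hL _ (hξ (hu ξ)))
    · exact ae_of_all _ fun ξ => Or.inl hq
  have h1 : ∀ᵐ w ∂(M.procLaw G ε (r₀, x₀ ε)), IsClock w.1 :=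
    Measure.quasiMeasurePreserving_fst.ae ae_isClock
  have h2 : ∀ᵐ w ∂(M.procLaw G ε (r₀, x₀ ε)), (∀ k, (w.2 k, w.2 (k + 1)) ∈ R) ∧
      w.2 0 = (r₀, x₀ ε) ∧ Monotone fun k => (w.2 k).1 :=
    Measure.quasiMeasurePreserving_snd.ae
      (hstep.and (M.ae_chainLaw_monotone G ε (r₀, x₀ ε)))
  symm
  rw [← nonpos_iff_eq_zero, nonpos_iff_eq_zero, measure_eq_zero_iff_ae_notMem]
  filter_upwards [h1, h2] with w hτ ⟨hwR, hw0, hwm⟩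
  refine not_le.2 ?_
  rw [pathAt]
  rcases hj : arrivalCount ε w.1 (min (t : EReal) (zeta ε δ w)).toReal with _ | k
  · rw [hw0]
    exact hε1
  · have hnorm := norm_le_of_stopped hε2.1 hτ ht hj
    have hlow : ∀ j θ, a₀ ≤ (w.2 j).1.1 θ := fun j θ => by
      have h3 : (w.2 0).1.1 θ ≤ (w.2 j).1.1 θ := hwm (Nat.zero_le j) θ
      rw [hw0] at h3
      exact (hac₀.trans (hr₀ θ)).trans h3
    have hA : (w.2 k).1 ∈ A n ∞ a₀ :=
      ⟨hlow k, hnorm.trans (ENNReal.ofReal_le_ofReal haC₀)⟩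
    refine hε3 _ (hlow (k + 1)) ?_
    rcases hwR k with h | h
    · exact absurd hA h
    · exact h

end GrowthModel


/-! ### Spherical caps -/

section Caps

variable {n : ℕ}

open scoped Pointwise in
/-- A spherical cap of radius `ρ` has measure of order at most `ρ^{n-1}`: the cone over the cap is
covered by `1/ρ` balls of radius `2ρ`. -/
lemma exists_surf_closedBall_le (hn : 1 ≤ n) : ∃ C : ℝ, 0 ≤ C ∧ ∀ (z : Sph n) (ρ : ℝ), 0 < ρ →
    surf n (Metric.closedBall z ρ) ≤ ENNReal.ofReal (C * ρ ^ (n - 1)) := by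
  set V : ℝ := volume.real (Metric.closedBall (0 : Eucl n) 1)
  have hV : 0 ≤ V := measureReal_nonneg
  refine ⟨n * 2 ^ (n + 1) * V + area n, by have := area_nonneg (n := n); positivity,
    fun z ρ hρ => ?_⟩
  have hω := area_nonneg (n := n)
  rcases le_total 1 ρ with h1 | h1
  · refine (measure_mono (subset_univ _)).trans ?_
    rw [surf_univ]
    refine ENNReal.ofReal_le_ofReal ?_
    have h2 : 1 ≤ ρ ^ (n - 1) := one_le_pow₀ h1
    calc area n ≤ n * 2 ^ (n + 1) * V + area n := by
          have : 0 ≤ n * 2 ^ (n + 1) * V := by positivity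
          linarith
      _ ≤ _ := le_mul_of_one_le_right (by positivity) h2
  set K := ⌈1 / ρ⌉₊
  have hK1 : 1 / ρ ≤ K := Nat.le_ceil _
  have hK0 : (0 : ℝ) < K := (one_div_pos.2 hρ).trans_le hK1
  have hK2 : (K : ℝ) ≤ 2 / ρ := by
    have h2 := (Nat.ceil_lt_add_one (one_div_pos.2 hρ).le).le
    have h3 : 1 ≤ 1 / ρ := by rwa [le_div_iff₀ hρ, one_mul]
    calc (K : ℝ) ≤ 1 / ρ + 1 := h2
      _ ≤ 1 / ρ + 1 / ρ := by linarith
      _ = 2 / ρ := by ring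
  have hKρ : 1 / (K : ℝ) ≤ ρ := by
    rw [div_le_iff₀ hK0, mul_comm]
    rwa [div_le_iff₀ hρ] at hK1
  have hsub : Ioo (0 : ℝ) 1 • ((↑) '' Metric.closedBall z ρ : Set (Eucl n)) ⊆
      ⋃ i ∈ Finset.range K, Metric.closedBall (((i : ℝ) / K) • (z : Eucl n)) (2 * ρ) := by
    rintro _ ⟨t, ht, _, ⟨θ, hθ, rfl⟩, rfl⟩
    have htK : 0 ≤ t * K := mul_nonneg ht.1.le hK0.le
    have hi := Nat.floor_le htK
    have hi2 := (Nat.lt_floor_add_one (t * K)).le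
    refine mem_iUnion₂.2 ⟨⌊t * K⌋₊, ?_, ?_⟩
    · rw [Finset.mem_range, Nat.floor_lt htK]
      exact mul_lt_of_lt_one_left hK0 ht.2
    · rw [Metric.mem_closedBall, dist_eq_norm]
      set i := ⌊t * K⌋₊
      have e : t • (θ : Eucl n) - ((i : ℝ) / K) • (z : Eucl n) =
          (t - i / K) • (θ : Eucl n) + ((i : ℝ) / K) • ((θ : Eucl n) - z) := by
        rw [sub_smul, smul_sub]; abel
      change ‖t • (θ : Eucl n) - _‖ ≤ _
      rw [e]
      refine (norm_add_le _ _).trans ?_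
      rw [norm_smul, norm_smul, norm_eq_of_mem_sphere, mul_one, Real.norm_eq_abs,
        Real.norm_of_nonneg (by positivity), ← dist_eq_norm]
      have h2 : |t - i / K| ≤ 1 / K := by
        have h3 : (i : ℝ) / K ≤ t := (div_le_iff₀ hK0).2 hi
        have h4 : t ≤ i / K + 1 / K := by rw [← add_div, le_div_iff₀ hK0]; exact hi2
        rw [abs_of_nonneg (by linarith)]
        linarith
      have h5 : (i : ℝ) / K ≤ 1 := by
        rw [div_le_one hK0]
        exact hi.trans (mul_le_of_le_one_left hK0.le ht.2.le)
      have h6 : dist (θ : Eucl n) z ≤ ρ := hθ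
      have h7 : (i : ℝ) / K * dist (θ : Eucl n) z ≤ 1 * ρ := by gcongr
      linarith
  rw [Measure.toSphere_apply' _ Metric.isClosed_closedBall.measurableSet,
    finrank_euclideanSpace_fin]
  calc (n : ℝ≥0∞) * volume (Ioo (0 : ℝ) 1 • ((↑) '' Metric.closedBall z ρ : Set (Eucl n)))
      ≤ n * ∑ i ∈ Finset.range K,
          volume (Metric.closedBall (((i : ℝ) / K) • (z : Eucl n)) (2 * ρ)) := by
        gcongr
        exact (measure_mono hsub).trans (measure_biUnion_finset_le _ _)
    _ = ENNReal.ofReal (n * (K * ((2 * ρ) ^ n * V))) := by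
        simp_rw [Measure.addHaar_closedBall' volume _ (by positivity : 0 ≤ 2 * ρ)]
        rw [Finset.sum_const, Finset.card_range, finrank_euclideanSpace_fin, nsmul_eq_mul,
          ENNReal.ofReal_mul (by positivity), ENNReal.ofReal_mul (by positivity),
          ENNReal.ofReal_mul (by positivity), ENNReal.ofReal_natCast, ENNReal.ofReal_natCast,
          ofReal_measureReal measure_closedBall_lt_top.ne]
    _ ≤ _ := by
        refine ENNReal.ofReal_le_ofReal ?_
        have e : ρ ^ n = ρ ^ (n - 1) * ρ := by rw [← pow_succ, Nat.sub_add_cancel hn]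
        calc (n : ℝ) * (K * ((2 * ρ) ^ n * V)) ≤ n * (2 / ρ * ((2 * ρ) ^ n * V)) := by gcongr
          _ = n * 2 ^ (n + 1) * V * ρ ^ (n - 1) := by
              rw [mul_pow, e]; field_simp; ring
          _ ≤ _ := by
              have : 0 ≤ area n * ρ ^ (n - 1) := by positivity
              linarith

/-- The sphere is covered by at most `(3/s)^n` sets of diameter at most `n s`, the traces of the
cells of a grid. -/
lemma exists_cells {s : ℝ} (hs : 0 < s) (hs1 : s ≤ 1) :
    ∃ (K : ℕ) (U : (Fin n → Fin K) → Set (Sph n)), (K : ℝ) ≤ 3 / s ∧ (∀ θ, ∃ u, θ ∈ U u) ∧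
      ∀ u, ∀ θ ∈ U u, ∀ θ' ∈ U u, dist θ θ' ≤ n * s := by
  set K := ⌊2 / s⌋₊ + 1
  have hcoord : ∀ (θ : Sph n) (i : Fin n), |(θ : Eucl n) i| ≤ 1 := fun θ i => by
    have := PiLp.norm_apply_le (θ : Eucl n) i
    rwa [norm_eq_of_mem_sphere] at this
  have hlt : ∀ (θ : Sph n) (i : Fin n), ⌊((θ : Eucl n) i + 1) / s⌋₊ < K := fun θ i => by
    refine Nat.lt_succ_of_le (Nat.floor_le_floor ?_)
    have := (abs_le.1 (hcoord θ i)).2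
    gcongr
    linarith
  refine ⟨K, fun u => {θ | ∀ i, ⌊((θ : Eucl n) i + 1) / s⌋₊ = u i}, ?_,
    fun θ => ⟨fun i => ⟨_, hlt θ i⟩, fun i => rfl⟩, fun u θ hθ θ' hθ' => ?_⟩
  · have h1 : (⌊2 / s⌋₊ : ℝ) ≤ 2 / s := Nat.floor_le (by positivity)
    have h2 : 1 ≤ 1 / s := by rwa [le_div_iff₀ hs, one_mul]
    calc (K : ℝ) = ⌊2 / s⌋₊ + 1 := by push_cast [K]; rfl
      _ ≤ 2 / s + 1 / s := add_le_add h1 h2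
      _ = 3 / s := by ring
  · have h1 : ∀ i, |(θ : Eucl n) i - (θ' : Eucl n) i| ≤ s := fun i => by
      have e : ⌊((θ : Eucl n) i + 1) / s⌋₊ = ⌊((θ' : Eucl n) i + 1) / s⌋₊ :=
        (hθ i).trans (hθ' i).symm
      have p1 : 0 ≤ ((θ : Eucl n) i + 1) / s :=
        div_nonneg (by linarith [(abs_le.1 (hcoord θ i)).1]) hs.le
      have p2 : 0 ≤ ((θ' : Eucl n) i + 1) / s :=
        div_nonneg (by linarith [(abs_le.1 (hcoord θ' i)).1]) hs.le
      have a1 := Nat.floor_le p1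
      have a2 := Nat.floor_le p2
      have b1 := (Nat.lt_floor_add_one (((θ : Eucl n) i + 1) / s)).le
      have b2 := (Nat.lt_floor_add_one (((θ' : Eucl n) i + 1) / s)).le
      rw [e] at a1 b1
      have c1 : ((θ : Eucl n) i + 1) / s - ((θ' : Eucl n) i + 1) / s =
          ((θ : Eucl n) i - (θ' : Eucl n) i) / s := by ring
      have c2 : |((θ : Eucl n) i - (θ' : Eucl n) i) / s| ≤ 1 := by
        rw [← c1, abs_le]; constructor <;> linarith
      rwa [abs_div, abs_of_pos hs, div_le_one hs] at c2
    rw [Subtype.dist_eq, EuclideanSpace.dist_eq]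
    refine Real.sqrt_le_iff.2 ⟨by positivity, ?_⟩
    calc ∑ i, dist ((θ : Eucl n) i) ((θ' : Eucl n) i) ^ 2 ≤ ∑ _i : Fin n, s ^ 2 :=
          Finset.sum_le_sum fun i _ => by
            rw [Real.dist_eq]
            exact pow_le_pow_left₀ (abs_nonneg _) (h1 i) 2
      _ = n * s ^ 2 := by simp
      _ ≤ (n * s) ^ 2 := by
          rw [mul_pow]
          refine mul_le_mul_of_nonneg_right ?_ (sq_nonneg s)
          exact_mod_cast Nat.le_self_pow two_ne_zero n

end Caps

/-! ### Counting transitions of a chain -/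

section Count

variable {α : Type*} [MeasurableSpace α] (κ : Kernel α α) [IsMarkovKernel κ] (μ : Measure α)
  [IsProbabilityMeasure μ]

/-- If transitions in `S` have conditional probability at most `p`, then the exponential moment
`E[2^N]` of their number `N` among the first `m` transitions is at most `(1 + p)^m`. -/
lemma chainLaw_count_ge_le {S : Set (α × α)} (hS : MeasurableSet S) {p : ℝ} (hp : 0 ≤ p)
    (h : ∀ x, κ x {y | (x, y) ∈ S} ≤ ENNReal.ofReal p) (m : ℕ) (c : ℝ) :
    chainLaw κ μ {w | c ≤ ∑ l ∈ Finset.range m, S.indicator (fun _ => (1 : ℝ)) (w l, w (l + 1))} ≤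
      ENNReal.ofReal ((1 + p) ^ m * (2 : ℝ) ^ (-c)) := by
  have hi : Measurable (S.indicator fun _ => (1 : ℝ)) := measurable_const.indicator hS
  set φ : α × α → ℝ≥0∞ := fun z => ENNReal.ofReal ((2 : ℝ) ^ (S.indicator (fun _ => (1 : ℝ)) z))
  have hφ : Measurable φ := (measurable_const.pow hi).ennreal_ofReal
  have hφ1 : ∀ z, φ z = 1 + S.indicator (fun _ => (1 : ℝ≥0∞)) z := fun z => by
    by_cases hz : z ∈ S
    · simp only [φ, indicator_of_mem hz, Real.rpow_one]
      norm_num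
    · simp only [φ, indicator_of_notMem hz, Real.rpow_zero]
      norm_num
  have hC : ∀ x, ∫⁻ y, φ (x, y) ∂(κ x) ≤ ENNReal.ofReal (1 + p) := fun x => by
    have hSx : MeasurableSet {y | (x, y) ∈ S} := hS.preimage measurable_prodMk_left
    simp_rw [hφ1]
    rw [lintegral_add_left measurable_const, lintegral_const, measure_univ, mul_one,
      ENNReal.ofReal_add zero_le_one hp, ENNReal.ofReal_one]
    gcongr
    refine le_trans (le_of_eq ?_) (h x)
    rw [← lintegral_indicator_one hSx]
    rfl
  have hprod := lintegral_chainLaw_prod_le κ μ hφ hC m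
  have hmk := mul_meas_ge_le_lintegral (μ := chainLaw κ μ)
    (f := fun w => ∏ l ∈ Finset.range m, φ (w l, w (l + 1)))
    (Finset.measurable_fun_prod _ fun l _ => hφ.comp (by fun_prop)) (ENNReal.ofReal ((2 : ℝ) ^ c))
  have hsub : {w : ℕ → α | c ≤ ∑ l ∈ Finset.range m,
      S.indicator (fun _ => (1 : ℝ)) (w l, w (l + 1))} ⊆
      {w | ENNReal.ofReal ((2 : ℝ) ^ c) ≤ ∏ l ∈ Finset.range m, φ (w l, w (l + 1))} := by
    intro w hw
    change _ ≤ ∏ l ∈ Finset.range m, ENNReal.ofReal _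
    rw [← ENNReal.ofReal_prod_of_nonneg fun _ _ => by positivity, ← Real.rpow_sum_of_pos two_pos]
    exact ENNReal.ofReal_le_ofReal (Real.rpow_le_rpow_of_exponent_le one_le_two hw)
  have h2 : ENNReal.ofReal ((2 : ℝ) ^ (-c)) * ENNReal.ofReal ((2 : ℝ) ^ c) = 1 := by
    rw [← ENNReal.ofReal_mul (by positivity), ← Real.rpow_add two_pos, neg_add_cancel,
      Real.rpow_zero, ENNReal.ofReal_one]
  refine (measure_mono hsub).trans ?_
  have h3 := mul_le_mul_right (hmk.trans hprod) (ENNReal.ofReal ((2 : ℝ) ^ (-c)))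
  rw [← mul_assoc, h2, one_mul] at h3
  refine h3.trans (le_of_eq ?_)
  rw [mul_comm, ENNReal.ofReal_mul (by positivity), ENNReal.ofReal_pow (by positivity)]

end Count


/-! ### The supremum norm of the growth process -/

namespace GrowthModel

variable {n : ℕ} (M : GrowthModel n)

lemma exists_of_zeta_lt {ε : ℝ≥0} (hε : 0 < ε) {δ T : ℝ} {ρ : Cplus n}
    {w : (ℕ → ℝ) × (ℕ → Cplus n × Eucl n)} (hτ : IsClock w.1)
    (h : zeta ε δ w < min (T : EReal) (kappa ε ρ w)) :
    ∃ k, arrival ε w.1 k < T ∧ ENNReal.ofReal δ⁻¹ < eLpNorm (w.2 k).1.1 ∞ (surf n) ∧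
      eLpNorm (w.2 k).1.1 2 (surf n) ≤ 1 + eLpNorm ρ.1 2 (surf n) := by
  obtain ⟨_, ⟨s, ⟨hs0, hs⟩, rfl⟩, hlt⟩ := sInf_lt_iff.1 h
  have h1 : s < T := EReal.coe_lt_coe_iff.1 (hlt.trans_le (min_le_left _ _))
  refine ⟨arrivalCount ε w.1 s, ((hτ.arrivalCount_spec hε hs0.le).1).trans_lt h1, hs, ?_⟩
  by_contra hc
  have h2 : kappa ε ρ w ≤ s := sInf_le ⟨s, ⟨hs0.le, not_le.1 hc⟩, rfl⟩
  exact absurd (hlt.trans_le (min_le_right _ _)) (not_lt.2 h2)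

/-- States whose domain is at least `a` and whose hitting density is at most `B`. -/
def boundedStates (a B : ℝ) : Set (Cplus n × Eucl n) :=
  {q | (∀ θ, a ≤ q.1.1 θ) ∧ ∀ θ, (M.dens q).1 θ ≤ B}

lemma measurableSet_boundedStates (a B : ℝ) : MeasurableSet (M.boundedStates a B) := by
  have h2 : IsClosed {f : C(Sph n, ℝ) | ∀ θ, f θ ≤ B} := by
    have h : {f : C(Sph n, ℝ) | ∀ θ, f θ ≤ B} = ⋂ θ, {f : C(Sph n, ℝ) | f θ ≤ B} := by
      ext r
      simp only [mem_iInter]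
      rfl
    rw [h]
    exact isClosed_iInter fun θ => isClosed_le (f := fun f : C(Sph n, ℝ) => f θ)
      (g := fun _ => B) (by fun_prop) (by fun_prop)
  exact ((isClosed_le_coe a).measurableSet.preimage measurable_fst).inter
    (h2.measurableSet.preimage M.measurable_dens_coe)

/-- Transitions from a bounded state which change the domain somewhere on `U`. -/
def changes (a B : ℝ) (U : Set (Sph n)) : Set ((Cplus n × Eucl n) × (Cplus n × Eucl n)) :=
  {z | z.1 ∈ M.boundedStates a B ∧ ∃ θ ∈ U, z.1.1.1 θ < z.2.1.1 θ}

lemma measurableSet_changes (a B : ℝ) (U : Set (Sph n)) : MeasurableSet (M.changes a B U) := by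
  have h2 : IsOpen {z : Cplus n × Cplus n | ∃ θ ∈ U, z.1.1 θ < z.2.1 θ} := by
    have h : {z : Cplus n × Cplus n | ∃ θ ∈ U, z.1.1 θ < z.2.1 θ} =
        ⋃ θ ∈ U, {z | z.1.1 θ < z.2.1 θ} := by
      ext z
      simp only [mem_iUnion₂, exists_prop]
      rfl
    rw [h]
    exact isOpen_biUnion fun θ _ => isOpen_lt (f := fun z : Cplus n × Cplus n => z.1.1 θ)
      (g := fun z => z.2.1 θ) (by fun_prop) (by fun_prop)
  exact ((M.measurableSet_boundedStates a B).preimage measurable_fst).inter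
    (h2.measurableSet.preimage ((measurable_fst.comp measurable_fst).prodMk
      (measurable_fst.comp measurable_snd)))

/-- A jump changes the domain on a set of small diameter only if the particle hits a cap of radius
of order `ε^{1/n}`. -/
lemma stepKernel_changes_le (hn : 2 ≤ n) (G : BumpFamily n) {a B : ℝ} (ha : 0 < a) (hB : 0 ≤ B) :
    ∃ P : ℝ, 0 ≤ P ∧ ∀ ε : ℝ≥0, 0 < ε → ∀ U : Set (Sph n),
      (∀ θ ∈ U, ∀ θ' ∈ U, dist θ θ' ≤ n * (ε : ℝ) ^ (1 / (n : ℝ))) →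
      ∀ q, M.stepKernel G ε q {q' | (q, q') ∈ M.changes a B U} ≤
        ENNReal.ofReal (P * ((ε : ℝ) ^ (1 / (n : ℝ))) ^ (n - 1)) := by
  obtain ⟨C, hC, hcap⟩ := exists_surf_closedBall_le (n := n) (by lia)
  set c := 2 * scaleConst n a + n
  have hc : 0 < c := by
    have := M.scaleConst_pos ha
    positivity
  refine ⟨B * (C * c ^ (n - 1)), by positivity, fun ε hε U hU q => ?_⟩
  set s := (ε : ℝ) ^ (1 / (n : ℝ))
  have hs : 0 < s := Real.rpow_pos_of_pos (NNReal.coe_pos.2 hε) _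
  rcases U.eq_empty_or_nonempty with rfl | ⟨θ₀, hθ₀⟩
  · simp [changes]
  by_cases hq : q ∈ M.boundedStates a B
  swap
  · simp [changes, hq]
  have hms : MeasurableSet {q' | (q, q') ∈ M.changes a B U} :=
    (M.measurableSet_changes a B U).preimage measurable_prodMk_left
  have hmap : Measurable fun ξ => M.update G ε (q, ξ) :=
    (M.measurable_update G ε).comp measurable_prodMk_left
  have hsub : (fun ξ => M.update G ε (q, ξ)) ⁻¹' {q' | (q, q') ∈ M.changes a B U} ⊆
      Metric.closedBall θ₀ (c * s) := by
    rintro ξ ⟨-, θ, hθ, hlt⟩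
    have hlt' : q.1.1 θ < (M.update G ε (q, ξ)).1.1 θ := hlt
    rw [update_apply] at hlt'
    have h1 : dist ξ θ ≤ 2 * M.scale ε q := by
      by_contra hd
      rw [G.support _ (M.scale_pos hε q) _ _ (not_le.1 hd)] at hlt'
      simp at hlt'
    rw [Metric.mem_closedBall]
    calc dist ξ θ₀ ≤ dist ξ θ + dist θ θ₀ := dist_triangle _ _ _
      _ ≤ 2 * (s * scaleConst n a) + n * s := by
          have := M.scale_le hn ε ha hq.1
          have := hU θ hθ θ₀ hθ₀
          gcongr
          exact h1.trans (by gcongr)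
      _ = c * s := by ring
  rw [stepKernel_apply, Measure.map_apply hmap hms, hitKernel_apply,
    withDensity_apply _ (hms.preimage hmap)]
  calc _ ≤ ∫⁻ _ in (fun ξ => M.update G ε (q, ξ)) ⁻¹' {q' | (q, q') ∈ M.changes a B U},
        ENNReal.ofReal B ∂(surf n) :=
        lintegral_mono fun θ => ENNReal.ofReal_le_ofReal (hq.2 θ)
    _ ≤ ENNReal.ofReal B * ENNReal.ofReal (C * (c * s) ^ (n - 1)) := by
        rw [setLIntegral_const]
        gcongr
        exact (measure_mono hsub).trans (hcap θ₀ _ (by positivity))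
    _ = _ := by
        rw [← ENNReal.ofReal_mul hB, mul_pow]
        congr 1
        ring

/-- Almost surely, every jump from a domain above `a` is small, and the particle is in a bounded
state after each jump between two domains of `𝒜_2(a)`. -/
lemma ae_chainLaw_jumps (hn : 2 ≤ n) {G : BumpFamily n} {Λ : ℝ}
    (hΛ : ∀ η ∈ Ioo (0 : ℝ) 1, ∀ t, η ^ (n - 1) * G.g η t ≤ Λ) {ε : ℝ≥0} (hε : 0 < ε) {a B : ℝ}
    (ha : 0 < a) (hB : ∀ q ∈ M.Ae 2 a, ∀ θ, (M.dens q).1 θ ≤ B)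
    (hscale : ∀ q : Cplus n × Eucl n, (∀ θ, a ≤ q.1.1 θ) → M.scale ε q < 1)
    (p₀ : Cplus n × Eucl n) :
    ∀ᵐ w ∂(chainLaw (M.stepKernel G ε) (Measure.dirac p₀)), ∀ k,
      ((∀ θ, a ≤ (w k).1.1 θ) → ∀ θ,
        (w (k + 1)).1.1 θ ≤ (w k).1.1 θ + Λ * (ε : ℝ) ^ (1 / (n : ℝ))) ∧
      ((w k).1 ∈ A n 2 a → (w (k + 1)).1 ∈ A n 2 a → w (k + 1) ∈ M.boundedStates a B) := by
  set e := Λ * (ε : ℝ) ^ (1 / (n : ℝ))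
  -- the two properties of a transition, written as measurable relations
  set R₁ : Set ((Cplus n × Eucl n) × (Cplus n × Eucl n)) :=
    {z | ∀ θ, a ≤ z.1.1.1 θ}ᶜ ∪ {z | ∀ θ, z.2.1.1 θ ≤ z.1.1.1 θ + e}
  set R₂ : Set ((Cplus n × Eucl n) × (Cplus n × Eucl n)) :=
    {z | z.1.1 ∈ A n 2 a}ᶜ ∪ ({z | z.2.1 ∈ A n 2 a}ᶜ ∪ {z | z.2 ∈ M.boundedStates a B})
  have hR₁ : MeasurableSet R₁ := by
    have h2 : IsClosed {z : Cplus n × Cplus n | ∀ θ, z.2.1 θ ≤ z.1.1 θ + e} := by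
      have h : {z : Cplus n × Cplus n | ∀ θ, z.2.1 θ ≤ z.1.1 θ + e} =
          ⋂ θ, {z | z.2.1 θ ≤ z.1.1 θ + e} := by
        ext z
        simp only [mem_iInter]
        rfl
      rw [h]
      exact isClosed_iInter fun θ => isClosed_le (f := fun z : Cplus n × Cplus n => z.2.1 θ)
        (g := fun z => z.1.1 θ + e) (by fun_prop) (by fun_prop)
    exact ((isClosed_le_coe a).measurableSet.preimage
      (measurable_fst.comp measurable_fst)).compl.union
      (h2.measurableSet.preimage ((measurable_fst.comp measurable_fst).prodMk
        (measurable_fst.comp measurable_snd)))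
  have hR₂ : MeasurableSet R₂ :=
    ((measurableSet_A ha).preimage measurable_fst).compl.union
      (((measurableSet_A ha).preimage measurable_snd).compl.union
        ((M.measurableSet_boundedStates a B).preimage measurable_snd))
  have h1 := ae_chainLaw_step (M.stepKernel G ε) (Measure.dirac p₀) hR₁ fun q => by
    refine M.ae_stepKernel (hR₁.preimage measurable_prodMk_left) (ae_of_all _ fun ξ => ?_)
    by_cases hq : ∀ θ, a ≤ q.1.1 θ
    · refine Or.inr fun θ => ?_
      change (M.update G ε (q, ξ)).1.1 θ ≤ q.1.1 θ + e
      rw [update_apply]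
      exact add_le_add_right (M.jump_le hn hΛ hε (hscale q hq) _) _
    · exact Or.inl hq
  have h2 := ae_chainLaw_step (M.stepKernel G ε) (Measure.dirac p₀) hR₂ fun q => by
    refine M.ae_stepKernel (hR₂.preimage measurable_prodMk_left) ?_
    by_cases hq : q.1 ∈ A n 2 a
    · filter_upwards [M.ae_update_mem_Ae G ε hq] with ξ hξ
      by_cases hu : (M.update G ε (q, ξ)).1 ∈ A n 2 a
      · exact Or.inr (Or.inr ⟨hu.1, hB _ (hξ hu)⟩)
      · exact Or.inr (Or.inl hu)
    · exact ae_of_all _ fun ξ => Or.inl hq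
  filter_upwards [h1, h2] with w hw1 hw2 k
  refine ⟨fun h => ?_, fun h h' => ?_⟩
  · rcases hw1 k with hc | hc
    · exact absurd h hc
    · exact hc
  · rcases hw2 k with hc | hc | hc
    · exact absurd h hc
    · exact absurd h' hc
    · exact hc

/-- If the domain is large in supremum norm but not in `L^2` after fewer than `m` jumps, then the
domain changed many times on one of the sets `U u`.  The state before the first jump need not be
bounded, but the first jump contributes only `Λ s`. -/
lemma exists_count_ge {a B Λ s c : ℝ} (hΛ : 0 < Λ) (hs : 0 < s) (hs1 : s ≤ 1)
    (hc : 0 ≤ c)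
    {ι : Type*} {U : ι → Set (Sph n)} (hU : ∀ θ, ∃ u, θ ∈ U u) {w : ℕ → Cplus n × Eucl n}
    (hmono : Monotone fun k => (w k).1)
    (hjump : ∀ k, ((∀ θ, a ≤ (w k).1.1 θ) → ∀ θ, (w (k + 1)).1.1 θ ≤ (w k).1.1 θ + Λ * s) ∧
      ((w k).1 ∈ A n 2 a → (w (k + 1)).1 ∈ A n 2 a → w (k + 1) ∈ M.boundedStates a B))
    {k m : ℕ} (hkm : k ≤ m) (hA : ∀ l ≤ k, (w l).1 ∈ A n 2 a)
    (hlarge : ‖(w 0).1.1‖ + Λ * (1 + c) < nrm ∞ (w k).1.1) :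
    ∃ u, c / s ≤ ∑ l ∈ Finset.range m,
      (M.changes a B (U u)).indicator (fun _ => (1 : ℝ)) (w l, w (l + 1)) := by
  by_contra! hcon
  refine absurd hlarge (not_lt.2 ?_)
  have hpos : 0 ≤ ‖(w 0).1.1‖ + Λ * (1 + c) := by positivity
  refine (nrm_top_le_iff hpos).2 fun θ => ?_
  obtain ⟨u, hu⟩ := hU θ
  set S := M.changes a B (U u)
  set I : ℕ → ℝ := fun l => S.indicator (fun _ => (1 : ℝ)) (w l, w (l + 1))
  have hI : ∀ l, 0 ≤ I l := fun l => indicator_nonneg (fun _ _ => zero_le_one) _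
  have hterm : ∀ l ∈ Finset.range k, (w (l + 1)).1.1 θ - (w l).1.1 θ ≤
      Λ * s * (I l + if l = 0 then 1 else 0) := fun l hl => by
    have hlk := Finset.mem_range.1 hl
    have h1 := (hjump l).1 (hA l hlk.le).1 θ
    have hΛs : 0 ≤ Λ * s := by positivity
    rcases l with _ | l
    · rw [if_pos rfl]
      have := mul_nonneg hΛs (hI 0)
      linarith
    · rw [if_neg (Nat.succ_ne_zero l), add_zero]
      have hb : w (l + 1) ∈ M.boundedStates a B :=
        (hjump l).2 (hA l (by lia)) (hA (l + 1) hlk.le)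
      have hle : (w (l + 1)).1.1 θ ≤ (w (l + 1 + 1)).1.1 θ := hmono (Nat.le_succ (l + 1)) θ
      rcases hle.lt_or_eq with hlt | heq
      · have hmem : (w (l + 1), w (l + 1 + 1)) ∈ S := ⟨hb, θ, hu, hlt⟩
        have : I (l + 1) = 1 := indicator_of_mem hmem _
        rw [this]
        linarith
      · rw [heq, sub_self]
        exact mul_nonneg hΛs (hI _)
  have hsum := Finset.sum_le_sum hterm
  rw [Finset.sum_range_sub (fun l => (w l).1.1 θ), ← Finset.mul_sum, Finset.sum_add_distrib] at hsum
  have h2 : ∑ l ∈ Finset.range k, I l ≤ ∑ l ∈ Finset.range m, I l :=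
    Finset.sum_le_sum_of_subset_of_nonneg (Finset.range_mono hkm) fun l _ _ => hI l
  have h3 : ∑ l ∈ Finset.range k, (if l = 0 then (1 : ℝ) else 0) ≤ 1 := by
    rw [Finset.sum_ite_eq']
    split_ifs <;> norm_num
  have h4 : (∑ l ∈ Finset.range m, I l) * s ≤ c := ((lt_div_iff₀ hs).1 (hcon u)).le
  have h5 : (w 0).1.1 θ ≤ ‖(w 0).1.1‖ := (le_abs_self _).trans ((w 0).1.1.norm_coe_le_norm θ)
  rw [abs_of_pos ((w k).1.2 θ)]
  have h6 : Λ * s * (∑ l ∈ Finset.range k, I l +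
      ∑ l ∈ Finset.range k, (if l = 0 then (1 : ℝ) else 0)) ≤ Λ * (1 + c) := by
    rw [mul_assoc]
    refine mul_le_mul_of_nonneg_left ?_ hΛ.le
    calc _ ≤ s * (∑ l ∈ Finset.range m, I l + 1) := by gcongr
      _ = s + (∑ l ∈ Finset.range m, I l) * s := by ring
      _ ≤ _ := add_le_add hs1 h4
  linarith

/-- The exponential moment of the number of hits of a cap of radius `s = ε^{1/n}` during `O(s^{-n})`
jumps is `exp(O(1/s))`, which is beaten by the threshold of order `1/s`. -/
lemma pow_mul_two_rpow_le {s P T : ℝ} (hs : 0 < s) (hP : 0 ≤ P) (hT : 0 ≤ T) {n m : ℕ}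
    (hn : 1 ≤ n) (hm : m ≤ (4 * T + 2) / s ^ n) :
    (1 + P * s ^ (n - 1)) ^ m * (2 : ℝ) ^ (-(2 * ((4 * T + 2) * P + 1) / s)) ≤
      Real.exp (-s⁻¹) := by
  have e : s ^ n = s ^ (n - 1) * s := by rw [← pow_succ, Nat.sub_add_cancel hn]
  have h1 : (1 + P * s ^ (n - 1)) ^ m ≤ Real.exp ((4 * T + 2) * P / s) := by
    calc (1 + P * s ^ (n - 1)) ^ m ≤ Real.exp (P * s ^ (n - 1)) ^ m := by
          gcongr
          rw [add_comm]
          exact Real.add_one_le_exp _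
      _ = Real.exp (m * (P * s ^ (n - 1))) := by rw [← Real.exp_nat_mul]
      _ ≤ Real.exp ((4 * T + 2) / s ^ n * (P * s ^ (n - 1))) := by gcongr
      _ = _ := by
          rw [e]
          congr 1
          field_simp
  have h2 : (2 : ℝ) ^ (-(2 * ((4 * T + 2) * P + 1) / s)) ≤
      Real.exp (-(((4 * T + 2) * P + 1) / s)) := by
    rw [Real.rpow_def_of_pos two_pos, Real.exp_le_exp]
    have h3 : 1 / 2 ≤ Real.log 2 := by linarith [Real.log_two_gt_d9]
    have h4 : 0 ≤ ((4 * T + 2) * P + 1) / s := by positivity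
    have h5 := mul_le_mul_of_nonneg_right h3 h4
    have e2 : 2 * ((4 * T + 2) * P + 1) / s = 2 * (((4 * T + 2) * P + 1) / s) := by ring
    rw [e2]
    linarith
  calc _ ≤ Real.exp ((4 * T + 2) * P / s) * Real.exp (-(((4 * T + 2) * P + 1) / s)) := by gcongr
    _ = _ := by
        rw [← Real.exp_add]
        congr 1
        field_simp
        ring

/-- The bound on the probability of leaving a ball of `C_+` before leaving a ball of `L^2`. -/
lemma procLaw_zeta_lt_le (hn : 2 ≤ n) {G : BumpFamily n} {Λ : ℝ} (hΛ0 : 0 < Λ)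
    (hΛ : ∀ η ∈ Ioo (0 : ℝ) 1, ∀ t, η ^ (n - 1) * G.g η t ≤ Λ) {ε : ℝ≥0} (hε : 0 < ε)
    (hε1 : ε ≤ 1) {a B : ℝ} (ha : 0 < a) (hB : ∀ q ∈ M.Ae 2 a, ∀ θ, (M.dens q).1 θ ≤ B)
    (hscale : ∀ q : Cplus n × Eucl n, (∀ θ, a ≤ q.1.1 θ) → M.scale ε q < 1) {P : ℝ} (hP : 0 ≤ P)
    (hstep : ∀ U : Set (Sph n),
      (∀ θ ∈ U, ∀ θ' ∈ U, dist θ θ' ≤ n * (ε : ℝ) ^ (1 / (n : ℝ))) →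
      ∀ q, M.stepKernel G ε q {q' | (q, q') ∈ M.changes a B U} ≤
        ENNReal.ofReal (P * ((ε : ℝ) ^ (1 / (n : ℝ))) ^ (n - 1)))
    {T : ℝ} (hT : 0 ≤ T) {p₀ : Cplus n × Eucl n} (hp₀ : ∀ θ, a ≤ p₀.1.1 θ) {ρ : Cplus n}
    (hρ : 1 + nrm 2 ρ.1 ≤ a⁻¹) {δ : ℝ}
    (hδ : ‖p₀.1.1‖ + Λ * (1 + 2 * ((4 * T + 2) * P + 1)) < δ⁻¹) :
    M.procLaw G ε p₀ {w | zeta ε δ w < min (T : EReal) (kappa ε ρ w)} ≤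
      ENNReal.ofReal (Real.exp (-(2 * (ε : ℝ))⁻¹)) +
        ENNReal.ofReal ((3 * ((ε : ℝ) ^ (1 / (n : ℝ)))⁻¹) ^ n *
          Real.exp (-((ε : ℝ) ^ (1 / (n : ℝ)))⁻¹)) := by
  set s := (ε : ℝ) ^ (1 / (n : ℝ)) with hsdef
  have hε' : (0 : ℝ) < ε := NNReal.coe_pos.2 hε
  have hs : 0 < s := Real.rpow_pos_of_pos hε' _
  have hs1 : s ≤ 1 := Real.rpow_le_one ε.coe_nonneg (by exact_mod_cast hε1) (by positivity)
  have hsn : s ^ n = ε := by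
    rw [hsdef, one_div, Real.rpow_inv_natCast_pow ε.coe_nonneg (by lia)]
  obtain ⟨K, U, hK, hcov, hdiam⟩ := exists_cells (n := n) hs hs1
  set c := 2 * ((4 * T + 2) * P + 1) with hc
  have hc0 : 0 ≤ c := by positivity
  -- about `T / ε` jumps are expected up to time `T`; four times as many are very unlikely
  set m := ⌈(4 * T + 1) / (ε : ℝ)⌉₊
  have hm1 : (4 * T + 1) / (ε : ℝ) ≤ m := Nat.le_ceil _
  have hm2 : (m : ℝ) ≤ (4 * T + 2) / s ^ n := by
    have h1 := (Nat.ceil_lt_add_one (a := (4 * T + 1) / (ε : ℝ)) (by positivity)).le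
    have h2 : 1 ≤ 1 / (ε : ℝ) := by
      rw [le_div_iff₀ hε', one_mul]
      exact_mod_cast hε1
    rw [hsn]
    calc (m : ℝ) ≤ (4 * T + 1) / (ε : ℝ) + 1 := h1
      _ ≤ (4 * T + 1) / (ε : ℝ) + 1 / ε := by linarith
      _ = _ := by ring
  set E₁ : Set (ℕ → ℝ) := {τ | ∑ i ∈ Finset.range m, τ i ≤ T / ε}
  set E₂ : (Fin n → Fin K) → Set (ℕ → Cplus n × Eucl n) := fun u =>
    {w | c / s ≤ ∑ l ∈ Finset.range m,
      (M.changes a B (U u)).indicator (fun _ => (1 : ℝ)) (w l, w (l + 1))}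
  have hE₁ : clockLaw E₁ ≤ ENNReal.ofReal (Real.exp (-(2 * (ε : ℝ))⁻¹)) := by
    refine (clockLaw_sum_le m (T / ε)).trans (ENNReal.ofReal_le_ofReal ?_)
    have h1 : (1 / 2 : ℝ) ≤ Real.exp (-(1 / 2)) := by
      have := Real.add_one_le_exp (-(1 / 2 : ℝ))
      linarith
    calc Real.exp (T / ε) * (1 / 2) ^ m ≤ Real.exp (T / ε) * Real.exp (-(1 / 2)) ^ m := by gcongr
      _ = Real.exp (T / ε - m / 2) := by
          rw [← Real.exp_nat_mul, ← Real.exp_add]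
          congr 1
          ring
      _ ≤ _ := by
          rw [Real.exp_le_exp]
          have e1 : (4 * T + 1) / (ε : ℝ) = 4 * (T / ε) + 2 * (2 * (ε : ℝ))⁻¹ := by
            field_simp
          have h2 : 0 ≤ T / (ε : ℝ) := by positivity
          rw [e1] at hm1
          linarith
  have hE₂ : ∀ u, chainLaw (M.stepKernel G ε) (Measure.dirac p₀) (E₂ u) ≤
      ENNReal.ofReal (Real.exp (-s⁻¹)) := fun u =>
    (chainLaw_count_ge_le (M.stepKernel G ε) (Measure.dirac p₀) (M.measurableSet_changes a B (U u))
      (by positivity) (hstep (U u) (hdiam u)) m (c / s)).trans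
      (ENNReal.ofReal_le_ofReal (pow_mul_two_rpow_le hs hP hT (by lia) hm2))
  have h1 : ∀ᵐ w ∂(M.procLaw G ε p₀), IsClock w.1 :=
    Measure.quasiMeasurePreserving_fst.ae ae_isClock
  have h2 := Measure.quasiMeasurePreserving_snd (μ := clockLaw).ae
    ((M.ae_chainLaw_monotone G ε p₀).and (M.ae_chainLaw_jumps hn hΛ hε ha hB hscale p₀))
  have hsub : {w | zeta ε δ w < min (T : EReal) (kappa ε ρ w)} ≤ᵐ[M.procLaw G ε p₀]
      (E₁ ×ˢ univ ∪ univ ×ˢ ⋃ u, E₂ u : Set ((ℕ → ℝ) × (ℕ → Cplus n × Eucl n))) := by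
    filter_upwards [h1, h2] with w hτ ⟨⟨hw0, hmono⟩, hjump⟩ hlt
    obtain ⟨k, hkT, hk1, hk2⟩ := exists_of_zeta_lt hε hτ hlt
    by_cases hE : w.1 ∈ E₁
    · exact Or.inl ⟨hE, mem_univ _⟩
    refine Or.inr ⟨mem_univ _, mem_iUnion.2 ?_⟩
    have hkm : k ≤ m := by
      by_contra hkm
      refine hE ?_
      have h3 := ((hτ.strictMono_arrival hε) (not_le.1 hkm)).le.trans hkT.le
      rw [arrival_eq] at h3
      change ∑ i ∈ Finset.range m, w.1 i ≤ T / ε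
      rw [le_div_iff₀ hε']
      linarith
    rw [eLpNorm_eq_nrm, eLpNorm_eq_nrm, ← ENNReal.ofReal_one,
      ← ENNReal.ofReal_add zero_le_one (nrm_nonneg _ _), ENNReal.ofReal_le_ofReal_iff
        (add_nonneg zero_le_one (nrm_nonneg _ _))] at hk2
    have hA : ∀ l ≤ k, (w.2 l).1 ∈ A n 2 a := fun l hl => by
      refine ⟨fun θ => (hp₀ θ).trans ?_, ?_⟩
      · have h3 : (w.2 0).1.1 θ ≤ (w.2 l).1.1 θ := hmono (Nat.zero_le l) θ
        rwa [hw0] at h3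
      · refine (eLpNorm_mono (g := (w.2 k).1.1) fun θ => ?_).trans ?_
        · rw [Real.norm_of_nonneg ((w.2 l).1.2 θ).le, Real.norm_of_nonneg ((w.2 k).1.2 θ).le]
          exact hmono hl θ
        · rw [eLpNorm_eq_nrm]
          exact ENNReal.ofReal_le_ofReal (hk2.trans hρ)
    refine M.exists_count_ge hΛ0 hs hs1 hc0 hcov hmono hjump hkm hA ?_
    rw [hw0]
    refine hδ.trans ?_
    rw [eLpNorm_eq_nrm] at hk1
    exact (ENNReal.ofReal_lt_ofReal_iff_of_nonneg (le_trans (by positivity) hδ.le)).1 hk1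
  refine (measure_mono_ae hsub).trans ((measure_union_le _ _).trans (add_le_add ?_ ?_))
  · rw [procLaw, jumpLaw, Measure.prod_prod, measure_univ, mul_one]
    exact hE₁
  · rw [procLaw, jumpLaw, Measure.prod_prod, measure_univ, one_mul]
    calc _ ≤ ∑ u, chainLaw (M.stepKernel G ε) (Measure.dirac p₀) (E₂ u) :=
          measure_iUnion_fintype_le _ _
      _ ≤ ∑ _u : Fin n → Fin K, ENNReal.ofReal (Real.exp (-s⁻¹)) :=
          Finset.sum_le_sum fun u _ => hE₂ u
      _ = ENNReal.ofReal ((K : ℝ) ^ n * Real.exp (-s⁻¹)) := by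
          rw [Finset.sum_const, Finset.card_univ, Fintype.card_fun, Fintype.card_fin,
            Fintype.card_fin, nsmul_eq_mul, ENNReal.ofReal_mul (by positivity),
            ENNReal.ofReal_pow (by positivity), ENNReal.ofReal_natCast, Nat.cast_pow]
      _ ≤ _ := by
          refine ENNReal.ofReal_le_ofReal ?_
          rw [← div_eq_mul_inv]
          gcongr

/-- As long as `‖R‖_2` is bounded, (U) bounds the density of the hitting angle.  A given cap of
radius `ε^{1/n}` is then hit about `ε^{-1/n}` times up to time `T`, with an exponentially small
probability of many more hits, while every hit adds `O(ε^{1/n})` to the domain there. -/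
theorem UpperF.tendsto_zeta_lt {M : GrowthModel n} (hn : 2 ≤ n) (hU : M.UpperF)
    (G : BumpFamily n) (r₀ ρ : Cplus n) {T : ℝ} (hT : 0 ≤ T) :
    ∃ δₙ : ℝ, 0 < δₙ ∧ ∀ x₀ : ℝ≥0 → Eucl n,
      ∀ δ ∈ Ioo 0 δₙ, Tendsto (fun ε : ℝ≥0 => M.procLaw G ε (r₀, x₀ ε)
        {w | zeta ε δ w < min (T : EReal) (kappa ε ρ w)}) (𝓝[>] 0) (𝓝 0) := by
  obtain ⟨Λ, hΛ⟩ := G.bounded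
  have hΛ' : ∀ η ∈ Ioo (0 : ℝ) 1, ∀ t, η ^ (n - 1) * G.g η t ≤ |Λ| + 1 := fun η hη t =>
    (hΛ η hη t).trans (by linarith [le_abs_self Λ])
  have hΛ0 : 0 < |Λ| + 1 := by positivity
  obtain ⟨c₀, hc₀, hr₀⟩ := exists_lower r₀
  obtain ⟨a, ha, hac, haC⟩ := exists_mem_A c₀ (1 + nrm 2 ρ.1) hc₀
  obtain ⟨B, hB⟩ := hU a ha
  obtain ⟨P, hP, hstep⟩ := M.stepKernel_changes_le hn G ha.1 (abs_nonneg B)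
  -- `Λ s` for the first jump, and `Λ s` for each of at most `c / s` further changes on a cell
  set D := ‖r₀.1‖ + (|Λ| + 1) * (1 + 2 * ((4 * T + 2) * P + 1))
  have hD : 0 < D := by positivity
  refine ⟨D⁻¹, inv_pos.2 hD, fun x₀ δ hδ => ?_⟩
  have hδ' : D < δ⁻¹ := by
    rw [lt_inv_comm₀ hD hδ.1]
    exact hδ.2
  have hs0 : Tendsto (fun ε : ℝ≥0 => (ε : ℝ)) (𝓝[>] 0) (𝓝[>] 0) :=
    tendsto_nhdsWithin_iff.2 ⟨(NNReal.continuous_coe.tendsto 0).mono_left nhdsWithin_le_nhds,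
      by filter_upwards [self_mem_nhdsWithin] with ε hε using NNReal.coe_pos.2 hε⟩
  have hroot : Tendsto (fun ε : ℝ≥0 => (ε : ℝ) ^ (1 / (n : ℝ))) (𝓝[>] 0) (𝓝[>] 0) :=
    tendsto_nhdsWithin_iff.2 ⟨tendsto_root hn, by
      filter_upwards [self_mem_nhdsWithin] with ε hε
      exact Real.rpow_pos_of_pos (NNReal.coe_pos.2 hε) _⟩
  have ht1 : Tendsto (fun ε : ℝ≥0 => Real.exp (-(2 * (ε : ℝ))⁻¹)) (𝓝[>] 0) (𝓝 0) := by
    have h1 := (tendsto_inv_nhdsGT_zero.comp hs0).const_mul_atTop (one_half_pos (α := ℝ))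
    refine (Real.tendsto_exp_neg_atTop_nhds_zero.comp h1).congr fun ε => ?_
    simp only [Function.comp_apply, mul_inv]
    norm_num
  have ht2 : Tendsto (fun ε : ℝ≥0 => (3 * ((ε : ℝ) ^ (1 / (n : ℝ)))⁻¹) ^ n *
      Real.exp (-((ε : ℝ) ^ (1 / (n : ℝ)))⁻¹)) (𝓝[>] 0) (𝓝 0) := by
    have h1 := ((Real.tendsto_pow_mul_exp_neg_atTop_nhds_zero n).comp
      (tendsto_inv_nhdsGT_zero.comp hroot)).const_mul ((3 : ℝ) ^ n)
    rw [mul_zero] at h1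
    refine h1.congr fun ε => ?_
    simp only [Function.comp_apply, mul_pow]
    ring
  have hlim := (ENNReal.tendsto_ofReal ht1).add (ENNReal.tendsto_ofReal ht2)
  rw [ENNReal.ofReal_zero, add_zero] at hlim
  have hle1 : ∀ᶠ ε : ℝ≥0 in 𝓝[>] 0, ε ∈ Ioc (0 : ℝ≥0) 1 := Ioc_mem_nhdsGT one_pos
  refine tendsto_of_tendsto_of_tendsto_of_le_of_le' tendsto_const_nhds hlim
    (Eventually.of_forall fun _ => zero_le) ?_
  filter_upwards [hle1, M.eventually_scale_lt_one hn ha.1] with ε hε hscale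
  exact M.procLaw_zeta_lt_le hn hΛ0 hΛ' hε.1 hε.2 ha.1
    (fun q hq θ => (hB q hq θ).trans (le_abs_self B)) hscale hP (hstep ε hε.1) hT
    (fun θ => hac.trans (hr₀ θ)) haC hδ'

end GrowthModel

end StarGrowth

open StarGrowth in
theorem proposition1p4 (n : ℕ) (hn : 2 ≤ n) :
    -- (a), boundedness of `F` in `L^p` follows from the upper bound, or from the Lipschitz bounds
    (∀ (M : GrowthModel n) (p : ℝ≥0∞), (p = 2 ∨ p = ∞) →
      (M.UpperF ∨
        ((∀ a ∈ Ioo (0 : ℝ) 1, ∃ K, M.LipF p a K) ∧ ∀ a ∈ Ioo (0 : ℝ) 1, ∃ K, M.LipH a K)) →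
      ∀ a ∈ Ioo (0 : ℝ) 1, ∃ B, M.BddF p a B) ∧
    -- (a), Lipschitz bound on `b`
    (∀ p : ℝ≥0∞, (p = 2 ∨ p = ∞) → ∀ a ∈ Ioo (0 : ℝ) 1, ∀ K B : ℝ≥0, ∃ C : ℝ≥0,
      ∀ M : GrowthModel n, M.LipF p a K → M.BddF p a B → M.LipB p a C) ∧
    -- (a), Lipschitz bound on `h`
    (∀ a ∈ Ioo (0 : ℝ) 1, ∀ K : ℝ≥0, ∃ C : ℝ≥0,
      ∀ M : GrowthModel n, M.LipF 2 a K → M.LipH a K → M.Liph a C) ∧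
    -- (a), Lipschitz bound on the averaged drift
    (∀ M : GrowthModel n,
      (∀ p : ℝ≥0∞, (p = 2 ∨ p = ∞) → ∀ a ∈ Ioo (0 : ℝ) 1, ∃ K, M.LipF p a K) →
      (∀ a ∈ Ioo (0 : ℝ) 1, ∃ K, M.LipH a K) → M.UpperF → M.LowerF →
      (∀ r, ∃! μ, M.IsInvariant r μ) ∧
        ∀ ν : Cplus n → Measure (Eucl n), (∀ r, M.IsInvariant r (ν r)) →
          ∀ p : ℝ≥0∞, (p = 2 ∨ p = ∞) → ∀ a ∈ Ioo (0 : ℝ) 1, ∃ K, M.LipBar ν p a K) ∧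
    -- (b)
    (∀ (M : GrowthModel n) (ν : Cplus n → Measure (Eucl n)), (∀ r, M.IsInvariant r (ν r)) →
      (∀ a ∈ Ioo (0 : ℝ) 1, ∃ K, M.LipBar ν ∞ a K) → M.UpperF →
      ∀ r₀ : Cplus n, ∃ r : ℝ → Cplus n, M.IsSolution ν r₀ r ∧
        (∀ r' : ℝ → Cplus n, M.IsSolution ν r₀ r' → EqOn r' r (Ici 0)) ∧
        ∀ T : ℝ, ∃ a₁ ∈ Ioo (0 : ℝ) 1, ∀ t ∈ Icc 0 T, r t ∈ GrowthModel.A n ∞ a₁) ∧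
    -- (c)
    (∀ M : GrowthModel n, (∀ a ∈ Ioo (0 : ℝ) 1, ∃ B, M.BddF 2 a B) →
      M.Minorisation → M.AssumptionE) ∧
    -- (d)
    (∀ (M : GrowthModel n) (G : BumpFamily n), M.UnifLipF →
      ∀ (r₀ : Cplus n) (x₀ : ℝ≥0 → Eucl n),
        ((∃ x, (r₀, x) ∈ M.dom ∧ ∀ ε, x₀ ε = x) ∨
          ∃ a ∈ Ioo (0 : ℝ) 1, ∀ ε ∈ Ioc (0 : ℝ≥0) 1, (r₀, x₀ ε) ∈ M.Ae ∞ a) →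
        M.AssumptionC G r₀ x₀) ∧
    -- (e)
    (∀ (M : GrowthModel n) (G : BumpFamily n), M.UpperF →
      ∀ ν : Cplus n → Measure (Eucl n), (∀ r, M.IsInvariant r (ν r)) →
      ∀ (r₀ : Cplus n) (r : ℝ → Cplus n), M.IsSolution ν r₀ r →
      ∀ T : ℝ, 0 ≤ T → ∃ δₙ : ℝ, 0 < δₙ ∧
        ∀ x₀ : ℝ≥0 → Eucl n, (∀ ε ∈ Ioc (0 : ℝ≥0) 1, (r₀, x₀ ε) ∈ M.dom) →
        ∀ δ ∈ Ioo 0 δₙ,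
          Tendsto (fun ε : ℝ≥0 => M.procLaw G ε (r₀, x₀ ε)
              {w | GrowthModel.zeta ε δ w <
                min (T : EReal) (GrowthModel.kappa ε (r T) w)})
            (𝓝[>] 0) (𝓝 0)) := by
  have hfact : ∀ p : ℝ≥0∞, p = 2 ∨ p = ∞ → Fact (1 ≤ p) := by
    rintro p (rfl | rfl)
    · exact ⟨by norm_num⟩
    · exact ⟨le_top⟩
  refine ⟨fun M p hp h a ha => ?_, fun p hp a ha K B => ?_, fun a _ K => exists_liph K,
    fun M hF hH hU hL => ⟨fun r => ?_, fun ν hν p hp a ha => ?_⟩,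
    fun M ν hν hLip hU r₀ => M.exists_isSolution hU hν hLip hn r₀,
    fun M => GrowthModel.assumptionE,
    fun M G hM r₀ x₀ hx₀ => hM.assumptionC hn G r₀ x₀ hx₀,
    fun M G hU ν _ r₀ r _ T hT => ?_⟩
  · have := hfact p hp
    rcases h with hU | ⟨hF, hH⟩
    · exact hU.bddF hp ha
    · obtain ⟨K, hK⟩ := hF a ha
      obtain ⟨K', hK'⟩ := hH a ha
      exact hK.bddF hp ha.1 hK'
  · have := hfact p hp
    exact exists_lipB hp ha.1 K B
  · obtain ⟨a, ha, hr⟩ := GrowthModel.exists_mem_A_top r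
    obtain ⟨c, hc, hlow⟩ := hL _ (GrowthModel.div_normConst_mem ha)
    exact GrowthModel.existsUnique_isInvariant (GrowthModel.A_top_subset_two ha.1 hr)
      (GrowthModel.minorised_of_lower hc hlow)
  · have := hfact p hp
    exact GrowthModel.exists_lipBar hF hH hU hL hν hp ha
  · obtain ⟨δₙ, hδ, h⟩ := hU.tendsto_zeta_lt hn G r₀ (r T) hT
    exact ⟨δₙ, hδ, fun x₀ _ => h x₀⟩
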